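/- Let $G=\mathrm{Sp}_4(\mathbb C)$, let $T$ be a maximal torus, $\Lambda=\mathrm{Hom}(T,\mathbb C^*)$ its weight lattice, $W_0$ the Weyl group, and $W=W_0\ltimes\Lambda$ the extended affine Weyl group. Let $\alpha_1$ (long) and $\alpha_2$ (short) be the simple roots, and let $s,t\in W_0$ be the corresponding simple reflections. Let $x_1=\alpha_1+\alpha_2$ and $x_2=\tfrac12\alpha_1+\alpha_2$ be the fundamental dominant weights. Define $r,\omega\in W$ by $x_1=stsr$ and $x_2=\omega rsr$, where weights are regarded as elements of $W$. Then $W=\Omega\ltimes W'$, where $\Omega=\{e,\omega\}$ and $W'$ is the affine Weyl group of type $\widetilde B_2$ with simple reflections $r,s,t$, satisfying $rt=tr$, $(rs)^4=(st)^4=e$, $\omega r=t\omega$ and $\omega s=s\omega$. The length function $l$ and the Bruhat order $\le$ of $W'$ are extended to $W$ as usual: $l(\omega w)=l(w)$, and for $u,u'\in\Omega$ and $w,w'\in W'$, $uw\le u'w'$ if and only if $u=u'$ and $w\le w'$. Let $\mathcal H$ be the Hecke algebra of $W$ over $\mathcal A=\mathbb Z[q^{1/2},q^{-1/2}]$ with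 standard basis $(T_w)_{w\in W}$, so that $T_wT_u=T_{wu}$ if $l(wu)=l(w)+l(u)$, and $(T_g+1)(T_g-q)=0$ for $g\in\{r,s,t\}$. Let $C_w=q^{-l(w)/2}\sum_{y\le w}P_{y,w}T_y$ be its Kazhdan–Lusztig basis, where $P_{y,w}$ are the Kazhdan–Lusztig polynomials, and put $[2]=q^{1/2}+q^{-1/2}$. Let $w_0=stst$ be the longest element of $W_0$ and let $\Lambda^+=\{x\in\Lambda\mid l(xw_0)=l(x)+l(w_0)\}$ be the set of dominant weights. For $x\in\Lambda$ put $\theta_x=(q^{-l(x')/2}T_{x'})(q^{-l(x'')/2}T_{x''})^{-1}$, where $x',x''\in\Lambda^+$ are such that $x=x'-x''$; this does not depend on the choice of $x',x''$. For $x\in\Lambda^+$ let $z_x=\sum_{x'\in W_0(x)}\theta_{x'}$, the sum over the $W_0$-orbit of $x$, and $$S_x=\sum_{x'\in\Lambda^+,\ x'\le x}d_{x'}(x)\,z_{x'},$$ where here $x'\le x$ means that $x-x'$ is a sum of positive roots, and $d_{x'}(x)$ is the multiplicity of the weight $x'$ in the rational irreducible $G$-module $V(x)$ of highest weight $x$.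 Then $$C_{rt}S_{x_1}=C_{rststr}+C_{tsrsrt}-[2]C_{rtsrt}+C_{rt}$$ and $$C_{rt}S_{x_2}=(C_{rtsrt}-[2]C_{rt})C_\omega .$$ -/

import Mathlib

noncomputable section

namespace SpFour

/-! ### The root datum of `Sp₄(ℂ)` -/

/-- The weight lattice `Λ = Hom(T, ℂˣ)` of `Sp₄(ℂ)`, where `T` is the diagonal maximal torus:
`(m, n)` is the character `diag(a, b, a⁻¹, b⁻¹) ↦ a ^ m * b ^ n`. -/
abbrev Weight : Type := ℤ × ℤ

/-- The long simple root `α₁`, i.e. the character `a ^ 2`. -/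
def longRoot : Weight := (2, 0)

/-- The short simple root `α₂`, i.e. the character `a⁻¹ * b`. -/
def shortRoot : Weight := (-1, 1)

/-- The fundamental dominant weight `x₁ = α₁ + α₂`, i.e. the character `a * b`. -/
def x₁ : Weight := (1, 1)

/-- The fundamental dominant weight `x₂ = ½ α₁ + α₂`, i.e. the character `b`. -/
def x₂ : Weight := (0, 1)

/-- The dominance order: `x' ≤ x` iff `x - x'` is a sum of positive roots. -/
def DominanceLE (x' x : Weight) : Prop :=
  ∃ k l : ℕ, x - x' = k • longRoot + l • shortRoot

/-- The reflection `x ↦ x - ⟨x, α₁^∨⟩ α₁ = (-m, n)` of the long simple root. -/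
def longReflection : Weight ≃ₗ[ℤ] Weight where
  toFun x := (-x.1, x.2)
  invFun x := (-x.1, x.2)
  map_add' x y := by ext <;> simp [add_comm]
  map_smul' c x := by ext <;> simp
  left_inv x := by simp
  right_inv x := by simp

/-- The reflection `x ↦ x - ⟨x, α₂^∨⟩ α₂ = (n, m)` of the short simple root. -/
def shortReflection : Weight ≃ₗ[ℤ] Weight where
  toFun x := (x.2, x.1)
  invFun x := (x.2, x.1)
  map_add' _ _ := rfl
  map_smul' _ _ := rfl
  left_inv _ := rfl
  right_inv _ := rfl

/-- The Weyl group `W₀`, as the group of automorphisms of `Λ` generated by the simple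
reflections. -/
def weylGroup : Subgroup (Weight ≃ₗ[ℤ] Weight) :=
  Subgroup.closure {longReflection, shortReflection}

/-! ### The extended affine Weyl group -/

/-- The action of `W₀` on `Λ`, with `Λ` written multiplicatively. -/
def weylAction : weylGroup →* MulAut (Multiplicative Weight) where
  toFun σ := AddEquiv.toMultiplicative (σ : Weight ≃ₗ[ℤ] Weight).toAddEquiv
  map_one' := rfl
  map_mul' _ _ := rfl

/-- The extended affine Weyl group `W = W₀ ⋉ Λ`. -/
abbrev ExtAffineWeyl : Type := Multiplicative Weight ⋊[weylAction] weylGroup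

/-- A weight, regarded as an element of `W`. -/
def weightElt (x : Weight) : ExtAffineWeyl := SemidirectProduct.inl (Multiplicative.ofAdd x)

/-- The simple reflection `s` of the long simple root. -/
def s : ExtAffineWeyl :=
  SemidirectProduct.inr ⟨longReflection, Subgroup.subset_closure (by simp)⟩

/-- The simple reflection `t` of the short simple root. -/
def t : ExtAffineWeyl :=
  SemidirectProduct.inr ⟨shortReflection, Subgroup.subset_closure (by simp)⟩

/-- The affine simple reflection `r`, determined by `x₁ = s * t * s * r`. Here `s * t * s` is the
reflection of the highest short root `x₁`. -/
def r : ExtAffineWeyl := s * t * s * weightElt x₁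

/-- The element `ω` of length zero and order two, determined by `x₂ = ω * r * s * r`. -/
def ω : ExtAffineWeyl := weightElt x₂ * (r * s * r)⁻¹

/-- The set `S` of simple reflections. -/
def simpleReflections : Set ExtAffineWeyl := {r, s, t}

/-- The longest element `w₀` of `W₀`. -/
def w₀ : ExtAffineWeyl := s * t * s * t

/-- The length on `W = Ω ⋉ W'`, where `Ω = {1, ω}`: the least `n` such that `w = u * s₁ ⋯ sₙ` with
`u ∈ Ω` and all `sᵢ ∈ S`. -/
def length (w : ExtAffineWeyl) : ℕ :=
  sInf {n | ∃ u ∈ ({1, ω} : Set ExtAffineWeyl), ∃ L : List ExtAffineWeyl,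
    (∀ g ∈ L, g ∈ simpleReflections) ∧ L.length = n ∧ w = u * L.prod}

/-- The Bruhat order on `W`: the reflexive transitive closure of `u → u * τ`, for reflections `τ`
(conjugates of simple reflections) with `length u < length (u * τ)`. As reflections lie in `W'`,
elements of different cosets of `W'` are incomparable. -/
def BruhatLE : ExtAffineWeyl → ExtAffineWeyl → Prop :=
  Relation.ReflTransGen fun u v =>
    ∃ x : ExtAffineWeyl, ∃ g ∈ simpleReflections,
      v = u * (x * g * x⁻¹) ∧ length u < length v

/-- The set `Λ⁺` of dominant weights, `{x ∈ Λ | l(x w₀) = l(x) + l(w₀)}`. -/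
def dominantWeights : Set Weight :=
  {x | length (weightElt x * w₀) = length (weightElt x) + length w₀}

/-! ### The Hecke algebra -/

/-- The ring `𝒜 = ℤ[q^{1/2}, q^{-1/2}]`; its variable `LaurentPolynomial.T 1` is `q^{1/2}`. -/
abbrev Coeff : Type := LaurentPolynomial ℤ

/-- `qHalfPow k` is `q^{k/2}`. -/
def qHalfPow (k : ℤ) : Coeff := LaurentPolynomial.T k

/-- The element `[2] = q^{1/2} + q^{-1/2}`. -/
def two : Coeff := qHalfPow 1 + qHalfPow (-1)

/-- The defining relations of the Hecke algebra of `W`: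
`T_1 = 1`, `T_w T_u = T_{wu}` if `l(wu) = l(w) + l(u)`, and `(T_g + 1)(T_g - q) = 0` for
`g ∈ S`. -/
inductive HeckeRel : FreeAlgebra Coeff ExtAffineWeyl → FreeAlgebra Coeff ExtAffineWeyl → Prop
  | one : HeckeRel (FreeAlgebra.ι Coeff 1) 1
  | mul (w u : ExtAffineWeyl) (h : length (w * u) = length w + length u) :
      HeckeRel (FreeAlgebra.ι Coeff w * FreeAlgebra.ι Coeff u) (FreeAlgebra.ι Coeff (w * u))
  | quadratic (g : ExtAffineWeyl) (h : g ∈ simpleReflections) :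
      HeckeRel ((FreeAlgebra.ι Coeff g + 1) *
        (FreeAlgebra.ι Coeff g - algebraMap Coeff _ (qHalfPow 2))) 0

/-- The generic Hecke algebra `ℋ` of `W` over `𝒜`. -/
abbrev Hecke : Type := RingQuot HeckeRel

/-- The standard basis element `T_w`. -/
def T (w : ExtAffineWeyl) : Hecke :=
  RingQuot.mkAlgHom Coeff HeckeRel (FreeAlgebra.ι Coeff w)

/-! ### The Kazhdan-Lusztig basis -/

/-- A polynomial in `q`, as an element of `𝒜`. -/
def polyInQ (p : Polynomial ℤ) : Coeff := Polynomial.aeval (qHalfPow 2) p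

/-- The element `q^{-l(w)/2} ∑_y P_y T_y`. -/
def klSum (w : ExtAffineWeyl) (P : ExtAffineWeyl →₀ Polynomial ℤ) : Hecke :=
  P.sum fun y p => (qHalfPow (-(length w : ℤ)) * polyInQ p) • T y

/-- The image of `klSum w P` under the bar involution
`∑ a_y T_y ↦ ∑ bar(a_y) (T_{y⁻¹})⁻¹`, where `bar(q^{1/2}) = q^{-1/2}`. -/
def klSumBar (w : ExtAffineWeyl) (P : ExtAffineWeyl →₀ Polynomial ℤ) : Hecke :=
  P.sum fun y p =>
    LaurentPolynomial.invert (qHalfPow (-(length w : ℤ)) * polyInQ p) • Ring.inverse (T y⁻¹)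

/-- `y ↦ P y` is the family `y ↦ P_{y,w}` of Kazhdan-Lusztig polynomials: it is supported on
`{y | y ≤ w}`, `P_{w,w} = 1`, `deg P_{y,w} ≤ (l(w) - l(y) - 1) / 2` for `y < w`, and
`q^{-l(w)/2} ∑_{y ≤ w} P_{y,w} T_y` is fixed by the bar involution. -/
structure IsKLFamily (w : ExtAffineWeyl) (P : ExtAffineWeyl →₀ Polynomial ℤ) : Prop where
  support_le : ∀ y, P y ≠ 0 → BruhatLE y w
  self : P w = 1
  degree_le : ∀ y, BruhatLE y w → y ≠ w → 2 * (P y).natDegree + length y + 1 ≤ length w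
  bar_eq : klSumBar w P = klSum w P

open Classical in
/-- The Kazhdan-Lusztig polynomials `y ↦ P_{y,w}`. -/
def klPoly (w : ExtAffineWeyl) : ExtAffineWeyl →₀ Polynomial ℤ :=
  if h : ∃ P, IsKLFamily w P then h.choose else 0

/-- The Kazhdan-Lusztig basis element `C_w = q^{-l(w)/2} ∑_{y ≤ w} P_{y,w} T_y`. -/
def C (w : ExtAffineWeyl) : Hecke := klSum w (klPoly w)

/-! ### Rational irreducible representations of `Sp₄(ℂ)` -/

/-- The group `Sp₄(ℂ)`. -/
abbrev Sp : Type := Matrix.symplecticGroup (Fin 2) ℂ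

/-- The element `diag(a, b, a⁻¹, b⁻¹)` of the maximal torus. -/
def torus (a b : ℂˣ) : Sp :=
  ⟨Matrix.diagonal (Sum.elim ![(a : ℂ), b] ![(a : ℂ)⁻¹, (b : ℂ)⁻¹]), by
    rw [SymplecticGroup.mem_iff]
    ext i j
    rcases i with i | i <;> rcases j with j | j <;> fin_cases i <;> fin_cases j <;>
      simp [Matrix.J, Matrix.diagonal_mul, Matrix.mul_diagonal]⟩

variable {V : Type*} [AddCommGroup V] [Module ℂ V]

/-- A representation is rational if its matrix coefficients are regular functions on `Sp₄(ℂ)`,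
i.e. polynomials in the matrix entries. -/
def IsRational (ρ : Representation ℂ Sp V) : Prop :=
  ∀ (f : Module.Dual ℂ V) (v : V),
    ∃ p : MvPolynomial ((Fin 2 ⊕ Fin 2) × (Fin 2 ⊕ Fin 2)) ℂ,
      ∀ g : Sp, f (ρ g v) = MvPolynomial.eval (fun ij => g.1 ij.1 ij.2) p

/-- The weight space `V_x`. -/
def weightSpace (ρ : Representation ℂ Sp V) (x : Weight) : Submodule ℂ V :=
  ⨅ a : ℂˣ, ⨅ b : ℂˣ, Module.End.eigenspace (ρ (torus a b)) ((a ^ x.1 * b ^ x.2 : ℂˣ) : ℂ)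

/-- `V` is a rational irreducible `Sp₄(ℂ)`-module of highest weight `x`. -/
structure IsIrrepOfHighestWeight (ρ : Representation ℂ Sp V) (x : Weight) : Prop where
  finite : FiniteDimensional ℂ V
  rational : IsRational ρ
  irreducible : ρ.IsIrreducible
  weight : weightSpace ρ x ≠ ⊥
  highest : ∀ x', weightSpace ρ x' ≠ ⊥ → DominanceLE x' x

open Classical in
/-- `weightMult x x'` is `d_{x'}(x)`, the multiplicity of the weight `x'` in the rational
irreducible module `V(x)` of highest weight `x` (realised, after a choice of basis, on `ℂⁿ`). -/
def weightMult (x x' : Weight) : ℕ :=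
  if h : ∃ V : Σ n : ℕ, Representation ℂ Sp (Fin n → ℂ), IsIrrepOfHighestWeight V.2 x then
    Module.finrank ℂ (weightSpace h.choose.2 x')
  else 0

/-! ### The center of the Hecke algebra -/

/-- Bernstein's element `θ_x = (q^{-l(x')/2} T_{x'}) (q^{-l(x'')/2} T_{x''})⁻¹`, for a choice of
dominant `x', x''` with `x = x' - x''` (it does not depend on the choice). -/
def θ (x : Weight) : Hecke :=
  let p : Weight × Weight := Classical.epsilon fun p =>
    p.1 ∈ dominantWeights ∧ p.2 ∈ dominantWeights ∧ x = p.1 - p.2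
  (qHalfPow (-(length (weightElt p.1) : ℤ)) • T (weightElt p.1)) *
    Ring.inverse (qHalfPow (-(length (weightElt p.2) : ℤ)) • T (weightElt p.2))

/-- `z_x`, the sum of `θ_{x'}` over the `W₀`-orbit of `x`. -/
def z (x : Weight) : Hecke := ∑ᶠ x' ∈ MulAction.orbit weylGroup x, θ x'

/-- `S_x = ∑ d_{x'}(x) z_{x'}`, over the dominant weights `x' ≤ x`. -/
def S (x : Weight) : Hecke :=
  ∑ᶠ x' ∈ {x' | x' ∈ dominantWeights ∧ DominanceLE x' x}, weightMult x x' • z x'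

end SpFour

end

noncomputable section

namespace SpFour

/-! Every ingredient can be made explicit, and both identities then become computations in an
algebra with three generators.

The group. An element of `W` is an affine map of the plane with a signed permutation matrix as
linear part, so it is recorded by six integers. Its length is the number of walls separating the
fundamental alcove from its image (`length_eq_sep`), so lengths, reducedness and dominance become
integer arithmetic. The exchange condition is geometric: when passing to an adjacent alcove crosses
a wall of the fundamental alcove, that wall is the common one.

The Hecke algebra. It is given by a presentation, so linear independence of the `T w` must be
proved. Left and right generators act on the free module on `W` and commute, by the exchange
condition; this gives the left regular representation. The presentation also yields the bar
involution, which is triangular with respect to length. Hence a bar-invariant element whose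
coefficients satisfy the degree bounds is the Kazhdan–Lusztig element (`C_eq_klSum`). With `CGen i`
the element of a simple reflection, the required ones are `C_rt = C_r C_t`, `C_rtsrt = C_r C_t C_s
C_r C_t - [2] C_r C_t`, and `C_rststr = C_r C_stst C_r` with `C_stst = C_s C_t C_s C_t - 2 C_s C_t`;
the last has a counterpart with `r` and `t` exchanged.

The elements `S`. The orbits of `x₁` and `x₂` have four elements each, and every `θ` involved is a
product of factors `CGen i - q^{-1/2}` (normalised `T`), `CGen i - q^{1/2}` (its inverse) and `T ω`.
The claims become `key_identity_one` and `key_identity_two`. They follow from the quadratic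
relations and from the commutation of `C_r` and `C_t`; the first also needs the braid relations.

The multiplicities. The coefficients `d` come from an unspecified choice of irreducible module, so
both existence and independence of the choice are needed. For independence, a matrix coefficient of
a highest weight vector is invariant under opposite maximal unipotent groups on the two sides and
has a fixed torus weight on the left. It is therefore determined by its value at the identity,
because the big cell is dense. The module is recovered as the span of the right translates of this
function. For existence, the modules are `ℂ⁴` and the five-dimensional primitive part of its
exterior square, whose weights are pairwise distinct; all relevant multiplicities are one. -/

/-! ### Affine frames -/

/-- The affine map `v ↦ (p, q) + v.1 • (a, b) + v.2 • (c, d)` of the weight lattice. -/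
@[ext]
structure Frame where
  /-- first coordinate of the image of the origin -/
  p : ℤ
  /-- second coordinate of the image of the origin -/
  q : ℤ
  /-- first coordinate of the linear image of `(1, 0)` -/
  a : ℤ
  /-- second coordinate of the linear image of `(1, 0)` -/
  b : ℤ
  /-- first coordinate of the linear image of `(0, 1)` -/
  c : ℤ
  /-- second coordinate of the linear image of `(0, 1)` -/
  d : ℤ

/-- The affine map given by an element of `W`. -/
def frame (w : ExtAffineWeyl) : Frame where
  p := (Multiplicative.toAdd w.left).1
  q := (Multiplicative.toAdd w.left).2
  a := ((w.right : Weight ≃ₗ[ℤ] Weight) (1, 0)).1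
  b := ((w.right : Weight ≃ₗ[ℤ] Weight) (1, 0)).2
  c := ((w.right : Weight ≃ₗ[ℤ] Weight) (0, 1)).1
  d := ((w.right : Weight ≃ₗ[ℤ] Weight) (0, 1)).2

/-- Composition of affine maps. -/
def Frame.mul (F G : Frame) : Frame where
  p := F.p + (G.p * F.a + G.q * F.c)
  q := F.q + (G.p * F.b + G.q * F.d)
  a := G.a * F.a + G.b * F.c
  b := G.a * F.b + G.b * F.d
  c := G.c * F.a + G.d * F.c
  d := G.c * F.b + G.d * F.d

lemma linearEquiv_apply_eq (f : Weight ≃ₗ[ℤ] Weight) (x : Weight) :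
    f x = x.1 • f (1, 0) + x.2 • f (0, 1) := by
  conv_lhs => rw [show x = x.1 • (1, 0) + x.2 • (0, 1) by ext <;> simp]
  rw [map_add, map_smul, map_smul]

lemma frame_injective : Function.Injective frame := by
  intro w w' h
  have hp := congrArg Frame.p h
  have hq := congrArg Frame.q h
  have ha := congrArg Frame.a h
  have hb := congrArg Frame.b h
  have hc := congrArg Frame.c h
  have hd := congrArg Frame.d h
  refine SemidirectProduct.ext ?_ ?_
  · exact Multiplicative.toAdd.injective (Prod.ext hp hq)
  · refine Subtype.ext (LinearEquiv.ext fun x => ?_)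
    rw [linearEquiv_apply_eq, linearEquiv_apply_eq (w'.right : Weight ≃ₗ[ℤ] Weight)]
    rw [show (w.right : Weight ≃ₗ[ℤ] Weight) (1, 0) = (w'.right : Weight ≃ₗ[ℤ] Weight) (1, 0) from
      Prod.ext ha hb,
      show (w.right : Weight ≃ₗ[ℤ] Weight) (0, 1) = (w'.right : Weight ≃ₗ[ℤ] Weight) (0, 1) from
      Prod.ext hc hd]

lemma frame_mul (w u : ExtAffineWeyl) : frame (w * u) = (frame w).mul (frame u) := by
  have h1 : ∀ x, (weylAction w.right (Multiplicative.ofAdd x)).toAdd =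
      (w.right : Weight ≃ₗ[ℤ] Weight) x := fun _ => rfl
  have h2 : ∀ x, ((w.right * u.right : weylGroup) : Weight ≃ₗ[ℤ] Weight) x =
    (w.right : Weight ≃ₗ[ℤ] Weight) ((u.right : Weight ≃ₗ[ℤ] Weight) x) := fun _ => rfl
  have hl : (w * u).left.toAdd = w.left.toAdd +
      (w.right : Weight ≃ₗ[ℤ] Weight) u.left.toAdd := rfl
  ext <;> simp only [frame, Frame.mul, hl, SemidirectProduct.mul_right, h2] <;>
    rw [linearEquiv_apply_eq (w.right : Weight ≃ₗ[ℤ] Weight)] <;> simp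

lemma frame_one : frame 1 = ⟨0, 0, 1, 0, 0, 1⟩ := rfl
lemma frame_s : frame s = ⟨0, 0, -1, 0, 0, 1⟩ := rfl
lemma frame_t : frame t = ⟨0, 0, 0, 1, 1, 0⟩ := rfl
lemma frame_weightElt (x : Weight) : frame (weightElt x) = ⟨x.1, x.2, 1, 0, 0, 1⟩ := rfl
lemma frame_r : frame r = ⟨-1, -1, 0, -1, -1, 0⟩ := by
  simp [r, x₁, frame_mul, frame_s, frame_t, frame_weightElt, Frame.mul]
lemma s_mul_s : s * s = 1 := by
  apply frame_injective; simp [frame_mul, frame_s, Frame.mul, frame_one]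
lemma t_mul_t : t * t = 1 := by
  apply frame_injective; simp [frame_mul, frame_t, Frame.mul, frame_one]
lemma r_mul_r : r * r = 1 := by
  apply frame_injective; simp [frame_mul, frame_r, Frame.mul, frame_one]
lemma s_inv : s⁻¹ = s := inv_eq_of_mul_eq_one_left s_mul_s
lemma r_inv : r⁻¹ = r := inv_eq_of_mul_eq_one_left r_mul_r
lemma frame_ω : frame ω = ⟨0, -1, 1, 0, 0, -1⟩ := by
  simp [ω, x₂, frame_mul, frame_s, frame_r, frame_weightElt, Frame.mul, r_inv, s_inv]
lemma ω_mul_ω : ω * ω = 1 := by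
  apply frame_injective; simp [frame_mul, frame_ω, Frame.mul, frame_one]
lemma ω_inv : ω⁻¹ = ω := inv_eq_of_mul_eq_one_left ω_mul_ω
lemma ω_mul_r : ω * r = t * ω := by
  apply frame_injective; simp [frame_mul, frame_ω, frame_r, frame_t, Frame.mul]
lemma ω_mul_t : ω * t = r * ω := by
  apply frame_injective; simp [frame_mul, frame_ω, frame_r, frame_t, Frame.mul]
lemma ω_mul_s : ω * s = s * ω := by
  apply frame_injective; simp [frame_mul, frame_ω, frame_s, Frame.mul]

/-- The linear part of the frame of an element of `W` is a signed permutation matrix. -/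
def Frame.IsSigned (F : Frame) : Prop :=
  ((F.a = 1 ∨ F.a = -1) ∧ F.b = 0 ∧ F.c = 0 ∧ (F.d = 1 ∨ F.d = -1)) ∨
    (F.a = 0 ∧ (F.b = 1 ∨ F.b = -1) ∧ (F.c = 1 ∨ F.c = -1) ∧ F.d = 0)

/-- `W₀` preserves the set of coordinate axes and the unit vectors on them. The resulting eight
cases are what makes all later alcove statements decidable by linear integer arithmetic. -/
lemma isSigned_linear (σ : Weight ≃ₗ[ℤ] Weight) (h : σ ∈ weylGroup) :
    Frame.IsSigned ⟨0, 0, (σ (1, 0)).1, (σ (1, 0)).2, (σ (0, 1)).1, (σ (0, 1)).2⟩ := by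
  induction h using Subgroup.closure_induction_left with
  | one => simp [Frame.IsSigned]
  | mul_left x hx y hy ih =>
    rcases hx with rfl | rfl
    · simp only [Frame.IsSigned, LinearEquiv.mul_apply, longReflection, LinearEquiv.coe_mk,
        LinearMap.coe_mk, AddHom.coe_mk] at ih ⊢
      omega
    · simp only [Frame.IsSigned, LinearEquiv.mul_apply, shortReflection, LinearEquiv.coe_mk,
        LinearMap.coe_mk, AddHom.coe_mk] at ih ⊢
      omega
  | inv_mul_cancel x hx y hy ih =>
    have : x⁻¹ = x := by
      refine inv_eq_of_mul_eq_one_left ?_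
      rcases hx with rfl | rfl
      · ext x <;> simp [longReflection]
      · ext x <;> simp [shortReflection]
    rw [this]
    rcases hx with rfl | rfl
    · simp only [Frame.IsSigned, LinearEquiv.mul_apply, longReflection, LinearEquiv.coe_mk,
        LinearMap.coe_mk, AddHom.coe_mk] at ih ⊢
      omega
    · simp only [Frame.IsSigned, LinearEquiv.mul_apply, shortReflection, LinearEquiv.coe_mk,
        LinearMap.coe_mk, AddHom.coe_mk] at ih ⊢
      omega

lemma frame_isSigned (w : ExtAffineWeyl) : (frame w).IsSigned :=
  isSigned_linear _ w.right.2

/-! ### Counting hyperplanes -/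

/-- Four times the first coordinate of the image of the point `-(1/4, 1/2)` of the fundamental
alcove. -/
def Frame.fst (F : Frame) : ℤ := 4 * F.p - F.a - 2 * F.c

/-- Four times the second coordinate of the image of the point `-(1/4, 1/2)` of the fundamental
alcove. -/
def Frame.snd (F : Frame) : ℤ := 4 * F.q - F.b - 2 * F.d

/-- The number of integers between `x / 4` and `-1 / 4`, if `x` is not divisible by `4`. -/
def wallCount (x : ℤ) : ℕ := (x / 4 + 1).natAbs

/-- Off the integers `⌊-y⌋ = -⌊y⌋ - 1`. Reflecting in the wall `0` or `-1` of the strip `(-1, 0)`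
from the side of the strip adds one wall, while reflecting in the middle of the strip preserves the
count; the next two lemmas are the other cases. -/
lemma wallCount_neg {x : ℤ} (h : ¬ 4 ∣ x) (hx : x < 0) : wallCount (-x) = wallCount x + 1 := by
  unfold wallCount; omega

lemma wallCount_reflect {x : ℤ} (h : ¬ 4 ∣ x) : wallCount (-4 - x) = wallCount x := by
  unfold wallCount; omega

lemma wallCount_reflect_succ {x : ℤ} (h : ¬ 4 ∣ x) (hx : -4 < x) :
    wallCount (-8 - x) = wallCount x + 1 := by
  unfold wallCount; omega

/-- The number of hyperplanes separating the fundamental alcove from its image. -/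
def Frame.sep (F : Frame) : ℕ :=
  wallCount F.fst + wallCount F.snd + wallCount (F.snd - F.fst) + wallCount (F.snd + F.fst)

/-- The number of hyperplanes separating the fundamental alcove from its image under `w`. -/
def sep (w : ExtAffineWeyl) : ℕ := (frame w).sep

/-- At the base point the four linear forms take the values `-1/4`, `-1/2`, `-1/4` and `-3/4`. All
lie in `(-1, 0)`, so a single counting function serves the four families of walls. -/
lemma sep_one : sep 1 = 0 := rfl

/-- The simple reflections, indexed by the nodes of the affine Dynkin diagram. -/
def gen : Fin 3 → ExtAffineWeyl := ![r, s, t]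

/-- The value at the image of `-(1/4, 1/2)` of (four times) the affine root which defines the
simple reflection `gen i` and is negative on the fundamental alcove. -/
def Frame.side (F : Frame) : Fin 3 → ℤ := ![-4 - (F.snd + F.fst), F.fst, F.snd - F.fst]

lemma gen_mem (i : Fin 3) : gen i ∈ simpleReflections := by
  fin_cases i <;> simp [gen, simpleReflections]

lemma exists_gen {g : ExtAffineWeyl} (hg : g ∈ simpleReflections) : ∃ i, g = gen i := by
  rcases hg with rfl | rfl | rfl
  exacts [⟨0, rfl⟩, ⟨1, rfl⟩, ⟨2, rfl⟩]

lemma gen_mul_gen (i : Fin 3) : gen i * gen i = 1 := by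
  fin_cases i
  exacts [r_mul_r, s_mul_s, t_mul_t]

/-- The image of the base point lies on no wall: modulo `4` its scaled coordinates are `±1` and `2`
in some order. -/
lemma Frame.IsSigned.not_dvd {F : Frame} (h : F.IsSigned) :
    ¬ 4 ∣ F.fst ∧ ¬ 4 ∣ F.snd ∧ ¬ 4 ∣ F.snd - F.fst ∧ ¬ 4 ∣ F.snd + F.fst := by
  simp only [Frame.IsSigned, Frame.fst, Frame.snd] at h ⊢
  omega

lemma side_ne_zero (w : ExtAffineWeyl) (i : Fin 3) : (frame w).side i ≠ 0 := by
  obtain ⟨h1, h2, h3, h4⟩ := (frame_isSigned w).not_dvd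
  fin_cases i <;> simp [Frame.side] <;> omega

lemma fst_snd_r_mul (w : ExtAffineWeyl) :
    (frame (r * w)).fst = -4 - (frame w).snd ∧ (frame (r * w)).snd = -4 - (frame w).fst := by
  constructor <;> simp [frame_mul, frame_r, Frame.mul, Frame.fst, Frame.snd] <;> ring

lemma fst_snd_s_mul (w : ExtAffineWeyl) :
    (frame (s * w)).fst = - (frame w).fst ∧ (frame (s * w)).snd = (frame w).snd := by
  constructor <;> simp [frame_mul, frame_s, Frame.mul, Frame.fst, Frame.snd] ; ring

lemma fst_snd_t_mul (w : ExtAffineWeyl) :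
    (frame (t * w)).fst = (frame w).snd ∧ (frame (t * w)).snd = (frame w).fst := by
  constructor <;> simp [frame_mul, frame_t, Frame.mul, Frame.fst, Frame.snd]

lemma fst_snd_ω_mul (w : ExtAffineWeyl) :
    (frame (ω * w)).fst = (frame w).fst ∧ (frame (ω * w)).snd = -4 - (frame w).snd := by
  constructor <;> simp [frame_mul, frame_ω, Frame.mul, Frame.fst, Frame.snd] ; ring

lemma side_gen_mul (w : ExtAffineWeyl) (i : Fin 3) :
    (frame (gen i * w)).side i = - (frame w).side i := by
  fin_cases i
  · simp [gen, Frame.side, fst_snd_r_mul]; ring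
  · simp [gen, Frame.side, fst_snd_s_mul]
  · simp [gen, Frame.side, fst_snd_t_mul]

/-- The reflection in a wall of the fundamental alcove permutes the other walls separating the two
alcoves. An image on the near side of that wall thus gains exactly this one wall. -/
lemma sep_gen_mul_of_side_neg {w : ExtAffineWeyl} {i : Fin 3} (hi : (frame w).side i < 0) :
    sep (gen i * w) = sep w + 1 := by
  obtain ⟨h1, h2, h3, h4⟩ := (frame_isSigned w).not_dvd
  fin_cases i
  · have hi : -4 < (frame w).snd + (frame w).fst := by simp [Frame.side] at hi; omega
    simp only [sep, gen, Frame.sep, Fin.zero_eta, Matrix.cons_val_zero, fst_snd_r_mul]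
    rw [wallCount_reflect h1, wallCount_reflect h2,
      show -4 - (frame w).fst + (-4 - (frame w).snd) = -8 - ((frame w).snd + (frame w).fst) by ring,
      show -4 - (frame w).fst - (-4 - (frame w).snd) = (frame w).snd - (frame w).fst by ring,
      wallCount_reflect_succ h4 hi]
    ring
  · have hi : (frame w).fst < 0 := hi
    simp only [sep, gen, Frame.sep, Fin.mk_one, Matrix.cons_val_one, Matrix.cons_val_zero,
      fst_snd_s_mul]
    rw [wallCount_neg h1 hi, sub_neg_eq_add, ← sub_eq_add_neg]
    ring
  · have hi : (frame w).snd - (frame w).fst < 0 := hi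
    simp only [sep, gen, Frame.sep, Fin.reduceFinMk, Matrix.cons_val, fst_snd_t_mul]
    rw [← neg_sub, wallCount_neg h3 hi, add_comm (frame w).fst]
    ring

lemma sep_gen_mul_of_side_pos {w : ExtAffineWeyl} {i : Fin 3} (hi : 0 < (frame w).side i) :
    sep w = sep (gen i * w) + 1 := by
  rw [← sep_gen_mul_of_side_neg (i := i), ← mul_assoc, gen_mul_gen, one_mul]
  rw [side_gen_mul]
  omega

/-- `ω` maps the fundamental alcove to itself and permutes the families of walls. -/
lemma sep_ω_mul (w : ExtAffineWeyl) : sep (ω * w) = sep w := by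
  obtain ⟨h1, h2, h3, h4⟩ := (frame_isSigned w).not_dvd
  simp only [sep, Frame.sep, fst_snd_ω_mul]
  rw [wallCount_reflect h2,
    show -4 - (frame w).snd - (frame w).fst = -4 - ((frame w).snd + (frame w).fst) by ring,
    show -4 - (frame w).snd + (frame w).fst = -4 - ((frame w).snd - (frame w).fst) by ring,
    wallCount_reflect h3, wallCount_reflect h4]
  ring

/-- Two alcoves are adjacent if exactly one of the four families of walls separates them, and
that family contributes one wall. -/
def Adjacent (x y : ℤ) (x' y' : ℤ) : Prop :=
  (x' / 4 = x / 4 ∧ y' / 4 = y / 4 ∧ (y' - x') / 4 = (y - x) / 4 ∧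
      ((y' + x') / 4 = (y + x) / 4 + 1 ∨ (y' + x') / 4 = (y + x) / 4 - 1)) ∨
    (x' / 4 = x / 4 ∧ y' / 4 = y / 4 ∧ (y' + x') / 4 = (y + x) / 4 ∧
      ((y' - x') / 4 = (y - x) / 4 + 1 ∨ (y' - x') / 4 = (y - x) / 4 - 1)) ∨
    (x' / 4 = x / 4 ∧ (y' + x') / 4 = (y + x) / 4 ∧ (y' - x') / 4 = (y - x) / 4 ∧
      (y' / 4 = y / 4 + 1 ∨ y' / 4 = y / 4 - 1)) ∨
    (y' / 4 = y / 4 ∧ (y' + x') / 4 = (y + x) / 4 ∧ (y' - x') / 4 = (y - x) / 4 ∧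
      (x' / 4 = x / 4 + 1 ∨ x' / 4 = x / 4 - 1))

lemma Adjacent.sep {F G : Frame} (h : Adjacent F.fst F.snd G.fst G.snd) :
    G.sep = F.sep + 1 ∨ F.sep = G.sep + 1 := by
  unfold Frame.sep wallCount
  rcases h with ⟨h1, h2, h3, h | h⟩ | ⟨h1, h2, h3, h | h⟩ | ⟨h1, h2, h3, h | h⟩ |
      ⟨h1, h2, h3, h | h⟩ <;> rw [h1, h2, h3, h] <;> omega

/-- The alcoves of `w` and `w * gen j` share the face that is the image under `w` of the `j`-th
wall. Which family this face belongs to depends only on `j` and on the eight possible linear parts.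
-/
lemma adjacent_mul_gen (w : ExtAffineWeyl) (j : Fin 3) :
    Adjacent (frame w).fst (frame w).snd (frame (w * gen j)).fst (frame (w * gen j)).snd := by
  have h := frame_isSigned w
  rw [frame_mul]
  generalize frame w = F at h
  unfold Adjacent
  fin_cases j <;>
    simp [gen, Frame.fst, Frame.snd, Frame.mul, frame_r, frame_s, frame_t] <;>
    rcases h with ⟨ha | ha, hb, hc, hd | hd⟩ | ⟨ha, hb | hb, hc | hc, hd⟩ <;>
    simp only [ha, hb, hc, hd] <;>
    first
    | exact Or.inl ⟨by omega, by omega, by omega, by omega⟩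
    | exact Or.inr (Or.inl ⟨by omega, by omega, by omega, by omega⟩)
    | exact Or.inr (Or.inr (Or.inl ⟨by omega, by omega, by omega, by omega⟩))
    | exact Or.inr (Or.inr (Or.inr ⟨by omega, by omega, by omega, by omega⟩))

lemma sep_mul_gen (w : ExtAffineWeyl) (j : Fin 3) :
    sep (w * gen j) = sep w + 1 ∨ sep w = sep (w * gen j) + 1 :=
  (adjacent_mul_gen w j).sep

/-- Two adjacent alcoves on opposite sides of the `i`-th wall have that wall in common, so the
reflection taking one to the other is `gen i`. -/
lemma gen_mul_eq_mul_gen {w : ExtAffineWeyl} {i j : Fin 3}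
    (hij : 0 < (frame w).side i ↔ (frame (w * gen j)).side i < 0) : gen i * w = w * gen j := by
  have h := frame_isSigned w
  apply frame_injective
  rw [frame_mul] at hij ⊢
  rw [frame_mul]
  generalize frame w = F at h hij
  ext <;> fin_cases i <;> fin_cases j <;>
    simp [gen, Frame.side, Frame.fst, Frame.snd, Frame.mul, frame_r, frame_s, frame_t] at hij ⊢ <;>
    rcases h with ⟨ha | ha, hb, hc, hd | hd⟩ | ⟨ha, hb | hb, hc | hc, hd⟩ <;>
    simp only [ha, hb, hc, hd] at hij ⊢ <;> omega

/-- The hypothesis places the image of the base point inside the fundamental alcove, so the alcove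
is mapped to itself; its only symmetries in `W` are the identity and `ω`. -/
lemma eq_one_or_eq_ω {w : ExtAffineWeyl} (hw : ∀ i, (frame w).side i < 0) : w = 1 ∨ w = ω := by
  have h := frame_isSigned w
  have h0 := hw 0
  have h1 := hw 1
  have h2 := hw 2
  rw [← frame_injective.eq_iff, ← frame_injective.eq_iff (b := ω), frame_one, frame_ω]
  generalize frame w = F at h h0 h1 h2
  obtain ⟨p, q, a, b, c, d⟩ := F
  simp [Frame.side, Frame.fst, Frame.snd, Frame.IsSigned] at h h0 h1 h2 ⊢
  omega

/-! ### Lengths -/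

lemma sep_eq_zero {w : ExtAffineWeyl} (h : sep w = 0) : w = 1 ∨ w = ω := by
  refine eq_one_or_eq_ω fun i => ?_
  rcases lt_or_gt_of_ne (side_ne_zero w i) with hi | hi
  · exact hi
  · have := sep_gen_mul_of_side_pos hi
    omega

lemma exists_gen_mul_ω (i : Fin 3) : ∃ j, gen i * ω = ω * gen j := by
  fin_cases i
  exacts [⟨2, ω_mul_t.symm⟩, ⟨1, ω_mul_s.symm⟩, ⟨0, ω_mul_r.symm⟩]

/-- The product of the simple reflections indexed by a word. -/
def word (L : List (Fin 3)) : ExtAffineWeyl := (L.map gen).prod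

lemma word_nil : word [] = 1 := rfl
lemma word_cons (i : Fin 3) (L : List (Fin 3)) : word (i :: L) = gen i * word L := by
  simp [word]
lemma word_append (L L' : List (Fin 3)) : word (L ++ L') = word L * word L' := by
  simp [word]
lemma word_reverse (L : List (Fin 3)) : word L.reverse = (word L)⁻¹ := by
  induction L with
  | nil => simp [word]
  | cons i L ih =>
    rw [List.reverse_cons, word_append, ih, word_cons i [], word_cons i L, mul_inv_rev, word_nil,
      mul_one, ← eq_inv_of_mul_eq_one_left (gen_mul_gen i)]

lemma exists_ω_mul_word (L : List (Fin 3)) :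
    ∃ L' : List (Fin 3), L'.length = L.length ∧ word L * ω = ω * word L' := by
  induction L with
  | nil => exact ⟨[], rfl, by simp [word]⟩
  | cons i L ih =>
    obtain ⟨L', h1, h2⟩ := ih
    obtain ⟨j, hj⟩ := exists_gen_mul_ω i
    exact ⟨j :: L', by simp [h1], by
      rw [word_cons, mul_assoc, h2, ← mul_assoc, hj, mul_assoc, word_cons]⟩

lemma exists_reduced_word (w : ExtAffineWeyl) :
    ∃ u ∈ ({1, ω} : Set ExtAffineWeyl), ∃ L, L.length = sep w ∧ w = u * word L := by
  induction h : sep w generalizing w with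
  | zero =>
    rcases sep_eq_zero h with rfl | rfl
    · exact ⟨1, by simp, [], rfl, by simp [word]⟩
    · exact ⟨ω, by simp, [], rfl, by simp [word]⟩
  | succ n ih =>
    obtain ⟨i, hi⟩ : ∃ i, 0 < (frame w).side i := by
      by_contra! hw
      rcases eq_one_or_eq_ω fun i => lt_of_le_of_ne (hw i) (side_ne_zero w i) with rfl | rfl
      · simp [sep_one] at h
      · rw [← mul_one ω, sep_ω_mul, sep_one] at h
        omega
    have hs := sep_gen_mul_of_side_pos hi
    obtain ⟨u, hu, L, hL, hw⟩ := ih (gen i * w) (by omega)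
    have hw' : w = gen i * (u * word L) := by rw [← hw, ← mul_assoc, gen_mul_gen, one_mul]
    rcases hu with rfl | rfl
    · exact ⟨1, by simp, i :: L, by simp [hL], by rw [hw', word_cons, one_mul, one_mul]⟩
    · obtain ⟨j, hj⟩ := exists_gen_mul_ω i
      exact ⟨ω, by simp, j :: L, by simp [hL],
        by rw [hw', word_cons, ← mul_assoc, hj, mul_assoc]⟩

lemma sep_mul_word_le (w : ExtAffineWeyl) (L : List (Fin 3)) :
    sep (w * word L) ≤ sep w + L.length := by
  induction L generalizing w with
  | nil => simp [word]
  | cons i L ih =>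
    have h1 := ih (w * gen i)
    have h2 := sep_mul_gen w i
    rw [word_cons, ← mul_assoc, List.length_cons]
    omega

lemma sep_of_mem {u : ExtAffineWeyl} (hu : u ∈ ({1, ω} : Set ExtAffineWeyl)) : sep u = 0 := by
  rcases hu with rfl | rfl
  · rfl
  · rw [← mul_one ω, sep_ω_mul, sep_one]

lemma exists_word_of_forall_mem (L : List ExtAffineWeyl) (hL : ∀ g ∈ L, g ∈ simpleReflections) :
    ∃ L' : List (Fin 3), L'.length = L.length ∧ L.prod = word L' := by
  induction L with
  | nil => exact ⟨[], rfl, rfl⟩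
  | cons g L ih =>
    obtain ⟨L', h1, h2⟩ := ih fun x hx => hL x (List.mem_cons_of_mem _ hx)
    obtain ⟨i, rfl⟩ := exists_gen (hL g List.mem_cons_self)
    exact ⟨i :: L', by simp [h1], by rw [word_cons, List.prod_cons, h2]⟩

/-- Each simple reflection crosses one wall, so a word cannot be shorter than the number of walls.
Conversely, an alcove beyond some wall of the fundamental alcove can be reflected back, which
removes one wall at a time until only `1` or `ω` remains. -/
theorem length_eq_sep (w : ExtAffineWeyl) : length w = sep w := by
  apply le_antisymm
  · obtain ⟨u, hu, L, hL, hw⟩ := exists_reduced_word w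
    refine Nat.sInf_le ⟨u, hu, L.map gen, ?_, by simp [hL], hw⟩
    intro g hg
    obtain ⟨i, -, rfl⟩ := List.mem_map.1 hg
    exact gen_mem i
  · obtain ⟨u, hu, L, hL, hw⟩ := exists_reduced_word w
    refine le_csInf ⟨L.length, u, hu, L.map gen, ?_, by simp, hw⟩ ?_
    · intro g hg
      obtain ⟨i, -, rfl⟩ := List.mem_map.1 hg
      exact gen_mem i
    · rintro n ⟨u, hu, L, hM, rfl, rfl⟩
      obtain ⟨L', h1, h2⟩ := exists_word_of_forall_mem L hM
      rw [h2, ← h1]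
      have := sep_mul_word_le u L'
      rw [sep_of_mem hu] at this
      omega

lemma length_one : length 1 = 0 := by rw [length_eq_sep, sep_one]

lemma length_ω_mul (w : ExtAffineWeyl) : length (ω * w) = length w := by
  rw [length_eq_sep, length_eq_sep, sep_ω_mul]

lemma length_ω : length ω = 0 := by rw [← mul_one ω, length_ω_mul, length_one]

lemma exists_word_eq (w : ExtAffineWeyl) :
    ∃ u ∈ ({1, ω} : Set ExtAffineWeyl), ∃ L, L.length = length w ∧ w = u * word L := by
  rw [length_eq_sep]
  exact exists_reduced_word w

lemma length_mul_word_le (w : ExtAffineWeyl) (L : List (Fin 3)) :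
    length (w * word L) ≤ length w + L.length := by
  simpa only [length_eq_sep] using sep_mul_word_le w L

lemma length_inv_le (w : ExtAffineWeyl) : length w⁻¹ ≤ length w := by
  obtain ⟨u, hu, L, hL, hw⟩ := exists_word_eq w
  rcases hu with rfl | rfl
  · have h3 : w⁻¹ = 1 * word L.reverse := by rw [hw, one_mul, one_mul, word_reverse]
    have := length_mul_word_le 1 L.reverse
    rw [← h3, length_one] at this
    simp at this
    omega
  · obtain ⟨L', h1, h2⟩ := exists_ω_mul_word L.reverse
    have h3 : w⁻¹ = ω * word L' := by rw [hw, mul_inv_rev, ω_inv, ← word_reverse, h2]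
    have := length_mul_word_le ω L'
    rw [← h3, h1, length_ω] at this
    simp at this
    omega

lemma length_inv (w : ExtAffineWeyl) : length w⁻¹ = length w :=
  le_antisymm (length_inv_le w) (by simpa using length_inv_le w⁻¹)

lemma length_mul_ω (w : ExtAffineWeyl) : length (w * ω) = length w := by
  rw [← length_inv, mul_inv_rev, ω_inv, length_ω_mul, length_inv]

lemma length_mul_gen (w : ExtAffineWeyl) (j : Fin 3) :
    length (w * gen j) = length w + 1 ∨ length w = length (w * gen j) + 1 := by
  simpa only [length_eq_sep] using sep_mul_gen w j

lemma length_gen_mul (i : Fin 3) (w : ExtAffineWeyl) :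
    length (gen i * w) = length w + 1 ∨ length w = length (gen i * w) + 1 := by
  simp only [length_eq_sep]
  rcases lt_or_gt_of_ne (side_ne_zero w i) with hi | hi
  · exact Or.inl (sep_gen_mul_of_side_neg hi)
  · exact Or.inr (sep_gen_mul_of_side_pos hi)

lemma length_lt_gen_mul_iff (i : Fin 3) (w : ExtAffineWeyl) :
    length w < length (gen i * w) ↔ (frame w).side i < 0 := by
  simp only [length_eq_sep]
  rcases lt_or_gt_of_ne (side_ne_zero w i) with hi | hi
  · simp [hi, sep_gen_mul_of_side_neg hi]
  · have := sep_gen_mul_of_side_pos hi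
    omega

lemma length_gen (i : Fin 3) : length (gen i) = 1 := by
  have := length_gen_mul i 1
  rw [mul_one, length_one] at this
  omega

/-- The exchange condition. -/
lemma length_lt_iff_of_ne {w : ExtAffineWeyl} {i j : Fin 3} (h : gen i * w ≠ w * gen j) :
    (length w < length (gen i * w) ↔ length (w * gen j) < length (gen i * (w * gen j))) := by
  rw [length_lt_gen_mul_iff, length_lt_gen_mul_iff]
  have h1 := side_ne_zero w i
  have h2 := side_ne_zero (w * gen j) i
  by_contra h3
  exact h (gen_mul_eq_mul_gen (by omega))

theorem length_induction_right {p : ExtAffineWeyl → Prop} (one : p 1) (omega : p ω)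
    (mul_gen : ∀ w j, length (w * gen j) = length w + 1 → p w → p (w * gen j)) (w) : p w := by
  obtain ⟨u, hu, L, hL, hw⟩ := exists_word_eq w
  have hp : p u := by rcases hu with rfl | rfl <;> assumption
  have hu0 : length u = 0 := by rw [length_eq_sep, sep_of_mem hu]
  clear hu
  induction L using List.reverseRecOn generalizing w with
  | nil => rw [hw, word_nil, mul_one]; exact hp
  | append_singleton L j ih =>
    have h1 : w = u * word L * gen j := by
      rw [hw, word_append, word_cons, word_nil, mul_one, mul_assoc]
    have h2 := length_mul_word_le u L
    have h3 := length_mul_gen (u * word L) j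
    rw [List.length_append, List.length_singleton, h1] at hL
    rw [h1]
    exact mul_gen _ _ (by omega) (ih _ (by omega) rfl)

theorem length_induction_left {p : ExtAffineWeyl → Prop} (one : p 1) (omega : p ω)
    (gen_mul : ∀ w i, length (gen i * w) = length w + 1 → p w → p (gen i * w)) (w) : p w := by
  rw [← inv_inv w]
  refine length_induction_right (p := fun w => p w⁻¹) (by simpa) (by simpa [ω_inv]) ?_ w⁻¹
  intro w j h hw
  have hj : (gen j)⁻¹ = gen j := (eq_inv_of_mul_eq_one_left (gen_mul_gen j)).symm
  rw [mul_inv_rev, hj]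
  refine gen_mul _ _ ?_ hw
  rw [← hj, ← mul_inv_rev, length_inv, h, length_inv]

/-! ### The regular representation of the Hecke algebra -/

/-- The free `𝒜`-module on `W`. -/
abbrev FreeMod : Type := ExtAffineWeyl →₀ Coeff

/-- The operator `e_w ↦ e_{f w}` if `f` increases the length of `w`, and
`e_w ↦ q e_{f w} + (q - 1) e_w` otherwise. -/
def heckeOp (f : ExtAffineWeyl → ExtAffineWeyl) : FreeMod →ₗ[Coeff] FreeMod :=
  Finsupp.linearCombination Coeff fun w =>
    if length w < length (f w) then Finsupp.single (f w) 1
    else qHalfPow 2 • Finsupp.single (f w) 1 + (qHalfPow 2 - 1) • Finsupp.single w 1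

lemma heckeOp_of_lt {f : ExtAffineWeyl → ExtAffineWeyl} {w : ExtAffineWeyl}
    (h : length w < length (f w)) :
    heckeOp f (Finsupp.single w 1) = Finsupp.single (f w) 1 := by
  simp [heckeOp, h]

lemma heckeOp_of_not_lt {f : ExtAffineWeyl → ExtAffineWeyl} {w : ExtAffineWeyl}
    (h : ¬ length w < length (f w)) :
    heckeOp f (Finsupp.single w 1) =
      qHalfPow 2 • Finsupp.single (f w) 1 + (qHalfPow 2 - 1) • Finsupp.single w 1 := by
  rw [heckeOp, Finsupp.linearCombination_single, if_neg h, one_smul]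

lemma freeMod_ext {φ ψ : FreeMod →ₗ[Coeff] FreeMod}
    (h : ∀ w, φ (Finsupp.single w 1) = ψ (Finsupp.single w 1)) : φ = ψ :=
  Finsupp.lhom_ext' fun w => LinearMap.ext_ring (h w)

/-- This is the point where the exchange condition enters. Either `gen i * w = w * gen j`, and then
the left and right operators agree on the basis vectors of `w` and `w * gen j`; or the left and
right multiplications change the length independently, and four cases are compared. -/
lemma heckeOp_comm (i j : Fin 3) (x : FreeMod) :
    heckeOp (gen i * ·) (heckeOp (· * gen j) x) = heckeOp (· * gen j) (heckeOp (gen i * ·) x) := by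
  suffices h : heckeOp (gen i * ·) ∘ₗ heckeOp (· * gen j) =
      heckeOp (· * gen j) ∘ₗ heckeOp (gen i * ·) from LinearMap.congr_fun h x
  refine freeMod_ext fun w => ?_
  simp only [LinearMap.comp_apply]
  by_cases h : gen i * w = w * gen j
  · have key1 : heckeOp (gen i * ·) (Finsupp.single w 1) =
        heckeOp (· * gen j) (Finsupp.single w 1) := by simp [heckeOp, h]
    have h2 : gen i * (w * gen j) = w * gen j * gen j := by
      rw [← h, ← mul_assoc, gen_mul_gen, h, mul_assoc, gen_mul_gen, one_mul, mul_one]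
    have key2 : heckeOp (gen i * ·) (Finsupp.single (w * gen j) 1) =
        heckeOp (· * gen j) (Finsupp.single (w * gen j) 1) := by simp [heckeOp, h2]
    by_cases h3 : length w < length (w * gen j)
    · rw [key1, heckeOp_of_lt h3, key2]
    · rw [key1, heckeOp_of_not_lt h3]
      simp only [map_add, map_smul, key1, key2]
  · have e1 := length_lt_iff_of_ne h
    have e2 : length w < length (w * gen j) ↔
        length (gen i * w) < length (gen i * (w * gen j)) := by
      have a1 := length_gen_mul i w
      have a2 := length_gen_mul i (w * gen j)
      omega
    have e3 : gen i * (w * gen j) = gen i * w * gen j := (mul_assoc _ _ _).symm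
    have lt1 := fun v => heckeOp_of_lt (f := (gen i * ·)) (w := v)
    have lt2 := fun v => heckeOp_of_lt (f := (· * gen j)) (w := v)
    have ge1 := fun v => heckeOp_of_not_lt (f := (gen i * ·)) (w := v)
    have ge2 := fun v => heckeOp_of_not_lt (f := (· * gen j)) (w := v)
    by_cases h1 : length w < length (gen i * w) <;> by_cases h2 : length w < length (w * gen j)
    · rw [lt2 w h2, lt1 w h1, lt1 _ (e1.1 h1), lt2 _ (e3 ▸ e2.1 h2), e3]
    · rw [ge2 w h2, lt1 w h1, ge2 _ (e3 ▸ mt e2.2 h2), map_add, map_smul, map_smul, lt1 w h1,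
        lt1 _ (e1.1 h1), e3]
    · rw [lt2 w h2, ge1 w h1, ge1 _ (mt e1.2 h1), map_add, map_smul, map_smul, lt2 w h2,
        lt2 _ (e3 ▸ e2.1 h2), e3]
    · rw [ge2 w h2, ge1 w h1, map_add, map_smul, map_smul, map_add, map_smul, map_smul, ge1 w h1,
        ge2 w h2, ge2 _ (e3 ▸ mt e2.2 h2), ge1 _ (mt e1.2 h1), e3]
      module

/-- An endomorphism of `FreeMod` commuting with right multiplication by the generators. -/
structure CommutesRight (φ : FreeMod →ₗ[Coeff] FreeMod) : Prop where
  gen : ∀ j x, φ (heckeOp (· * gen j) x) = heckeOp (· * SpFour.gen j) (φ x)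
  omega : ∀ x, φ (Finsupp.lmapDomain Coeff Coeff (· * ω) x) =
    Finsupp.lmapDomain Coeff Coeff (· * ω) (φ x)

lemma CommutesRight.comp {φ ψ : FreeMod →ₗ[Coeff] FreeMod} (hφ : CommutesRight φ)
    (hψ : CommutesRight ψ) : CommutesRight (φ ∘ₗ ψ) :=
  ⟨fun j x => by simp only [LinearMap.comp_apply, hψ.gen, hφ.gen],
    fun x => by simp only [LinearMap.comp_apply, hψ.omega, hφ.omega]⟩

lemma CommutesRight.heckeOp (i : Fin 3) : CommutesRight (heckeOp (SpFour.gen i * ·)) := by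
  refine ⟨heckeOp_comm i, fun x => ?_⟩
  suffices h : SpFour.heckeOp (SpFour.gen i * ·) ∘ₗ Finsupp.lmapDomain Coeff Coeff (· * ω) =
      Finsupp.lmapDomain Coeff Coeff (· * ω) ∘ₗ SpFour.heckeOp (SpFour.gen i * ·) from
    LinearMap.congr_fun h x
  refine freeMod_ext fun w => ?_
  simp only [LinearMap.comp_apply, Finsupp.lmapDomain_apply, Finsupp.mapDomain_single]
  have h0 : length (SpFour.gen i * (w * ω)) = length (SpFour.gen i * w) := by
    rw [← mul_assoc, length_mul_ω]
  by_cases h : length w < length (SpFour.gen i * w)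
  · rw [heckeOp_of_lt h, heckeOp_of_lt (by rwa [length_mul_ω, h0]), Finsupp.mapDomain_single,
      mul_assoc]
  · rw [heckeOp_of_not_lt h, heckeOp_of_not_lt (by rwa [length_mul_ω, h0]), Finsupp.mapDomain_add,
      Finsupp.mapDomain_smul, Finsupp.mapDomain_smul, Finsupp.mapDomain_single,
      Finsupp.mapDomain_single, mul_assoc]

lemma CommutesRight.lmapDomain : CommutesRight (Finsupp.lmapDomain Coeff Coeff (ω * ·)) := by
  constructor
  · intro j x
    suffices h : Finsupp.lmapDomain Coeff Coeff (ω * ·) ∘ₗ SpFour.heckeOp (· * SpFour.gen j) =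
        SpFour.heckeOp (· * SpFour.gen j) ∘ₗ Finsupp.lmapDomain Coeff Coeff (ω * ·) from
      LinearMap.congr_fun h x
    refine freeMod_ext fun w => ?_
    simp only [LinearMap.comp_apply, Finsupp.lmapDomain_apply, Finsupp.mapDomain_single]
    have h0 : length (ω * w * SpFour.gen j) = length (w * SpFour.gen j) := by
      rw [mul_assoc, length_ω_mul]
    by_cases h : length w < length (w * SpFour.gen j)
    · rw [heckeOp_of_lt h, heckeOp_of_lt (by rwa [length_ω_mul, h0]), Finsupp.mapDomain_single,
        mul_assoc]
    · rw [heckeOp_of_not_lt h, heckeOp_of_not_lt (by rwa [length_ω_mul, h0]),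
        Finsupp.mapDomain_add, Finsupp.mapDomain_smul, Finsupp.mapDomain_smul,
        Finsupp.mapDomain_single, Finsupp.mapDomain_single, mul_assoc]
  · intro x
    simp only [Finsupp.lmapDomain_apply, ← Finsupp.mapDomain_comp]
    congr 1
    funext w
    simp [mul_assoc]

/-- The right operators and `ω` generate the free module from the basis vector of `1`, so a map
commuting with them is determined there. Relations between left operators need only be tested on
this vector. -/
lemma CommutesRight.ext {φ ψ : FreeMod →ₗ[Coeff] FreeMod} (hφ : CommutesRight φ)
    (hψ : CommutesRight ψ) (h : φ (Finsupp.single 1 1) = ψ (Finsupp.single 1 1)) : φ = ψ := by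
  refine freeMod_ext fun w => ?_
  induction w using length_induction_right with
  | one => exact h
  | omega =>
    have e : (Finsupp.single ω 1 : FreeMod) =
        Finsupp.lmapDomain Coeff Coeff (· * ω) (Finsupp.single 1 1) := by simp
    rw [e, hφ.omega, hψ.omega, h]
  | mul_gen w j hw ih =>
    have e : (Finsupp.single (w * SpFour.gen j) 1 : FreeMod) =
        SpFour.heckeOp (· * SpFour.gen j) (Finsupp.single w 1) := by
      rw [heckeOp_of_lt (by omega)]
    rw [e, hφ.gen, hψ.gen, ih]

/-- The operator is a product of left generators along a reduced expression. By `CommutesRight.ext`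
it does not depend on that expression. -/
lemma exists_leftOp (w : ExtAffineWeyl) :
    ∃ φ, CommutesRight φ ∧ φ (Finsupp.single 1 1) = Finsupp.single w 1 := by
  induction w using length_induction_left with
  | one => exact ⟨LinearMap.id, ⟨fun _ _ => rfl, fun _ => rfl⟩, rfl⟩
  | omega => exact ⟨_, CommutesRight.lmapDomain, by simp⟩
  | gen_mul w i hw ih =>
    obtain ⟨φ, h1, h2⟩ := ih
    exact ⟨_, (CommutesRight.heckeOp i).comp h1, by
      rw [LinearMap.comp_apply, h2, heckeOp_of_lt (by omega)]⟩

/-- Left multiplication by `T_w`. -/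
def leftOp (w : ExtAffineWeyl) : Module.End Coeff FreeMod := (exists_leftOp w).choose

lemma leftOp_commutesRight (w : ExtAffineWeyl) : CommutesRight (leftOp w) :=
  (exists_leftOp w).choose_spec.1

lemma leftOp_single_one (w : ExtAffineWeyl) :
    leftOp w (Finsupp.single 1 1) = Finsupp.single w 1 :=
  (exists_leftOp w).choose_spec.2

lemma leftOp_one : leftOp 1 = 1 :=
  (leftOp_commutesRight 1).ext ⟨fun _ _ => rfl, fun _ => rfl⟩ (leftOp_single_one 1)

lemma leftOp_gen (i : Fin 3) : leftOp (gen i) = heckeOp (gen i * ·) := by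
  refine (leftOp_commutesRight _).ext (CommutesRight.heckeOp i) ?_
  rw [leftOp_single_one, heckeOp_of_lt, mul_one]
  rw [mul_one, length_gen, length_one]
  omega

lemma length_mul_le (w u : ExtAffineWeyl) : length (w * u) ≤ length w + length u := by
  induction u using length_induction_right with
  | one => simp
  | omega => rw [length_mul_ω]; omega
  | mul_gen u j hu ih =>
    have := length_mul_gen (w * u) j
    rw [← mul_assoc]
    omega

lemma leftOp_single {w u : ExtAffineWeyl} (h : length (w * u) = length w + length u) :
    leftOp w (Finsupp.single u 1) = Finsupp.single (w * u) 1 := by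
  induction u using length_induction_right with
  | one => rw [leftOp_single_one, mul_one]
  | omega =>
    have e : (Finsupp.single ω 1 : FreeMod) =
        Finsupp.lmapDomain Coeff Coeff (· * ω) (Finsupp.single 1 1) := by simp
    rw [e, (leftOp_commutesRight w).omega, leftOp_single_one]
    simp
  | mul_gen u j hu ih =>
    rw [← mul_assoc] at h
    have h1 := length_mul_gen (w * u) j
    have h2 := length_mul_le w u
    have e : (Finsupp.single (u * gen j) 1 : FreeMod) =
        heckeOp (· * gen j) (Finsupp.single u 1) := by
      rw [heckeOp_of_lt (by omega)]
    rw [e, (leftOp_commutesRight w).gen, ih (by omega), heckeOp_of_lt (by omega), mul_assoc]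

lemma leftOp_mul {w u : ExtAffineWeyl} (h : length (w * u) = length w + length u) :
    leftOp w * leftOp u = leftOp (w * u) := by
  refine ((leftOp_commutesRight w).comp (leftOp_commutesRight u)).ext (leftOp_commutesRight _) ?_
  rw [LinearMap.comp_apply, leftOp_single_one, leftOp_single_one, leftOp_single h]

lemma heckeOp_quadratic (i : Fin 3) (x : FreeMod) :
    heckeOp (gen i * ·) (heckeOp (gen i * ·) x) =
      (qHalfPow 2 - 1) • heckeOp (gen i * ·) x + qHalfPow 2 • x := by
  suffices h : heckeOp (gen i * ·) ∘ₗ heckeOp (gen i * ·) =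
      (qHalfPow 2 - 1) • heckeOp (gen i * ·) + qHalfPow 2 • LinearMap.id from
    LinearMap.congr_fun h x
  refine freeMod_ext fun w => ?_
  simp only [LinearMap.comp_apply, LinearMap.add_apply, LinearMap.smul_apply, LinearMap.id_apply]
  have e : gen i * (gen i * w) = w := by rw [← mul_assoc, gen_mul_gen, one_mul]
  by_cases h : length w < length (gen i * w)
  · rw [heckeOp_of_lt h, heckeOp_of_not_lt (by rw [e]; omega), e]
    module
  · have := length_gen_mul i w
    rw [heckeOp_of_not_lt h, map_add, map_smul, map_smul, heckeOp_of_not_lt h,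
      heckeOp_of_lt (by rw [e]; omega), e]
    module

/-- The left regular representation of the Hecke algebra. -/
def regular : Hecke →ₐ[Coeff] Module.End Coeff FreeMod :=
  RingQuot.liftAlgHom Coeff ⟨FreeAlgebra.lift Coeff leftOp, by
    intro a b hab
    induction hab with
    | one => simp [leftOp_one]
    | mul w u h => simp [leftOp_mul h]
    | quadratic g h =>
      obtain ⟨i, rfl⟩ := exists_gen h
      refine LinearMap.ext fun x => ?_
      simp [leftOp_gen, heckeOp_quadratic, Algebra.algebraMap_eq_smul_one]
      module⟩

lemma regular_T (w : ExtAffineWeyl) : regular (T w) = leftOp w := by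
  simp [regular, T]

/-- The coordinates of an element of the Hecke algebra in the standard basis. -/
def coeffs : Hecke →ₗ[Coeff] FreeMod where
  toFun h := regular h (Finsupp.single 1 1)
  map_add' := by simp
  map_smul' := by simp

lemma coeffs_T (w : ExtAffineWeyl) : coeffs (T w) = Finsupp.single w 1 := by
  simp [coeffs, regular_T, leftOp_single_one]

/-! ### The bar involution -/

/-- The ring structure of the Hecke algebra. -/
abbrev heckeRing : Ring Hecke := RingQuot.instRing HeckeRel

attribute [local instance] heckeRing in
/-- The multiplication of the Hecke algebra, as part of its ring structure. -/
abbrev heckeMul : Mul Hecke := NonUnitalNonAssocRing.toMul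

attribute [local instance] heckeRing in
/-- The subtraction of the Hecke algebra, as part of its ring structure. -/
abbrev heckeSub : Sub Hecke := SubNegMonoid.toSub

section

attribute [local instance] heckeRing heckeMul heckeSub

lemma qHalfPow_add (a b : ℤ) : qHalfPow (a + b) = qHalfPow a * qHalfPow b :=
  LaurentPolynomial.T_add a b

lemma qHalfPow_zero : qHalfPow 0 = 1 := LaurentPolynomial.T_zero

lemma invert_qHalfPow (k : ℤ) : LaurentPolynomial.invert (qHalfPow k) = qHalfPow (-k) := by
  simp [qHalfPow]

lemma T_one : T 1 = 1 := by
  simpa [T] using RingQuot.mkAlgHom_rel Coeff HeckeRel.one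

lemma T_mul {w u : ExtAffineWeyl} (h : length (w * u) = length w + length u) :
    T (w * u) = T w * T u := by
  simpa [T] using (RingQuot.mkAlgHom_rel Coeff (HeckeRel.mul w u h)).symm

lemma T_gen_mul_self (i : Fin 3) :
    T (gen i) * T (gen i) = (qHalfPow 2 - 1) • T (gen i) + qHalfPow 2 • 1 := by
  have h := RingQuot.mkAlgHom_rel Coeff (HeckeRel.quadratic (gen i) (gen_mem i))
  rw [map_mul, map_add, map_sub, map_one, map_zero, AlgHom.commutes] at h
  change (T (gen i) + 1) * (T (gen i) - algebraMap Coeff Hecke (qHalfPow 2)) = 0 at h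
  rw [Algebra.algebraMap_eq_smul_one, add_mul, mul_sub, one_mul, mul_smul_comm, mul_one] at h
  rw [← sub_eq_zero, ← h]
  module

lemma T_ω_mul (w : ExtAffineWeyl) : T (ω * w) = T ω * T w :=
  T_mul (by rw [length_ω_mul, length_ω, zero_add])

lemma T_mul_ω (w : ExtAffineWeyl) : T (w * ω) = T w * T ω :=
  T_mul (by rw [length_mul_ω, length_ω, add_zero])

lemma T_ω_mul_self : T ω * T ω = 1 := by rw [← T_ω_mul, ω_mul_ω, T_one]

/-- The inverse of `T (gen i)`. -/
def TInv (i : Fin 3) : Hecke := qHalfPow (-2) • T (gen i) + (qHalfPow (-2) - 1) • 1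

lemma qHalfPow_neg_two_mul : qHalfPow (-2) * qHalfPow 2 = 1 := by
  rw [← qHalfPow_add, neg_add_cancel, qHalfPow_zero]

lemma T_mul_TInv (i : Fin 3) : T (gen i) * TInv i = 1 := by
  rw [TInv, mul_add, mul_smul_comm, mul_smul_comm, T_gen_mul_self, mul_one, smul_add, smul_smul,
    smul_smul, mul_sub, qHalfPow_neg_two_mul]
  module

lemma TInv_mul_T (i : Fin 3) : TInv i * T (gen i) = 1 := by
  rw [TInv, add_mul, smul_mul_assoc, smul_mul_assoc, T_gen_mul_self, one_mul, smul_add, smul_smul,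
    smul_smul, mul_sub, qHalfPow_neg_two_mul]
  module

lemma isUnit_T (w : ExtAffineWeyl) : IsUnit (T w) := by
  induction w using length_induction_left with
  | one => rw [T_one]; exact isUnit_one
  | omega => exact ⟨⟨_, _, T_ω_mul_self, T_ω_mul_self⟩, rfl⟩
  | gen_mul w i hw ih =>
    rw [T_mul (by rw [hw, length_gen, add_comm])]
    exact IsUnit.mul ⟨⟨_, _, T_mul_TInv i, TInv_mul_T i⟩, rfl⟩ ih

lemma inverse_eq_of_mul_eq_one {R : Type*} [Ring R] {a b : R} (h : a * b = 1) (h' : b * a = 1) :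
    Ring.inverse a = b :=
  Ring.inverse_unit ⟨a, b, h, h'⟩

lemma inverse_mul {R : Type*} [Ring R] {a b : R} (ha : IsUnit a) (hb : IsUnit b) :
    Ring.inverse (a * b) = Ring.inverse b * Ring.inverse a := by
  obtain ⟨a, rfl⟩ := ha
  obtain ⟨b, rfl⟩ := hb
  rw [← Units.val_mul, Ring.inverse_unit, Ring.inverse_unit, Ring.inverse_unit, mul_inv_rev,
    Units.val_mul]

/-- The image of `T w` under the bar involution. -/
def barT (w : ExtAffineWeyl) : Hecke := Ring.inverse (T w⁻¹)

lemma barT_one : barT 1 = 1 := by rw [barT, inv_one, T_one, Ring.inverse_one]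

lemma barT_ω : barT ω = T ω := by
  rw [barT, ω_inv]
  exact inverse_eq_of_mul_eq_one T_ω_mul_self T_ω_mul_self

lemma gen_inv (i : Fin 3) : (gen i)⁻¹ = gen i :=
  (eq_inv_of_mul_eq_one_left (gen_mul_gen i)).symm

lemma barT_gen (i : Fin 3) : barT (gen i) = TInv i := by
  rw [barT, gen_inv]
  exact inverse_eq_of_mul_eq_one (T_mul_TInv i) (TInv_mul_T i)

lemma barT_mul {w u : ExtAffineWeyl} (h : length (w * u) = length w + length u) :
    barT (w * u) = barT w * barT u := by
  rw [barT, mul_inv_rev, T_mul, inverse_mul (isUnit_T _) (isUnit_T _), barT, barT]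
  rw [← mul_inv_rev, length_inv, length_inv, length_inv, h, add_comm]

/-- The Hecke algebra, with scalars acting through the involution `q^{1/2} ↦ q^{-1/2}`. -/
def BarHecke : Type := Hecke

instance : Ring BarHecke := inferInstanceAs (Ring Hecke)

/-- With twisted scalars the semilinear bar involution becomes an honest algebra map, so it can be
defined from the presentation. -/
instance : Algebra Coeff BarHecke :=
  ((algebraMap Coeff Hecke).comp
    (LaurentPolynomial.invert (R := ℤ)).toRingEquiv.toRingHom).toAlgebra'
    fun c x => Algebra.commutes (A := Hecke) (LaurentPolynomial.invert c) x

lemma algebraMap_barHecke (c : Coeff) : algebraMap Coeff BarHecke c =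
    algebraMap Coeff Hecke (LaurentPolynomial.invert c) := rfl

/-- `barT`, with values in the twisted algebra. -/
def toBar (w : ExtAffineWeyl) : BarHecke := barT w

/-- The bar involution, as an algebra map to the twisted algebra. -/
def barAlgHom : Hecke →ₐ[Coeff] BarHecke :=
  RingQuot.liftAlgHom Coeff ⟨FreeAlgebra.lift Coeff toBar, by
    intro a b hab
    induction hab with
    | one => rw [FreeAlgebra.lift_ι_apply, map_one]; exact barT_one
    | mul w u h =>
      rw [map_mul, FreeAlgebra.lift_ι_apply, FreeAlgebra.lift_ι_apply, FreeAlgebra.lift_ι_apply]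
      exact (barT_mul h).symm
    | quadratic g h =>
      obtain ⟨i, rfl⟩ := exists_gen h
      rw [map_mul, map_add, map_sub, map_one, map_zero, AlgHom.commutes, FreeAlgebra.lift_ι_apply,
        toBar, barT_gen, algebraMap_barHecke, invert_qHalfPow]
      have e : TInv i * T (gen i) = 1 := TInv_mul_T i
      have h : (TInv i + 1) * (TInv i - algebraMap Coeff Hecke (qHalfPow (-2))) = 0 := by
        have e2 : TInv i = qHalfPow (-2) • T (gen i) + (qHalfPow (-2) - 1) • 1 := rfl
        rw [Algebra.algebraMap_eq_smul_one]
        nth_rewrite 2 [e2]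
        rw [add_mul, one_mul, add_sub_assoc, ← sub_smul, mul_add, mul_smul_comm, e, mul_smul_comm,
          mul_one]
        nth_rewrite 1 [e2]
        module
      exact h⟩

/-- The bar involution of the Hecke algebra. -/
def bar : Hecke →+* Hecke := barAlgHom.toRingHom

lemma bar_T (w : ExtAffineWeyl) : bar (T w) = barT w := by
  change barAlgHom (T w) = barT w
  rw [barAlgHom, T, RingQuot.liftAlgHom_mkAlgHom_apply, FreeAlgebra.lift_ι_apply, toBar]

lemma bar_algebraMap (c : Coeff) :
    bar (algebraMap Coeff Hecke c) = algebraMap Coeff Hecke (LaurentPolynomial.invert c) :=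
  barAlgHom.commutes c

lemma bar_smul (c : Coeff) (h : Hecke) : bar (c • h) = LaurentPolynomial.invert c • bar h := by
  rw [Algebra.smul_def, map_mul, bar_algebraMap, ← Algebra.smul_def]

lemma klSumBar_eq (w : ExtAffineWeyl) (P : ExtAffineWeyl →₀ Polynomial ℤ) :
    klSumBar w P = bar (klSum w P) := by
  simp only [klSumBar, klSum, Finsupp.sum, map_sum, bar_smul, bar_T, barT]

/-! ### Uniqueness of the Kazhdan-Lusztig polynomials -/

/-- The span of the `T z` with `length z < n`. -/
def lowSpan (n : ℕ) : Submodule Coeff Hecke := Submodule.span Coeff (T '' {z | length z < n})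

lemma T_mem_lowSpan {n : ℕ} {z : ExtAffineWeyl} (h : length z < n) : T z ∈ lowSpan n :=
  Submodule.subset_span ⟨z, h, rfl⟩

lemma lowSpan_mono {m n : ℕ} (h : m ≤ n) : lowSpan m ≤ lowSpan n :=
  Submodule.span_mono (Set.image_mono fun _ (hz : _ < m) => lt_of_lt_of_le hz h)

lemma T_gen_mul_mem_lowSpan (i : Fin 3) {n : ℕ} {h : Hecke} (hh : h ∈ lowSpan n) :
    T (gen i) * h ∈ lowSpan (n + 1) := by
  induction hh using Submodule.span_induction with
  | mem x hx =>
    obtain ⟨z, hz, rfl⟩ := hx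
    have hz : length z < n := hz
    rcases length_gen_mul i z with h1 | h1
    · rw [← T_mul (by rw [h1, length_gen, add_comm])]
      exact T_mem_lowSpan (by omega)
    · have e : gen i * (gen i * z) = z := by rw [← mul_assoc, gen_mul_gen, one_mul]
      have e2 : T z = T (gen i) * T (gen i * z) := by
        rw [← T_mul (by rw [e, length_gen, add_comm, h1]), e]
      rw [e2, ← mul_assoc, T_gen_mul_self, add_mul, smul_mul_assoc, smul_mul_assoc, one_mul, ← e2]
      exact add_mem (Submodule.smul_mem _ _ (T_mem_lowSpan (by omega)))
        (Submodule.smul_mem _ _ (T_mem_lowSpan (by omega)))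
  | zero => rw [mul_zero]; exact zero_mem _
  | add x y _ _ hx hy => rw [mul_add]; exact add_mem hx hy
  | smul c x _ hx => rw [mul_smul_comm]; exact Submodule.smul_mem _ _ hx

/-- Since `T_g⁻¹ = q⁻¹ T_g + (q⁻¹ - 1)`, multiplying along a reduced expression gives the leading
term `q^{-l(w)} T_w`. Triangularity by length is coarser than by the Bruhat order, but suffices for
uniqueness. -/
lemma barT_sub_mem_lowSpan (w : ExtAffineWeyl) :
    barT w - qHalfPow (-2 * length w) • T w ∈ lowSpan (length w) := by
  induction w using length_induction_left with
  | one => rw [barT_one, length_one, T_one]; simp [qHalfPow_zero]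
  | omega => rw [barT_ω, length_ω]; simp [qHalfPow_zero]
  | gen_mul w i hw ih =>
    have hl : length (gen i * w) = length (gen i) + length w := by rw [hw, length_gen, add_comm]
    rw [barT_mul hl, T_mul hl, barT_gen, hw]
    obtain ⟨d, hd⟩ : ∃ d, d = barT w - qHalfPow (-2 * length w) • T w := ⟨_, rfl⟩
    rw [← hd] at ih
    have e : barT w = qHalfPow (-2 * length w) • T w + d := by rw [hd]; abel
    have e2 : (-2 * ((length w + 1 : ℕ) : ℤ)) = -2 + -2 * length w := by push_cast; ring
    have e3 : TInv i * barT w - qHalfPow (-2 * ((length w + 1 : ℕ) : ℤ)) • (T (gen i) * T w) =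
        qHalfPow (-2) • (T (gen i) * d) + ((qHalfPow (-2) - 1) * qHalfPow (-2 * length w)) • T w +
          (qHalfPow (-2) - 1) • d := by
      rw [e2, qHalfPow_add, e, TInv, mul_add, add_mul, add_mul]
      simp only [smul_mul_assoc, mul_smul_comm, one_mul]
      module
    rw [e3]
    exact add_mem (add_mem (Submodule.smul_mem _ _ (T_gen_mul_mem_lowSpan i ih))
      (Submodule.smul_mem _ _ (T_mem_lowSpan (by omega))))
      (Submodule.smul_mem _ _ (lowSpan_mono (by omega) ih))

lemma coeffs_apply_of_mem_lowSpan {n : ℕ} {h : Hecke} (hh : h ∈ lowSpan n) {z : ExtAffineWeyl}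
    (hz : n ≤ length z) : coeffs h z = 0 := by
  induction hh using Submodule.span_induction with
  | mem x hx =>
    obtain ⟨y, hy, rfl⟩ := hx
    have hy : length y < n := hy
    rw [coeffs_T, Finsupp.single_eq_of_ne]
    rintro rfl
    omega
  | zero => simp
  | add x y _ _ hx hy => simp [hx, hy]
  | smul c x _ hx => simp [hx]

open Classical in
lemma coeffs_barT (y z : ExtAffineWeyl) (h : length y ≤ length z) :
    coeffs (barT y) z = if y = z then qHalfPow (-2 * length y) else 0 := by
  have h1 := coeffs_apply_of_mem_lowSpan (barT_sub_mem_lowSpan y) h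
  rw [map_sub, map_smul, coeffs_T, Finsupp.sub_apply, sub_eq_zero] at h1
  rw [h1, Finsupp.smul_apply, Finsupp.single_apply]
  simp

/-- A bar-invariant combination of the `T y`, all of whose coefficients are strictly negative
after rescaling, vanishes. -/
lemma eq_zero_of_bar_eq (D : ExtAffineWeyl →₀ Coeff)
    (hD : ∀ y (k : ℤ), 0 ≤ k → (qHalfPow (length y) * D y : Coeff).coeff k = 0)
    (hbar : bar (D.sum fun y c => c • T y) = D.sum fun y c => c • T y) : D = 0 := by
  by_contra h0
  -- At a longest `y` in the support only `barT y` contributes to the coordinate at `y`. Hence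
  -- `q^{l(y)/2} D y` is fixed by `q^{1/2} ↦ q^{-1/2}`, and having only negative powers it is zero.
  obtain ⟨y, hy, hmax⟩ := D.support.exists_max_image length (Finsupp.support_nonempty_iff.2 h0)
  have h1 := congrArg (fun h => coeffs h y) hbar
  have h2 : coeffs (D.sum fun y c => c • T y) y = D y := by
    rw [Finsupp.sum, map_sum, Finsupp.finsetSum_apply, Finset.sum_eq_single y]
    · simp [coeffs_T]
    · intro z _ hz
      simp [coeffs_T, hz]
    · intro h
      simp [Finsupp.notMem_support_iff.1 h]
  have h3 : coeffs (bar (D.sum fun y c => c • T y)) y =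
      LaurentPolynomial.invert (D y) * qHalfPow (-2 * length y) := by
    rw [Finsupp.sum, map_sum, map_sum, Finsupp.finsetSum_apply, Finset.sum_eq_single y]
    · simp [bar_smul, bar_T, coeffs_barT]
    · intro z hz hzy
      simp [bar_smul, bar_T, coeffs_barT _ _ (hmax z hz), hzy]
    · intro h
      simp [Finsupp.notMem_support_iff.1 h]
  simp only [h2, h3] at h1
  have h4 : LaurentPolynomial.invert (qHalfPow (length y) * D y) = qHalfPow (length y) * D y := by
    conv_rhs => rw [← h1]
    rw [map_mul, invert_qHalfPow, mul_left_comm, ← qHalfPow_add, mul_comm]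
    congr 2
    ring
  refine Finsupp.mem_support_iff.1 hy ?_
  have h5 : qHalfPow (length y) * D y = 0 := by
    ext k
    rcases le_total 0 k with hk | hk
    · exact hD y k hk
    · rw [← h4, LaurentPolynomial.invert_apply]
      exact hD y (-k) (by omega)
  have h6 := congrArg (qHalfPow (-length y) * ·) h5
  simpa [← mul_assoc, ← qHalfPow_add, qHalfPow_zero] using h6

lemma length_le_of_bruhatLE {y w : ExtAffineWeyl} (h : BruhatLE y w) :
    y = w ∨ length y < length w := by
  induction h with
  | refl => exact Or.inl rfl
  | tail _ h2 ih =>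
    obtain ⟨_, _, _, _, h3⟩ := h2
    rcases ih with rfl | ih
    · exact Or.inr h3
    · exact Or.inr (ih.trans h3)

/-- Exponents in `Coeff` count powers of `q^{1/2}`, which doubles the degree of a polynomial in `q`.
-/
lemma polyInQ_apply (p : Polynomial ℤ) (k : ℤ) (a : ℤ) (hk : 2 * p.natDegree + a < k) :
    (qHalfPow a * polyInQ p : Coeff).coeff k = 0 := by
  have : qHalfPow a * polyInQ p = ∑ i ∈ Finset.range (p.natDegree + 1),
      LaurentPolynomial.C (p.coeff i) * LaurentPolynomial.T (a + 2 * i) := by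
    rw [polyInQ, Polynomial.aeval_eq_sum_range, Finset.mul_sum]
    refine Finset.sum_congr rfl fun i _ => ?_
    rw [qHalfPow, qHalfPow, LaurentPolynomial.T_pow, LaurentPolynomial.smul_eq_C_mul,
      LaurentPolynomial.T_add, mul_left_comm, mul_comm (i : ℤ)]
  rw [this, AddMonoidAlgebra.coeff_sum, Finsupp.finsetSum_apply]
  refine Finset.sum_eq_zero fun i hi => ?_
  rw [← LaurentPolynomial.single_eq_C_mul_T, AddMonoidAlgebra.coeff_single]
  refine Finsupp.single_eq_of_ne ?_
  have := Finset.mem_range.1 hi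
  omega

lemma polyInQ_apply_two_mul (p : Polynomial ℤ) (k : ℕ) :
    (polyInQ p).coeff (2 * k) = p.coeff k := by
  have : polyInQ p = ∑ i ∈ Finset.range (p.natDegree + 1),
      LaurentPolynomial.C (p.coeff i) * LaurentPolynomial.T (2 * i) := by
    rw [polyInQ, Polynomial.aeval_eq_sum_range]
    refine Finset.sum_congr rfl fun i _ => ?_
    rw [qHalfPow, LaurentPolynomial.T_pow, LaurentPolynomial.smul_eq_C_mul, mul_comm (i : ℤ)]
  rw [this, AddMonoidAlgebra.coeff_sum, Finsupp.finsetSum_apply]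
  simp only [← LaurentPolynomial.single_eq_C_mul_T, AddMonoidAlgebra.coeff_single]
  rw [Finset.sum_eq_single k]
  · simp
  · intro i _ hi
    refine Finsupp.single_eq_of_ne ?_
    omega
  · intro hk
    rw [Finset.mem_range] at hk
    rw [Polynomial.coeff_eq_zero_of_natDegree_lt (by omega), Finsupp.single_zero]
    rfl

lemma polyInQ_eq_zero {p : Polynomial ℤ} (h : polyInQ p = 0) : p = 0 := by
  ext k
  rw [← polyInQ_apply_two_mul, h]
  rfl

/-- The difference of two families is bar-invariant. Its coefficient at `w` cancels, those off the
Bruhat interval vanish, and the degree bound makes the remaining ones strictly negative after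
rescaling by `q^{l(y)/2}`, so `eq_zero_of_bar_eq` applies. -/
theorem IsKLFamily.unique {w : ExtAffineWeyl} {P P' : ExtAffineWeyl →₀ Polynomial ℤ}
    (h : IsKLFamily w P) (h' : IsKLFamily w P') : P = P' := by
  let f : Polynomial ℤ →+ Coeff :=
    (AddMonoidHom.mulLeft (qHalfPow (-(length w : ℤ)))).comp
      (Polynomial.aeval (R := ℤ) (qHalfPow 2)).toRingHom.toAddMonoidHom
  have hf : ∀ p, f p = qHalfPow (-(length w : ℤ)) * polyInQ p := fun _ => rfl
  have hsum : ∀ Q : ExtAffineWeyl →₀ Polynomial ℤ,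
      ((Q.mapRange f (map_zero f)).sum fun y c => c • T y) = klSum w Q := by
    intro Q
    rw [Finsupp.sum_mapRange_index (by simp)]
    rfl
  have hD : (P - P').mapRange f (map_zero f) = 0 := by
    refine eq_zero_of_bar_eq _ (fun y k hk => ?_) ?_
    · rw [Finsupp.mapRange_apply, hf, ← mul_assoc, ← qHalfPow_add, Finsupp.sub_apply]
      by_cases hy : y = w
      · rw [hy, h.self, h'.self, sub_self]
        simp [polyInQ]
      · by_cases hle : BruhatLE y w
        · apply polyInQ_apply
          have h1 := h.degree_le y hle hy
          have h2 := h'.degree_le y hle hy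
          have h3 := Polynomial.natDegree_sub_le (P y) (P' y)
          have h4 : max (P y).natDegree (P' y).natDegree ≤ (P y).natDegree ∨
            max (P y).natDegree (P' y).natDegree ≤ (P' y).natDegree := by simp [le_total]
          omega
        · have h1 : P y = 0 := by_contra fun h0 => hle (h.support_le y h0)
          have h2 : P' y = 0 := by_contra fun h0 => hle (h'.support_le y h0)
          simp [h1, h2, polyInQ]
    · have e : ((P - P').mapRange f (map_zero f)).sum (fun y c => c • T y) =
          klSum w P - klSum w P' := by
        rw [Finsupp.mapRange_sub (by simp), Finsupp.sum_sub_index, hsum, hsum]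
        intro a b c
        rw [sub_smul]
      rw [e, map_sub, ← klSumBar_eq, ← klSumBar_eq, h.bar_eq, h'.bar_eq]
  rw [← sub_eq_zero]
  ext1 y
  have h1 := DFunLike.congr_fun hD y
  rw [Finsupp.mapRange_apply, hf] at h1
  have h2 := congrArg (qHalfPow (length w) * ·) h1
  simp only [← mul_assoc, ← qHalfPow_add, add_neg_cancel, qHalfPow_zero, one_mul] at h2
  exact polyInQ_eq_zero (by simpa using h2)

theorem C_eq_klSum {w : ExtAffineWeyl} {P : ExtAffineWeyl →₀ Polynomial ℤ}
    (h : IsKLFamily w P) : C w = klSum w P := by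
  have hex : ∃ P, IsKLFamily w P := ⟨P, h⟩
  rw [C, klPoly, dif_pos hex, hex.choose_spec.unique h]

end

/-! ### Explicit Kazhdan-Lusztig basis elements -/

section

attribute [local instance] heckeRing heckeMul heckeSub

/-- The frame of the element of `W` given by a word. -/
def wordFrame : List (Fin 3) → Frame
  | [] => ⟨0, 0, 1, 0, 0, 1⟩
  | i :: L => Frame.mul
      ((![⟨-1, -1, 0, -1, -1, 0⟩, ⟨0, 0, -1, 0, 0, 1⟩, ⟨0, 0, 0, 1, 1, 0⟩] : Fin 3 → Frame) i)
      (wordFrame L)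

lemma frame_word (L : List (Fin 3)) : frame (word L) = wordFrame L := by
  induction L with
  | nil => rfl
  | cons i L ih =>
    rw [word_cons, frame_mul, ih, wordFrame]
    congr 1
    fin_cases i
    exacts [frame_r, frame_s, frame_t]

lemma length_word (L : List (Fin 3)) : length (word L) = (wordFrame L).sep := by
  rw [length_eq_sep, sep, frame_word]

lemma T_word {L : List (Fin 3)} (h : (wordFrame L).sep = L.length) :
    T (word L) = (L.map fun i => T (gen i)).prod := by
  rw [← length_word] at h
  induction L with
  | nil => exact T_one
  | cons i L ih =>
    have h1 := length_mul_word_le 1 L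
    rw [one_mul, length_one] at h1
    have h2 := length_gen_mul i (word L)
    rw [word_cons, List.length_cons] at h
    rw [word_cons, T_mul (by rw [length_gen]; omega), ih (by omega), List.map_cons, List.prod_cons]

/-- If `L = A g B`, then `A g B = (A B)(B⁻¹ g B)`: restoring the deleted letter is right
multiplication by a reflection. -/
lemma bruhatLE_of_eraseIdx {L : List (Fin 3)} {n : ℕ} (hn : n < L.length)
    (h : (wordFrame (L.eraseIdx n)).sep < (wordFrame L).sep) :
    BruhatLE (word (L.eraseIdx n)) (word L) := by
  have e1 : word L = word (L.take n) * gen L[n] * word (L.drop (n + 1)) := by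
    conv_lhs => rw [← List.take_append_drop n L, List.drop_eq_getElem_cons hn]
    rw [word_append, word_cons, mul_assoc]
  have e2 : word (L.eraseIdx n) = word (L.take n) * word (L.drop (n + 1)) := by
    rw [List.eraseIdx_eq_take_drop_succ, word_append]
  refine Relation.ReflTransGen.single
    ⟨(word (L.drop (n + 1)))⁻¹, gen L[n], gen_mem _, ?_, by rwa [length_word, length_word]⟩
  rw [e1, e2, inv_inv]
  group

lemma klSum_add (w : ExtAffineWeyl) (P Q : ExtAffineWeyl →₀ Polynomial ℤ) :
    klSum w (P + Q) = klSum w P + klSum w Q := by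
  refine Finsupp.sum_add_index' (fun y => ?_) fun y p q => ?_
  · simp [polyInQ]
  · simp [polyInQ, mul_add, add_smul]

lemma klSum_single (w y : ExtAffineWeyl) (p : Polynomial ℤ) :
    klSum w (Finsupp.single y p) = (qHalfPow (-(length w : ℤ)) * polyInQ p) • T y := by
  refine Finsupp.sum_single_index ?_
  simp [polyInQ]

/-- The family with value `1` at the word `L₀` and, for each entry `(L, b)` of `l`, the value
`1 + q` or `1` at the word `L`, according to `b`. -/
def wordFamily (L₀ : List (Fin 3)) (l : List (List (Fin 3) × Bool)) :
    ExtAffineWeyl →₀ Polynomial ℤ :=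
  Finsupp.single (word L₀) 1 +
    (l.map fun e => Finsupp.single (word e.1) (if e.2 then 1 + Polynomial.X else 1)).sum

lemma klSum_wordFamily (L₀ : List (Fin 3)) (l : List (List (Fin 3) × Bool)) :
    klSum (word L₀) (wordFamily L₀ l) = qHalfPow (-(length (word L₀) : ℤ)) •
      (T (word L₀) + (l.map fun e => (if e.2 then 1 + qHalfPow 2 else 1 : Coeff) •
        T (word e.1)).sum) := by
  rw [wordFamily, klSum_add, klSum_single, smul_add]
  congr 1
  · simp [polyInQ]
  · induction l with
    | nil => simp [klSum]
    | cons e l ih =>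
      rw [List.map_cons, List.sum_cons, klSum_add, ih, klSum_single, List.map_cons, List.sum_cons,
        smul_add, smul_smul]
      congr 3
      split_ifs <;> simp [polyInQ]

lemma exists_of_list_sum_ne_zero {l : List (List (Fin 3) × Bool)} {y : ExtAffineWeyl}
    (h : (l.map fun e => (Finsupp.single (word e.1)
      (if e.2 then 1 + Polynomial.X else 1) : ExtAffineWeyl →₀ Polynomial ℤ)).sum y ≠ 0) :
    ∃ e ∈ l, word e.1 = y := by
  induction l with
  | nil => simp at h
  | cons e l ih =>
    by_cases he : word e.1 = y
    · exact ⟨e, List.mem_cons_self, he⟩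
    · rw [List.map_cons, List.sum_cons, Finsupp.add_apply, Finsupp.single_eq_of_ne (Ne.symm he),
        zero_add] at h
      obtain ⟨e, h1, h2⟩ := ih h
      exact ⟨e, List.mem_cons_of_mem _ h1, h2⟩

lemma natDegree_list_sum_le {l : List (List (Fin 3) × Bool)} {y : ExtAffineWeyl} {n : ℕ}
    (h : ∀ e ∈ l, word e.1 = y → e.2.toNat ≤ n) :
    ((l.map fun e => (Finsupp.single (word e.1)
      (if e.2 then 1 + Polynomial.X else 1) : ExtAffineWeyl →₀ Polynomial ℤ)).sum y).natDegree
      ≤ n := by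
  induction l with
  | nil => simp
  | cons e l ih =>
    rw [List.map_cons, List.sum_cons, Finsupp.add_apply]
    refine Polynomial.natDegree_add_le_of_degree_le ?_
      (ih fun e he => h e (List.mem_cons_of_mem _ he))
    by_cases he : word e.1 = y
    · have h1 := h e List.mem_cons_self he
      rw [← he, Finsupp.single_eq_same]
      split_ifs with h2
      · rw [h2] at h1
        refine le_trans (Polynomial.natDegree_add_le_of_degree_le (n := 1) (by simp) ?_) h1
        exact Polynomial.natDegree_X_le
      · simp
    · rw [Finsupp.single_eq_of_ne (Ne.symm he)]
      simp

/-- The combinatorial hypotheses are decidable. The list is required neither to be free of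
repetitions nor to exhaust the Bruhat interval: degrees are bounded on sums of coinciding entries,
and bar-invariance is a hypothesis on the total sum. -/
theorem isKLFamily_wordFamily {L₀ : List (Fin 3)} {l : List (List (Fin 3) × Bool)}
    (hdeg : ∀ e ∈ l, 2 * e.2.toNat + (wordFrame e.1).sep + 1 ≤ (wordFrame L₀).sep)
    (hle : ∀ e ∈ l, ∃ L ∈ L₀ :: l.map Prod.fst, ∃ n < L.length, L.eraseIdx n = e.1 ∧
      (wordFrame e.1).sep < (wordFrame L).sep)
    (hbar : bar (klSum (word L₀) (wordFamily L₀ l)) = klSum (word L₀) (wordFamily L₀ l)) :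
    IsKLFamily (word L₀) (wordFamily L₀ l) := by
  -- Induction on a bound `k` for the length deficit. Each listed word is obtained by deleting a
  -- letter of a strictly longer element of the list, so chains of deletions lead back to `L₀`.
  have hle' : ∀ k, ∀ L ∈ L₀ :: l.map Prod.fst, (wordFrame L₀).sep ≤ (wordFrame L).sep + k →
      BruhatLE (word L) (word L₀) := by
    intro k
    induction k with
    | zero =>
      intro L hL hk
      rcases List.mem_cons.1 hL with rfl | hL
      · exact Relation.ReflTransGen.refl
      · obtain ⟨e, he, rfl⟩ := List.mem_map.1 hL
        have := hdeg e he
        omega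
    | succ k ih =>
      intro L hL hk
      rcases List.mem_cons.1 hL with rfl | hL
      · exact Relation.ReflTransGen.refl
      · obtain ⟨e, he, rfl⟩ := List.mem_map.1 hL
        obtain ⟨L, h1, n, h2, h3, h4⟩ := hle e he
        rw [← h3] at h4 ⊢
        refine (bruhatLE_of_eraseIdx h2 h4).trans (ih L h1 ?_)
        rw [h3] at h4
        omega
  have hne : ∀ e ∈ l, word e.1 ≠ word L₀ := by
    intro e he h
    have h1 := hdeg e he
    rw [← length_word, ← length_word, h] at h1
    omega
  refine ⟨?_, ?_, ?_, ?_⟩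
  · intro y hy
    by_cases h : y = word L₀
    · rw [h]
      exact Relation.ReflTransGen.refl
    · rw [wordFamily, Finsupp.add_apply, Finsupp.single_eq_of_ne h, zero_add] at hy
      obtain ⟨e, he, rfl⟩ := exists_of_list_sum_ne_zero hy
      exact hle' _ e.1 (List.mem_cons_of_mem _ (List.mem_map_of_mem he)) (Nat.le_add_left _ _)
  · rw [wordFamily, Finsupp.add_apply, Finsupp.single_eq_same, add_eq_left]
    by_contra h
    obtain ⟨e, he, h1⟩ := exists_of_list_sum_ne_zero h
    exact hne e he h1
  · intro y hy hyw
    rw [wordFamily, Finsupp.add_apply, Finsupp.single_eq_of_ne hyw, zero_add]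
    have hlt := (length_le_of_bruhatLE hy).resolve_left hyw
    have h1 : _ ≤ (length (word L₀) - length y - 1) / 2 := natDegree_list_sum_le (l := l) (y := y)
      (n := (length (word L₀) - length y - 1) / 2) (by
        rintro e he rfl
        have := hdeg e he
        rw [← length_word, ← length_word] at this
        omega)
    omega
  · rw [klSumBar_eq, hbar]

/-- The Kazhdan-Lusztig element `q^{-1/2} (1 + T_g)` of the simple reflection `g = gen i`. -/
def CGen (i : Fin 3) : Hecke := qHalfPow (-1) • (1 + T (gen i))

lemma bar_CGen (i : Fin 3) : bar (CGen i) = CGen i := by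
  rw [CGen, bar_smul, map_add, map_one, bar_T, barT_gen, TInv, invert_qHalfPow, smul_add, smul_add,
    smul_smul, smul_smul, ← qHalfPow_add, mul_sub, ← qHalfPow_add]
  norm_num
  module

lemma bar_two_smul (h : Hecke) : bar (two • h) = two • bar h := by
  rw [bar_smul, two, map_add, invert_qHalfPow, invert_qHalfPow, neg_neg, add_comm]

/-- The working criterion: a bar-invariant `h`, usually a polynomial in the `CGen i`, is `C` of the
word once its expansion in the standard basis has the listed shape. -/
lemma C_eq_of_wordFamily {L₀ : List (Fin 3)} (l : List (List (Fin 3) × Bool)) {h : Hecke}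
    (hdeg : ∀ e ∈ l, 2 * e.2.toNat + (wordFrame e.1).sep + 1 ≤ (wordFrame L₀).sep)
    (hle : ∀ e ∈ l, ∃ L ∈ L₀ :: l.map Prod.fst, ∃ n < L.length, L.eraseIdx n = e.1 ∧
      (wordFrame e.1).sep < (wordFrame L).sep)
    (hred : (wordFrame L₀).sep = L₀.length)
    (hred' : ∀ e ∈ l, (wordFrame e.1).sep = e.1.length)
    (hbar : bar h = h)
    (hh : qHalfPow (-(L₀.length : ℤ)) •
      ((L₀.map fun i => T (gen i)).prod + (l.map fun e =>
        (if e.2 then 1 + qHalfPow 2 else 1 : Coeff) • (e.1.map fun i => T (gen i)).prod).sum) = h) :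
    C (word L₀) = h := by
  have e : klSum (word L₀) (wordFamily L₀ l) = h := by
    rw [klSum_wordFamily, length_word, hred, ← hh, T_word hred]
    congr 3
    refine List.map_congr_left fun e he => ?_
    rw [T_word (hred' e he)]
  rw [C_eq_klSum (isKLFamily_wordFamily hdeg hle _), e]
  rw [e, hbar]

end

/-! ### Expansions of products of `1 + T_g` in an abstract algebra -/

section Identities

variable {K A : Type*} [CommRing K] [Ring A] [Algebra K A] {v v' : K} {a b c : A}

lemma expand_rt (v' : K) (a c : A) :
    (v' ^ 2) • (a * c + (a + (c + 1))) = (v' • (1 + a)) * (v' • (1 + c)) := by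
  simp only [mul_add, add_mul, smul_mul_assoc, mul_smul_comm, one_mul, mul_one]
  module

lemma one_add_mul_self (ha : a * a = (v ^ 2 - 1) • a + (v ^ 2) • 1) :
    (1 + a) * (1 + a) = (1 + v ^ 2) • (1 + a) := by
  simp only [mul_add, add_mul, ha, one_mul, mul_one]
  module

lemma one_add_comm (hac : c * a = a * c) : (1 + c) * (1 + a) = (1 + a) * (1 + c) := by
  rw [mul_add, add_mul, add_mul, mul_add, add_mul, add_mul, hac]
  simp only [mul_one, one_mul]
  abel

/-- Here `v` is `q^{1/2}` and `a`, `b`, `c` are `T_r`, `T_s`, `T_t`. The summand `1` of `1 + b`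
contributes `(1 + v²)²` times `(1 + a)(1 + c)`; subtracting `[2] C_r C_t` lowers this to `1 + v²`,
the largest coefficient the degree bound permits. -/
lemma expand_rtsrt (hv : v * v' = 1) (ha : a * a = (v ^ 2 - 1) • a + (v ^ 2) • 1)
    (hc : c * c = (v ^ 2 - 1) • c + (v ^ 2) • 1) (hac : c * a = a * c) :
    (v' • (1 + a)) * (v' • (1 + c)) * (v' • (1 + b)) * ((v' • (1 + a)) * (v' • (1 + c))) -
      (v + v') • ((v' • (1 + a)) * (v' • (1 + c))) =
    (v' ^ 5) • ((1 + a) * (1 + c) * b * ((1 + a) * (1 + c)) +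
      (1 + v ^ 2) • ((1 + a) * (1 + c))) := by
  have h1 : (1 + a) * (1 + c) * ((1 + a) * (1 + c)) =
      (1 + v ^ 2) • (1 + v ^ 2) • ((1 + a) * (1 + c)) := by
    rw [mul_assoc, ← mul_assoc (1 + c), one_add_comm hac, mul_assoc, one_add_mul_self hc,
      mul_smul_comm, mul_smul_comm, ← mul_assoc, one_add_mul_self ha, smul_mul_assoc]
  have h2 : (v + v') * v' ^ 2 = v' ^ 5 * (v ^ 2 + v ^ 4) := by
    have e1 : v' ^ 5 * v ^ 2 = v' ^ 3 * (v * v') ^ 2 := by ring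
    have e2 : v' ^ 5 * v ^ 4 = v' * (v * v') ^ 4 := by ring
    have e3 : (v + v') * v' ^ 2 = v * v' * v' + v' ^ 3 := by ring
    rw [mul_add, e1, e2, e3, hv]
    ring
  have h3 : (1 + a) * (1 + c) * (1 + b) * ((1 + a) * (1 + c)) =
      (1 + a) * (1 + c) * b * ((1 + a) * (1 + c)) +
        (1 + v ^ 2) • (1 + v ^ 2) • ((1 + a) * (1 + c)) := by
    rw [mul_add, mul_one, add_mul, h1, add_comm]
  simp only [smul_mul_assoc, mul_smul_comm, h3, smul_smul]
  generalize (1 + a) * (1 + c) * b * ((1 + a) * (1 + c)) = X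
  generalize (1 + a) * (1 + c) = Y
  rw [show (v + v') * (v' * v') = v' ^ 5 * (v ^ 2 + v ^ 4) by rw [← h2]; ring]
  module

/-- Up to the correction term, this is the sum of the standard basis over the eight elements of the
dihedral group generated by two simple reflections. -/
lemma one_add_mul_four (hb : b * b = (v ^ 2 - 1) • b + (v ^ 2) • 1)
    (hc : c * c = (v ^ 2 - 1) • c + (v ^ 2) • 1) :
    (1 + b) * (1 + c) * (1 + b) * (1 + c) =
      1 + c + (b + b * c + c * b + c * b * c + b * c * b + b * c * b * c) +
        (2 * v ^ 2) • ((1 + b) * (1 + c)) := by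
  simp only [mul_add, add_mul, mul_one, one_mul, mul_assoc, hb, hc, mul_smul_comm,
    smul_mul_assoc]
  module

/-- The inner factor is `C_stst`, namely `q^{-2}` times the sum over the dihedral group. Its part `1
+ c` commutes with `1 + a`, so the two outer factors merge there and produce the coefficient `1 +
v²`. -/
lemma expand_rststr (hv : v * v' = 1) (ha : a * a = (v ^ 2 - 1) • a + (v ^ 2) • 1)
    (hb : b * b = (v ^ 2 - 1) • b + (v ^ 2) • 1)
    (hc : c * c = (v ^ 2 - 1) • c + (v ^ 2) • 1) (hac : c * a = a * c) :
    (v' • (1 + a)) * ((v' • (1 + b)) * (v' • (1 + c)) * (v' • (1 + b)) * (v' • (1 + c)) -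
      (2 : K) • ((v' • (1 + b)) * (v' • (1 + c)))) * (v' • (1 + a)) =
    (v' ^ 6) • ((1 + a) * (b + b * c + c * b + c * b * c + b * c * b + b * c * b * c) * (1 + a) +
      (1 + v ^ 2) • ((1 + a) * (1 + c))) := by
  have h1 : (v' • (1 + b)) * (v' • (1 + c)) * (v' • (1 + b)) * (v' • (1 + c)) -
      (2 : K) • ((v' • (1 + b)) * (v' • (1 + c))) = (v' ^ 4) •
        ((b + b * c + c * b + c * b * c + b * c * b + b * c * b * c) + (1 + c)) := by
    have h2 : v' * v' = v' ^ 4 * v ^ 2 := by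
      rw [show v' ^ 4 * v ^ 2 = v' * v' * (v * v') ^ 2 by ring, hv]
      ring
    simp only [smul_mul_assoc, mul_smul_comm, one_add_mul_four hb hc, smul_smul]
    generalize (1 + b) * (1 + c) = X
    generalize b + b * c + c * b + c * b * c + b * c * b + b * c * b * c = Y
    rw [show (2 : K) * (v' * v') = v' ^ 4 * (2 * v ^ 2) by linear_combination 2 * h2]
    module
  rw [h1]
  generalize b + b * c + c * b + c * b * c + b * c * b + b * c * b * c = Y
  have h3 : (1 + a) * (1 + c) * (1 + a) = (1 + v ^ 2) • ((1 + a) * (1 + c)) := by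
    rw [mul_assoc, one_add_comm hac, ← mul_assoc, one_add_mul_self ha, smul_mul_assoc]
  have h4 : (1 + a) * (Y + (1 + c)) * (1 + a) =
      (1 + a) * Y * (1 + a) + (1 + v ^ 2) • ((1 + a) * (1 + c)) := by
    rw [mul_add (1 + a) Y, add_mul _ _ (1 + a), h3]
  simp only [smul_mul_assoc, mul_smul_comm, smul_smul, h4]
  congr 1
  ring

end Identities

/-! ### The five Kazhdan–Lusztig elements occurring in the theorem -/

/-- The reduced words of the elements below `r t s r t`, with the degrees of the Kazhdan-Lusztig
polynomials. -/
def lowerWordsRTSRT : List (List (Fin 3) × Bool) :=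
  [([2, 1, 0, 2], false), ([0, 1, 0, 2], false), ([1, 0, 2], false),
    ([0, 2, 1, 2], false), ([2, 1, 2], false), ([0, 1, 2], false), ([1, 2], false),
    ([0, 2, 1, 0], false), ([2, 1, 0], false), ([0, 1, 0], false), ([1, 0], false),
    ([0, 2, 1], false), ([2, 1], false), ([0, 1], false), ([1], false),
    ([0, 2], true), ([0], true), ([2], true), ([], true)]

/-- The reduced words of the elements below `g s h s h g`, where `(g, h)` is `(r, t)` or
`(t, r)`, with the degrees of the Kazhdan-Lusztig polynomials. -/
def lowerWords (i k : Fin 3) : List (List (Fin 3) × Bool) :=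
  [([1, k, 1, k, i], false), ([i, 1, k, 1, k], false), ([1, k, 1, k], false),
    ([i, k, 1, k, i], false), ([k, 1, k, i], false), ([i, k, 1, k], false), ([k, 1, k], false),
    ([i, 1, k, 1, i], false), ([1, k, 1, i], false), ([i, 1, k, 1], false), ([1, k, 1], false),
    ([i, 1, k, i], false), ([1, k, i], false), ([i, 1, k], false), ([1, k], false),
    ([i, k, 1, i], false), ([k, 1, i], false), ([i, k, 1], false), ([k, 1], false),
    ([i, 1, i], false), ([1, i], false), ([i, 1], false), ([1], false),
    ([i, k], true), ([i], true), ([k], true), ([], true)]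

section

attribute [local instance] heckeRing heckeMul heckeSub

lemma T_mul_self' (i : Fin 3) :
    T (gen i) * T (gen i) = (qHalfPow 1 ^ 2 - 1) • T (gen i) + (qHalfPow 1 ^ 2) • 1 := by
  rw [T_gen_mul_self, show (2 : ℤ) = 1 + 1 by norm_num, qHalfPow_add, sq]

lemma r_mul_t : r * t = t * r := by
  apply frame_injective; simp [frame_mul, frame_r, frame_t, Frame.mul]

lemma T_t_mul_T_r : T (gen 2) * T (gen 0) = T (gen 0) * T (gen 2) := by
  have h1 : (wordFrame [2, 0]).sep = [2, 0].length := by decide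
  have h2 : (wordFrame [0, 2]).sep = [0, 2].length := by decide
  have e1 := T_word h1
  have e2 := T_word h2
  have e3 : word [2, 0] = word [0, 2] := by simp [word, gen, r_mul_t]
  rw [e3, e2] at e1
  simpa using e1.symm

lemma qHalfPow_mul_neg : qHalfPow 1 * qHalfPow (-1) = 1 := by
  rw [← qHalfPow_add, add_neg_cancel, qHalfPow_zero]

lemma qHalfPow_neg_natCast (n : ℕ) : qHalfPow (-(n : ℤ)) = qHalfPow (-1) ^ n := by
  simp [qHalfPow, LaurentPolynomial.T_pow]

lemma qHalfPow_two : qHalfPow 2 = qHalfPow 1 ^ 2 := by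
  simp [qHalfPow, LaurentPolynomial.T_pow]

theorem C_rt : C (r * t) = CGen 0 * CGen 2 := by
  rw [show r * t = word [0, 2] by simp [word, gen]]
  refine C_eq_of_wordFamily [([0], false), ([2], false), ([], false)] (by decide) (by decide)
    (by decide) (by decide) ?_ ?_
  · rw [map_mul, bar_CGen, bar_CGen]
  · rw [qHalfPow_neg_natCast, CGen, CGen, ← expand_rt]
    simp

theorem C_rtsrt : C (r * t * s * r * t) =
    CGen 0 * CGen 2 * CGen 1 * (CGen 0 * CGen 2) - two • (CGen 0 * CGen 2) := by
  rw [show r * t * s * r * t = word [0, 2, 1, 0, 2] by simp [word, gen, mul_assoc]]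
  refine C_eq_of_wordFamily lowerWordsRTSRT (by decide) (by decide) (by decide) (by decide) ?_ ?_
  · simp only [map_sub, map_mul, bar_two_smul, bar_CGen]
  · simp only [CGen, two]
    rw [qHalfPow_neg_natCast, expand_rtsrt qHalfPow_mul_neg (T_mul_self' 0) (T_mul_self' 2)
      T_t_mul_T_r]
    simp only [lowerWordsRTSRT, List.map_cons, List.map_nil, List.prod_cons, List.prod_nil,
      List.sum_cons, List.sum_nil, mul_one, one_smul, if_true, if_false, Bool.false_eq_true,
      qHalfPow_two, List.length_cons, List.length_nil, zero_add, Nat.reduceAdd]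
    simp only [mul_add, add_mul, mul_one, one_mul, mul_assoc]
    module

/-- Stated for two commuting nodes `i` and `k`, so that the elements for `rststr` and `tsrsrt` come
from one calculation with `r` and `t` exchanged. -/
lemma C_of_lowerWords {i k : Fin 3} (h1 : T (gen k) * T (gen i) = T (gen i) * T (gen k))
    (hdeg : ∀ e ∈ lowerWords i k, 2 * e.2.toNat + (wordFrame e.1).sep + 1 ≤
      (wordFrame [i, 1, k, 1, k, i]).sep)
    (hle : ∀ e ∈ lowerWords i k, ∃ L ∈ [i, 1, k, 1, k, i] :: (lowerWords i k).map Prod.fst,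
      ∃ n < L.length, L.eraseIdx n = e.1 ∧ (wordFrame e.1).sep < (wordFrame L).sep)
    (hred : (wordFrame [i, 1, k, 1, k, i]).sep = [i, 1, k, 1, k, i].length)
    (hred' : ∀ e ∈ lowerWords i k, (wordFrame e.1).sep = e.1.length) :
    C (word [i, 1, k, 1, k, i]) = CGen i *
      (CGen 1 * CGen k * CGen 1 * CGen k - (2 : Coeff) • (CGen 1 * CGen k)) * CGen i := by
  refine C_eq_of_wordFamily (lowerWords i k) hdeg hle hred hred' ?_ ?_
  · simp only [map_sub, map_mul, bar_smul, bar_CGen, map_ofNat]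
  · simp only [CGen]
    rw [qHalfPow_neg_natCast, expand_rststr qHalfPow_mul_neg (T_mul_self' i) (T_mul_self' 1)
      (T_mul_self' k) h1]
    simp only [lowerWords, List.map_cons, List.map_nil, List.prod_cons, List.prod_nil,
      List.sum_cons, List.sum_nil, mul_one, one_smul, if_true, if_false, Bool.false_eq_true,
      qHalfPow_two, List.length_cons, List.length_nil, zero_add, Nat.reduceAdd]
    simp only [mul_add, add_mul, mul_one, one_mul, mul_assoc]
    module

theorem C_rststr : C (r * s * t * s * t * r) = CGen 0 *
    (CGen 1 * CGen 2 * CGen 1 * CGen 2 - (2 : Coeff) • (CGen 1 * CGen 2)) * CGen 0 := by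
  rw [show r * s * t * s * t * r = word [0, 1, 2, 1, 2, 0] by simp [word, gen, mul_assoc]]
  exact C_of_lowerWords T_t_mul_T_r (by decide) (by decide) (by decide) (by decide)

theorem C_tsrsrt : C (t * s * r * s * r * t) = CGen 2 *
    (CGen 1 * CGen 0 * CGen 1 * CGen 0 - (2 : Coeff) • (CGen 1 * CGen 0)) * CGen 2 := by
  rw [show t * s * r * s * r * t = word [2, 1, 0, 1, 0, 2] by simp [word, gen, mul_assoc]]
  exact C_of_lowerWords T_t_mul_T_r.symm (by decide) (by decide) (by decide) (by decide)

/-- Length zero leaves nothing strictly below `ω`, and `T ω` is its own inverse, hence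
bar-invariant. -/
theorem C_ω : C ω = T ω := by
  have h : IsKLFamily ω (Finsupp.single ω 1) := by
    refine ⟨fun y hy => ?_, Finsupp.single_eq_same, fun y hy hne => ?_, ?_⟩
    · by_cases h : y = ω
      · rw [h]
        exact Relation.ReflTransGen.refl
      · exact absurd (Finsupp.single_eq_of_ne h) hy
    · have := (length_le_of_bruhatLE hy).resolve_left hne
      rw [length_ω] at this
      omega
    · rw [klSumBar_eq, klSum_single, length_ω]
      simp [polyInQ, bar_T, barT_ω, qHalfPow_zero]
  rw [C_eq_klSum h, klSum_single, length_ω]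
  simp [polyInQ, qHalfPow_zero]

end

/-! ### The two key identities in an abstract algebra -/

section Identities

variable {K A : Type*} [CommRing K] [Ring A] [Algebra K A] {v v' : K} {a b c o : A}

/-- Now `a`, `b`, `c` are the Kazhdan–Lusztig elements `C_r`, `C_s`, `C_t`, and the bracket is `S
x₂` with a right factor `T ω` removed. As `a (a - v) = v' a` and `c (c - v') = v c`, the factor `a
c` absorbs the leading factors of the bracket; no relation for `b` is needed. -/
lemma key_identity_two (hv : v * v' = 1) (ha : a * a = (v + v') • a)
    (hc : c * c = (v + v') • c) (hca : c * a = a * c) :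
    a * c * ((c - v' • 1) * (b - v' • 1) * (c - v' • 1) + (a - v • 1) * (b - v • 1) * (a - v • 1) +
      (b - v' • 1) * (c - v' • 1) * (a - v • 1) + (c - v' • 1) * (a - v • 1) * (b - v • 1)) =
    a * c * b * (a * c) - (v + v') • (a * c) - (v + v') • (a * c) := by
  have ha' : ∀ x, a * (a * x) = (v + v') • (a * x) := fun x => by
    rw [← mul_assoc, ha, smul_mul_assoc]
  have hc' : ∀ x, c * (c * x) = (v + v') • (c * x) := fun x => by
    rw [← mul_assoc, hc, smul_mul_assoc]
  have hca' : ∀ x, c * (a * x) = a * (c * x) := fun x => by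
    rw [← mul_assoc, hca, mul_assoc]
  simp only [mul_add, add_mul, mul_sub, sub_mul, mul_smul_comm, smul_mul_assoc, mul_one, one_mul,
    mul_assoc, ha, ha', hc, hc', hca, hca', smul_sub, smul_smul]
  match_scalars <;> grind

/-- The bracket is `S x₁`: the four `θ` of the orbit and the term `1` from the zero weight. The
hypotheses `hcb` and `hab` are the braid relations, expressed in the Kazhdan–Lusztig generators. -/
lemma key_identity_one (hv : v * v' = 1) (ha : a * a = (v + v') • a)
    (hb : b * b = (v + v') • b) (hc : c * c = (v + v') • c) (hca : c * a = a * c)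
    (hcb : c * b * c * b = b * c * b * c - (2 : K) • (b * c) + (2 : K) • (c * b))
    (hab : a * b * a * b = b * a * b * a - (2 : K) • (b * a) + (2 : K) • (a * b)) :
    a * c * ((b - v' • 1) * (c - v' • 1) * (b - v' • 1) * (a - v' • 1) +
        (a - v • 1) * (b - v • 1) * (c - v • 1) * (b - v • 1) +
        (c - v' • 1) * (b - v' • 1) * (a - v' • 1) * (b - v • 1) +
        (b - v' • 1) * (a - v • 1) * (b - v • 1) * (c - v • 1) + 1) =
      a * (b * c * b * c - (2 : K) • (b * c)) * a + c * (b * a * b * a - (2 : K) • (b * a)) * c -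
        (v + v') • (a * c * b * (a * c) - (v + v') • (a * c)) + a * c := by
  have ha' : ∀ x, a * (a * x) = (v + v') • (a * x) := fun x => by
    rw [← mul_assoc, ha, smul_mul_assoc]
  have hc' : ∀ x, c * (c * x) = (v + v') • (c * x) := fun x => by
    rw [← mul_assoc, hc, smul_mul_assoc]
  have hca' : ∀ x, c * (a * x) = a * (c * x) := fun x => by
    rw [← mul_assoc, hca, mul_assoc]
  have hcb1 : c * (b * (c * b)) = b * (c * (b * c)) - (2 : K) • (b * c) + (2 : K) • (c * b) := by
    simpa only [mul_assoc] using hcb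
  have hcb2 : ∀ x, c * (b * (c * (b * x))) = b * (c * (b * (c * x))) - (2 : K) • (b * (c * x)) +
      (2 : K) • (c * (b * x)) := fun x => by
    have := congrArg (· * x) hcb1
    simpa only [mul_assoc, add_mul, sub_mul, smul_mul_assoc] using this
  -- Moving `a` to the left of `c` hides the subword `abab` inside `acbab`, so the braid relation is
  -- also needed in this overlapping form for the rewriting to reach a normal form.
  have hab1 : a * (c * (b * (a * b))) =
      c * (b * (a * (b * a))) - (2 : K) • (c * (b * a)) + (2 : K) • (a * (c * b)) := by
    rw [← hca', ← hca']
    have := congrArg (c * ·) hab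
    simpa only [mul_assoc, mul_add, mul_sub, mul_smul_comm] using this
  have hab2 : ∀ x, a * (c * (b * (a * (b * x)))) =
      c * (b * (a * (b * (a * x)))) - (2 : K) • (c * (b * (a * x))) +
        (2 : K) • (a * (c * (b * x))) := fun x => by
    have := congrArg (· * x) hab1
    simpa only [mul_assoc, add_mul, sub_mul, smul_mul_assoc] using this
  simp only [mul_add, add_mul, mul_sub, sub_mul, mul_smul_comm, smul_mul_assoc, mul_one, one_mul,
    mul_assoc, ha', hb, hc, hc', hca, hca', hcb1, hcb2, hab1, hab2, smul_add, smul_sub,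
    smul_smul]
  match_scalars <;> grind

end Identities

/-! ### Bernstein's elements -/

section

attribute [local instance] heckeRing heckeMul heckeSub

lemma length_weightElt (x : Weight) : length (weightElt x) =
    x.1.natAbs + x.2.natAbs + (x.2 - x.1).natAbs + (x.2 + x.1).natAbs := by
  rw [length_eq_sep, sep, frame_weightElt]
  simp only [Frame.sep, Frame.fst, Frame.snd, wallCount]
  rw [show (4 * x.1 - 1 - 2 * 0) / 4 + 1 = x.1 by omega,
    show (4 * x.2 - 0 - 2 * 1) / 4 + 1 = x.2 by omega,
    show (4 * x.2 - 0 - 2 * 1 - (4 * x.1 - 1 - 2 * 0)) / 4 + 1 = x.2 - x.1 by omega,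
    show (4 * x.2 - 0 - 2 * 1 + (4 * x.1 - 1 - 2 * 0)) / 4 + 1 = x.2 + x.1 by omega]

lemma frame_w₀ : frame w₀ = ⟨0, 0, -1, 0, 0, -1⟩ := by
  simp [w₀, frame_mul, frame_s, frame_t, Frame.mul]

lemma length_weightElt_mul_w₀ (x : Weight) : length (weightElt x * w₀) =
    (x.1 + 1).natAbs + (x.2 + 1).natAbs + (x.2 - x.1 + 1).natAbs + (x.2 + x.1 + 1).natAbs := by
  rw [length_eq_sep, sep, frame_mul, frame_weightElt, frame_w₀]
  simp only [Frame.mul, Frame.sep, Frame.fst, Frame.snd, wallCount]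
  congr 2 <;> [congr 2; skip; skip] <;> omega

lemma length_w₀ : length w₀ = 4 := by
  rw [length_eq_sep, sep, frame_w₀]
  rfl

/-- Multiplying by `w₀` replaces each `|k|` in the length by `|k + 1|`, for `k` among `m`, `n`, `n -
m`, `n + m`. A total gain of `4` forces each of the four to be nonnegative. -/
lemma mem_dominantWeights {x : Weight} : x ∈ dominantWeights ↔ 0 ≤ x.1 ∧ x.1 ≤ x.2 := by
  change length (weightElt x * w₀) = length (weightElt x) + length w₀ ↔ _
  rw [length_weightElt_mul_w₀, length_weightElt, length_w₀]
  omega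

/-- The normalised element `q^{-l(x)/2} T_x` for a weight `x`. -/
def weightT (x : Weight) : Hecke := qHalfPow (-(length (weightElt x) : ℤ)) • T (weightElt x)

lemma weightElt_add (x y : Weight) : weightElt (x + y) = weightElt x * weightElt y := by
  simp [weightElt]

/-- On the dominant chamber the four absolute values in the length have constant sign, so length is
additive. -/
lemma weightT_add {x y : Weight} (hx : x ∈ dominantWeights) (hy : y ∈ dominantWeights) :
    weightT (x + y) = weightT x * weightT y := by
  rw [mem_dominantWeights] at hx hy
  have h : length (weightElt x * weightElt y) =
      length (weightElt x) + length (weightElt y) := by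
    rw [← weightElt_add, length_weightElt, length_weightElt, length_weightElt]
    simp only [Prod.fst_add, Prod.snd_add]
    omega
  rw [weightT, weightElt_add, T_mul h, h, weightT, weightT, smul_mul_assoc, mul_smul_comm,
    smul_smul, ← qHalfPow_add]
  congr 2
  push_cast
  ring

lemma weightT_commute {x y : Weight} (hx : x ∈ dominantWeights) (hy : y ∈ dominantWeights) :
    weightT x * weightT y = weightT y * weightT x := by
  rw [← weightT_add hx hy, ← weightT_add hy hx, add_comm]

lemma isUnit_weightT (x : Weight) : IsUnit (weightT x) := by
  obtain ⟨u, hu⟩ := isUnit_T (weightElt x)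
  refine ⟨⟨weightT x, qHalfPow (length (weightElt x)) • ↑u⁻¹, ?_, ?_⟩, rfl⟩ <;>
    rw [weightT, ← hu, smul_mul_assoc, mul_smul_comm, smul_smul, ← qHalfPow_add] <;>
    simp [qHalfPow_zero]

lemma mul_inverse_eq_mul_inverse {R : Type*} [Ring R] {a b c d : R} (hb : IsUnit b)
    (hd : IsUnit d) (hbd : b * d = d * b) (h : a * d = c * b) :
    a * Ring.inverse b = c * Ring.inverse d := by
  obtain ⟨b, rfl⟩ := hb
  obtain ⟨d, rfl⟩ := hd
  rw [Ring.inverse_unit, Ring.inverse_unit, Units.mul_inv_eq_iff_eq_mul, mul_assoc]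
  have hc : Commute (b : R) d := hbd
  rw [(hc.symm.units_inv_left).eq, ← mul_assoc, ← h, Units.mul_inv_cancel_right]

/-- The normalised elements of dominant weights commute, so a quotient depends only on the
difference. This replaces the arbitrary choice in the definition of `θ` by any convenient pair. -/
theorem θ_eq {x a b : Weight} (ha : a ∈ dominantWeights) (hb : b ∈ dominantWeights)
    (h : x = a - b) : θ x = weightT a * Ring.inverse (weightT b) := by
  have hex : ∃ p : Weight × Weight,
    p.1 ∈ dominantWeights ∧ p.2 ∈ dominantWeights ∧ x = p.1 - p.2 := ⟨(a, b), ha, hb, h⟩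
  obtain ⟨h1, h2, h3⟩ := Classical.epsilon_spec hex
  change weightT _ * Ring.inverse (weightT _) = _
  refine mul_inverse_eq_mul_inverse (isUnit_weightT _) (isUnit_weightT _)
    (weightT_commute h2 hb) ?_
  rw [← weightT_add h1 hb, ← weightT_add ha h2]
  congr 1
  rw [← sub_eq_sub_iff_add_eq_add, ← h]
  exact h3.symm

lemma T_gen_eq (i : Fin 3) : qHalfPow (-1) • T (gen i) = CGen i - qHalfPow (-1) • 1 := by
  rw [CGen, smul_add]
  abel

/-- `q^{-1/2} T_g` for the simple reflection `g = gen i`. -/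
def normT (i : Fin 3) : Hecke := CGen i - qHalfPow (-1) • 1

/-- The inverse of `normT i`. -/
def normTInv (i : Fin 3) : Hecke := CGen i - qHalfPow 1 • 1

lemma normT_eq (i : Fin 3) : normT i = qHalfPow (-1) • T (gen i) := (T_gen_eq i).symm

lemma normTInv_eq (i : Fin 3) : normTInv i = qHalfPow 1 • TInv i := by
  rw [normTInv, CGen, TInv, smul_add, smul_add, smul_smul, smul_smul, mul_sub, ← qHalfPow_add]
  norm_num
  module

lemma normT_mul_normTInv (i : Fin 3) : normT i * normTInv i = 1 := by
  rw [normT_eq, normTInv_eq, smul_mul_assoc, mul_smul_comm, smul_smul, T_mul_TInv, ← qHalfPow_add,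
    neg_add_cancel, qHalfPow_zero, one_smul]

lemma normTInv_mul_normT (i : Fin 3) : normTInv i * normT i = 1 := by
  rw [normT_eq, normTInv_eq, smul_mul_assoc, mul_smul_comm, smul_smul, TInv_mul_T, ← qHalfPow_add,
    add_neg_cancel, qHalfPow_zero, one_smul]

lemma normT_mul_normTInv_assoc (i : Fin 3) (x : Hecke) : normT i * (normTInv i * x) = x := by
  rw [← mul_assoc, normT_mul_normTInv, one_mul]

lemma normTInv_mul_normT_assoc (i : Fin 3) (x : Hecke) : normTInv i * (normT i * x) = x := by
  rw [← mul_assoc, normTInv_mul_normT, one_mul]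

lemma CGen_comm : CGen 2 * CGen 0 = CGen 0 * CGen 2 := by
  rw [CGen, CGen, smul_mul_assoc, mul_smul_comm, smul_mul_assoc, mul_smul_comm,
    one_add_comm T_t_mul_T_r]

lemma normT_normTInv_comm : normT 0 * normTInv 2 = normTInv 2 * normT 0 := by
  rw [normT, normTInv]
  simp only [mul_sub, sub_mul, CGen_comm, smul_mul_assoc, mul_smul_comm, mul_one, one_mul]
  module

lemma normTInv_comm : normTInv 0 * normTInv 2 = normTInv 2 * normTInv 0 := by
  rw [normTInv, normTInv]
  simp only [mul_sub, sub_mul, CGen_comm, smul_mul_assoc, mul_smul_comm, mul_one, one_mul]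
  module

lemma T_ω_mul_T (i j : Fin 3) (h : ω * gen i = gen j * ω) :
    T ω * T (gen i) = T (gen j) * T ω := by
  rw [← T_ω_mul, h, T_mul_ω]

lemma T_ω_mul_CGen {i j : Fin 3} (h : ω * gen i = gen j * ω) :
    T ω * CGen i = CGen j * T ω := by
  rw [CGen, CGen, mul_smul_comm, smul_mul_assoc, mul_add, add_mul, T_ω_mul_T i j h, mul_one,
    one_mul]

lemma T_ω_mul_normT {i j : Fin 3} (h : ω * gen i = gen j * ω) :
    T ω * normT i = normT j * T ω := by
  rw [normT, normT, mul_sub, sub_mul, T_ω_mul_CGen h, mul_smul_comm, smul_mul_assoc, mul_one,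
    one_mul]

lemma T_ω_mul_normTInv {i j : Fin 3} (h : ω * gen i = gen j * ω) :
    T ω * normTInv i = normTInv j * T ω := by
  rw [normTInv, normTInv, mul_sub, sub_mul, T_ω_mul_CGen h, mul_smul_comm, smul_mul_assoc,
    mul_one, one_mul]

lemma ω_mul_gen_zero : ω * gen 0 = gen 2 * ω := ω_mul_r
lemma ω_mul_gen_one : ω * gen 1 = gen 1 * ω := ω_mul_s
lemma ω_mul_gen_two : ω * gen 2 = gen 0 * ω := ω_mul_t

lemma weightT_x₁ : weightT x₁ = normT 1 * (normT 2 * (normT 1 * normT 0)) := by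
  have h : weightElt x₁ = word [1, 2, 1, 0] := by
    apply frame_injective
    rw [frame_word, frame_weightElt]
    rfl
  have hs : (wordFrame [1, 2, 1, 0]).sep = 4 := by decide
  rw [weightT, h, T_word hs, length_word, hs, qHalfPow_neg_natCast]
  simp only [normT_eq, smul_mul_assoc, mul_smul_comm, smul_smul, List.map_cons, List.map_nil,
    List.prod_cons, List.prod_nil, mul_one]
  congr 1
  ring

lemma weightT_x₂ : weightT x₂ = normT 2 * (normT 1 * (normT 2 * T ω)) := by
  have h : weightElt x₂ = word [2, 1, 2] * ω := by
    apply frame_injective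
    rw [frame_mul, frame_word, frame_weightElt, frame_ω]
    rfl
  have hs : (wordFrame [2, 1, 2]).sep = 3 := by decide
  rw [weightT, h, T_mul_ω, length_mul_ω, T_word hs, length_word, hs, qHalfPow_neg_natCast]
  simp only [normT_eq, smul_mul_assoc, mul_smul_comm, smul_smul, List.map_cons, List.map_nil,
    List.prod_cons, List.prod_nil, mul_one, mul_assoc]
  congr 1
  ring

lemma weightT_zero : weightT 0 = 1 := by
  rw [weightT, show weightElt 0 = 1 from rfl, length_one, T_one]
  simp [qHalfPow_zero]

lemma inverse_weightT_x₁ : Ring.inverse (weightT x₁) =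
    normTInv 0 * (normTInv 1 * (normTInv 2 * normTInv 1)) := by
  refine inverse_eq_of_mul_eq_one ?_ ?_ <;>
    simp only [weightT_x₁, mul_assoc, normT_mul_normTInv_assoc, normTInv_mul_normT_assoc,
      normT_mul_normTInv, normTInv_mul_normT]

lemma T_ω_mul_self_assoc (x : Hecke) : T ω * (T ω * x) = x := by
  rw [← mul_assoc, T_ω_mul_self, one_mul]

lemma inverse_weightT_x₂ : Ring.inverse (weightT x₂) =
    T ω * (normTInv 2 * (normTInv 1 * normTInv 2)) := by
  refine inverse_eq_of_mul_eq_one ?_ ?_ <;>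
    simp only [weightT_x₂, mul_assoc, normT_mul_normTInv_assoc, normTInv_mul_normT_assoc,
      normT_mul_normTInv, T_ω_mul_self_assoc, T_ω_mul_self]

/-- Pushing `T ω` to the right exchanges the nodes `0` and `2`. This form cancels against the tail
of `weightT x₁`. -/
lemma inverse_weightT_x₂' : Ring.inverse (weightT x₂) =
    normTInv 0 * (normTInv 1 * (normTInv 0 * T ω)) := by
  rw [inverse_weightT_x₂, ← mul_assoc, T_ω_mul_normTInv ω_mul_gen_two, mul_assoc,
    ← mul_assoc (T ω), T_ω_mul_normTInv ω_mul_gen_one, mul_assoc, T_ω_mul_normTInv ω_mul_gen_two]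

lemma x₁_mem : x₁ ∈ dominantWeights := by rw [mem_dominantWeights]; decide
lemma x₂_mem : x₂ ∈ dominantWeights := by rw [mem_dominantWeights]; decide
lemma zero_mem_dominantWeights : 0 ∈ dominantWeights := by rw [mem_dominantWeights]; decide
lemma two_x₂_mem : x₂ + x₂ ∈ dominantWeights := by rw [mem_dominantWeights]; decide

lemma θ_of_dominant {x : Weight} (hx : x ∈ dominantWeights) : θ x = weightT x := by
  rw [θ_eq hx zero_mem_dominantWeights (sub_zero x).symm, weightT_zero, Ring.inverse_one, mul_one]

lemma θ_neg_of_dominant {x : Weight} (hx : x ∈ dominantWeights) :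
    θ (-x) = Ring.inverse (weightT x) := by
  rw [θ_eq zero_mem_dominantWeights hx (zero_sub x).symm, weightT_zero, one_mul]

lemma θ_zero : θ 0 = 1 := by
  rw [θ_of_dominant zero_mem_dominantWeights, weightT_zero]

lemma θ_one_zero : θ (1, 0) = normT 1 * (normT 2 * (normTInv 0 * T ω)) := by
  rw [θ_eq x₁_mem x₂_mem (by decide), weightT_x₁, inverse_weightT_x₂']
  simp only [mul_assoc, normT_mul_normTInv_assoc]

lemma θ_neg_one_zero : θ (-1, 0) = normT 2 * (normTInv 0 * (normTInv 1 * T ω)) := by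
  rw [θ_eq x₂_mem x₁_mem (by decide), weightT_x₂, inverse_weightT_x₁]
  have e : T ω * (normTInv 0 * (normTInv 1 * (normTInv 2 * normTInv 1))) =
      normTInv 2 * (normTInv 1 * (normTInv 0 * (normTInv 1 * T ω))) := by
    rw [← mul_assoc, T_ω_mul_normTInv ω_mul_gen_zero, mul_assoc, ← mul_assoc (T ω),
      T_ω_mul_normTInv ω_mul_gen_one, mul_assoc, ← mul_assoc (T ω),
      T_ω_mul_normTInv ω_mul_gen_two, mul_assoc, T_ω_mul_normTInv ω_mul_gen_one]
  simp only [mul_assoc, e, normT_mul_normTInv_assoc]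

/-- The weight is `2 x₂ - x₁`, so `θ` is `weightT x₂` times the already computed value at `x₂ - x₁`.
The weight `x₁ - 2 x₂` below is handled in the same way. -/
lemma θ_neg_one_one : θ (-1, 1) = normT 2 * (normT 1 * (normT 0 * normTInv 1)) := by
  have h := θ_neg_one_zero
  rw [θ_eq x₂_mem x₁_mem (by decide)] at h
  rw [θ_eq two_x₂_mem x₁_mem (by decide), weightT_add x₂_mem x₂_mem, mul_assoc, h, weightT_x₂]
  have e : T ω * (normT 2 * (normTInv 0 * (normTInv 1 * T ω))) =
      normT 0 * (normTInv 2 * normTInv 1) := by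
    rw [← mul_assoc, T_ω_mul_normT ω_mul_gen_two, mul_assoc, ← mul_assoc (T ω),
      T_ω_mul_normTInv ω_mul_gen_zero, mul_assoc, ← mul_assoc (T ω),
      T_ω_mul_normTInv ω_mul_gen_one, mul_assoc, T_ω_mul_self, mul_one]
  have e2 : normT 0 * (normTInv 2 * normTInv 1) = normTInv 2 * (normT 0 * normTInv 1) := by
    rw [← mul_assoc, normT_normTInv_comm, mul_assoc]
  simp only [mul_assoc, e, e2, normT_mul_normTInv_assoc]

lemma θ_one_neg_one : θ (1, -1) = normT 1 * (normTInv 0 * (normTInv 1 * normTInv 2)) := by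
  have h := θ_one_zero
  rw [θ_eq x₁_mem x₂_mem (by decide)] at h
  rw [θ_eq x₁_mem two_x₂_mem (by decide), weightT_add x₂_mem x₂_mem,
    inverse_mul (isUnit_weightT _) (isUnit_weightT _), ← mul_assoc, h, inverse_weightT_x₂]
  have e2 : normTInv 0 * (normTInv 2 * (normTInv 1 * normTInv 2)) =
      normTInv 2 * (normTInv 0 * (normTInv 1 * normTInv 2)) := by
    rw [← mul_assoc, normTInv_comm, mul_assoc]
  simp only [mul_assoc, T_ω_mul_self_assoc, e2, normT_mul_normTInv_assoc]

end

/-! ### The central elements -/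

/-- `W₀` consists of all signed permutations. The eight listed points need not be distinct; for the
weights `x₁` and `x₂` they collapse to four. -/
lemma orbit_eq (x : Weight) : MulAction.orbit weylGroup x =
    {(x.1, x.2), (-x.1, x.2), (x.1, -x.2), (-x.1, -x.2),
      (x.2, x.1), (-x.2, x.1), (x.2, -x.1), (-x.2, -x.1)} := by
  have hs : longReflection ∈ weylGroup := Subgroup.subset_closure (by simp)
  have ht : shortReflection ∈ weylGroup := Subgroup.subset_closure (by simp)
  have mem : ∀ σ (hσ : σ ∈ weylGroup), σ x ∈ MulAction.orbit weylGroup x :=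
    fun σ hσ => ⟨⟨σ, hσ⟩, rfl⟩
  ext y
  constructor
  · rintro ⟨⟨σ, hσ⟩, rfl⟩
    have h := isSigned_linear σ hσ
    change σ x ∈ _
    rw [linearEquiv_apply_eq]
    simp only [Frame.IsSigned] at h
    simp only [Set.mem_insert_iff, Set.mem_singleton_iff, Prod.ext_iff, Prod.fst_add, Prod.snd_add,
      Prod.smul_fst, Prod.smul_snd, smul_eq_mul]
    rcases h with ⟨ha | ha, hb, hc, hd | hd⟩ | ⟨ha, hb | hb, hc | hc, hd⟩ <;>
      simp [ha, hb, hc, hd]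
  · rintro (rfl | rfl | rfl | rfl | rfl | rfl | rfl | rfl)
    · exact mem 1 (one_mem _)
    · exact mem _ hs
    · exact mem _ (mul_mem (mul_mem ht hs) ht)
    · exact mem _ (mul_mem (mul_mem (mul_mem ht hs) ht) hs)
    · exact mem _ ht
    · exact mem _ (mul_mem hs ht)
    · exact mem _ (mul_mem ht hs)
    · exact mem _ (mul_mem (mul_mem hs ht) hs)

lemma z_zero : z 0 = 1 := by
  have h : MulAction.orbit weylGroup (0 : Weight) = {0} := by
    rw [orbit_eq]
    ext y
    simp [Prod.ext_iff]
  rw [z, h, finsum_mem_singleton, θ_zero]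

lemma z_x₁ : z x₁ = θ (1, 1) + θ (-1, -1) + θ (-1, 1) + θ (1, -1) := by
  have h : ({(x₁.1, x₁.2), (-x₁.1, x₁.2), (x₁.1, -x₁.2), (-x₁.1, -x₁.2),
      (x₁.2, x₁.1), (-x₁.2, x₁.1), (x₁.2, -x₁.1), (-x₁.2, -x₁.1)} : Set Weight) =
      (({(1, 1), (-1, -1), (-1, 1), (1, -1)} : Finset Weight) : Set Weight) := by
    ext y
    simp [x₁]
    tauto
  rw [z, orbit_eq, h, finsum_mem_coe_finset, Finset.sum_insert (by decide),
    Finset.sum_insert (by decide), Finset.sum_insert (by decide), Finset.sum_singleton]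
  abel

lemma z_x₂ : z x₂ = θ (0, 1) + θ (0, -1) + θ (1, 0) + θ (-1, 0) := by
  have h : ({(x₂.1, x₂.2), (-x₂.1, x₂.2), (x₂.1, -x₂.2), (-x₂.1, -x₂.2),
      (x₂.2, x₂.1), (-x₂.2, x₂.1), (x₂.2, -x₂.1), (-x₂.2, -x₂.1)} : Set Weight) =
      (({(0, 1), (0, -1), (1, 0), (-1, 0)} : Finset Weight) : Set Weight) := by
    ext y
    simp [x₂]
  rw [z, orbit_eq, h, finsum_mem_coe_finset, Finset.sum_insert (by decide),
    Finset.sum_insert (by decide), Finset.sum_insert (by decide), Finset.sum_singleton]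
  abel

lemma dominanceLE_iff {x y : Weight} : DominanceLE x y ↔
    ∃ k l : ℕ, y.1 - x.1 = 2 * k - l ∧ y.2 - x.2 = l := by
  simp only [DominanceLE, longRoot, shortRoot, Prod.ext_iff, Prod.fst_sub, Prod.snd_sub,
    Prod.fst_add, Prod.snd_add, Prod.smul_fst, Prod.smul_snd]
  simp only [nsmul_eq_mul]
  refine exists_congr fun k => exists_congr fun l => ?_
  constructor <;> rintro ⟨h1, h2⟩ <;> constructor <;> omega

lemma dominant_le_x₁ : {x' | x' ∈ dominantWeights ∧ DominanceLE x' x₁} =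
    (({x₁, 0} : Finset Weight) : Set Weight) := by
  ext y
  simp only [Set.mem_ofPred_eq, mem_dominantWeights, dominanceLE_iff, Finset.coe_insert,
    Finset.coe_singleton, Set.mem_insert_iff, Set.mem_singleton_iff, x₁, Prod.ext_iff]
  constructor
  · rintro ⟨h, k, l, h1, h2⟩
    simp only [Prod.fst_zero, Prod.snd_zero]
    omega
  · rintro (⟨h1, h2⟩ | ⟨h1, h2⟩)
    · exact ⟨by omega, 0, 0, by omega, by omega⟩
    · simp only [Prod.fst_zero, Prod.snd_zero] at h1 h2
      exact ⟨by omega, 1, 1, by omega, by omega⟩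

/-- The zero weight is excluded by parity, since `x₂` is not in the root lattice. -/
lemma dominant_le_x₂ : {x' | x' ∈ dominantWeights ∧ DominanceLE x' x₂} =
    (({x₂} : Finset Weight) : Set Weight) := by
  ext y
  simp only [Set.mem_ofPred_eq, mem_dominantWeights, dominanceLE_iff,
    Finset.coe_singleton, Set.mem_singleton_iff, x₂, Prod.ext_iff]
  constructor
  · rintro ⟨h, k, l, h1, h2⟩
    omega
  · rintro ⟨h1, h2⟩
    exact ⟨by omega, 0, 0, by omega, by omega⟩

theorem S_x₁ (h1 : weightMult x₁ x₁ = 1) (h0 : weightMult x₁ 0 = 1) : S x₁ =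
    θ (1, 1) + θ (-1, -1) + θ (-1, 1) + θ (1, -1) + 1 := by
  rw [S, dominant_le_x₁, finsum_mem_coe_finset, Finset.sum_insert (by decide),
    Finset.sum_singleton, h1, h0, z_x₁, z_zero]
  simp

theorem S_x₂ (h1 : weightMult x₂ x₂ = 1) : S x₂ =
    θ (0, 1) + θ (0, -1) + θ (1, 0) + θ (-1, 0) := by
  rw [S, dominant_le_x₂, finsum_mem_coe_finset, Finset.sum_singleton, h1, z_x₂]
  simp

/-! ### The two identities, given the weight multiplicities -/

section

attribute [local instance] heckeRing heckeMul heckeSub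

lemma CGen_mul_self (i : Fin 3) :
    CGen i * CGen i = (qHalfPow 1 + qHalfPow (-1)) • CGen i := by
  rw [CGen, smul_mul_assoc, mul_smul_comm, one_add_mul_self (T_mul_self' i), smul_smul, smul_smul,
    smul_smul]
  congr 1
  linear_combination (qHalfPow (-1) * qHalfPow 1) * qHalfPow_mul_neg

/-- By `one_add_mul_four`, `C_i C_j C_i C_j - 2 C_i C_j` is a multiple of the sum over the dihedral
group, and the braid relation makes this sum symmetric in `i` and `j`. -/
lemma CGen_braid {i j : Fin 3} (h : T (gen i) * T (gen j) * T (gen i) * T (gen j) =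
      T (gen j) * T (gen i) * T (gen j) * T (gen i)) :
    CGen i * CGen j * CGen i * CGen j = CGen j * CGen i * CGen j * CGen i -
      (2 : Coeff) • (CGen j * CGen i) + (2 : Coeff) • (CGen i * CGen j) := by
  have h1 := one_add_mul_four (T_mul_self' i) (T_mul_self' j)
  have h2 := one_add_mul_four (T_mul_self' j) (T_mul_self' i)
  rw [h] at h1
  simp only [CGen, smul_mul_assoc, mul_smul_comm, h1, h2, smul_smul]
  generalize T (gen j) * T (gen i) * T (gen j) * T (gen i) = X
  generalize hY : (1 + T (gen i)) * (1 + T (gen j)) = Y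
  generalize hZ : (1 + T (gen j)) * (1 + T (gen i)) = Z
  match_scalars
  any_goals ring1
  · linear_combination (2 * qHalfPow (-1) ^ 2 * (qHalfPow 1 * qHalfPow (-1) + 1)) * qHalfPow_mul_neg
  · linear_combination (-2 * qHalfPow (-1) ^ 2 * (qHalfPow 1 * qHalfPow (-1) + 1)) * qHalfPow_mul_neg

lemma T_braid_st : T (gen 2) * T (gen 1) * T (gen 2) * T (gen 1) =
    T (gen 1) * T (gen 2) * T (gen 1) * T (gen 2) := by
  have h1 : (wordFrame [2, 1, 2, 1]).sep = [2, 1, 2, 1].length := by decide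
  have h2 : (wordFrame [1, 2, 1, 2]).sep = [1, 2, 1, 2].length := by decide
  have e : word [2, 1, 2, 1] = word [1, 2, 1, 2] := by
    apply frame_injective
    rw [frame_word, frame_word]
    rfl
  have e1 := T_word h1
  rw [e, T_word h2] at e1
  simpa [mul_assoc] using e1.symm

lemma T_braid_sr : T (gen 0) * T (gen 1) * T (gen 0) * T (gen 1) =
    T (gen 1) * T (gen 0) * T (gen 1) * T (gen 0) := by
  have h1 : (wordFrame [0, 1, 0, 1]).sep = [0, 1, 0, 1].length := by decide
  have h2 : (wordFrame [1, 0, 1, 0]).sep = [1, 0, 1, 0].length := by decide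
  have e : word [0, 1, 0, 1] = word [1, 0, 1, 0] := by
    apply frame_injective
    rw [frame_word, frame_word]
    rfl
  have e1 := T_word h1
  rw [e, T_word h2] at e1
  simpa [mul_assoc] using e1.symm

theorem C_rt_mul_S_x₁ (h1 : weightMult x₁ x₁ = 1) (h0 : weightMult x₁ 0 = 1) :
    C (r * t) * S x₁ = C (r * s * t * s * t * r) + C (t * s * r * s * r * t) -
      two • C (r * t * s * r * t) + C (r * t) := by
  rw [C_rt, C_rststr, C_tsrsrt, C_rtsrt, S_x₁ h1 h0, show ((1, 1) : Weight) = x₁ from rfl,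
    show ((-1, -1) : Weight) = -x₁ from rfl, θ_of_dominant x₁_mem, θ_neg_of_dominant x₁_mem,
    inverse_weightT_x₁, weightT_x₁, θ_neg_one_one, θ_one_neg_one]
  have h := key_identity_one qHalfPow_mul_neg (CGen_mul_self 0) (CGen_mul_self 1)
    (CGen_mul_self 2) CGen_comm (CGen_braid T_braid_st) (CGen_braid T_braid_sr)
  simp only [← mul_assoc] at h ⊢
  exact h

theorem C_rt_mul_S_x₂ (h1 : weightMult x₂ x₂ = 1) :
    C (r * t) * S x₂ = (C (r * t * s * r * t) - two • C (r * t)) * C ω := by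
  rw [C_rt, C_rtsrt, C_ω, S_x₂ h1, show ((0, 1) : Weight) = x₂ from rfl,
    show ((0, -1) : Weight) = -x₂ from rfl, θ_of_dominant x₂_mem, θ_neg_of_dominant x₂_mem,
    inverse_weightT_x₂', weightT_x₂, θ_one_zero, θ_neg_one_zero]
  have h := congrArg (· * T ω) (key_identity_two (b := CGen 1) qHalfPow_mul_neg (CGen_mul_self 0)
    (CGen_mul_self 2) CGen_comm)
  simp only [add_mul, mul_assoc] at h ⊢
  exact h

end

/-! ### Functions on `Sp₄(ℂ)` which are determined by their value at the identity -/

open Matrix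

/-- The pairing of the weight of a basis vector of `ℂ⁴` with the cocharacter
`c ↦ torus c (c ^ 2)`. -/
def level : Fin 2 ⊕ Fin 2 → ℤ := Sum.elim ![1, 2] ![-1, -2]

/-- Unipotent matrices in the opposite of the standard Borel subgroup. -/
def IsLower (u : Sp) : Prop :=
  (∀ i, u.1 i i = 1) ∧ ∀ i j, i ≠ j → level j ≤ level i → u.1 i j = 0

/-- Unipotent matrices in the standard Borel subgroup. -/
def IsUpper (u : Sp) : Prop :=
  (∀ i, u.1 i i = 1) ∧ ∀ i j, i ≠ j → level i ≤ level j → u.1 i j = 0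

/-- A function on `Sp₄(ℂ)` is regular if it is given by a polynomial in the matrix entries. -/
def IsRegular (c : Sp → ℂ) : Prop :=
  ∃ p : MvPolynomial ((Fin 2 ⊕ Fin 2) × (Fin 2 ⊕ Fin 2)) ℂ,
    ∀ g : Sp, c g = MvPolynomial.eval (fun ij => g.1 ij.1 ij.2) p

/-- Regular functions on `Sp₄(ℂ)` which are invariant under the two maximal unipotent subgroups
and transform under the torus by the weight `x`. -/
structure IsHighestFunction (x : Weight) (c : Sp → ℂ) : Prop where
  regular : IsRegular c
  lower : ∀ u g, IsLower u → c (u * g) = c g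
  upper : ∀ u g, IsUpper u → c (g * u) = c g
  torus : ∀ a b g, c (torus a b * g) = ((a ^ x.1 * b ^ x.2 : ℂˣ) : ℂ) * c g

/-- The unipotent radical of the opposite of the stabiliser of the line of weight `x₂`. -/
def heis (p q z : ℂ) : Sp :=
  ⟨fromBlocks !![1, p; 0, 1] 0 !![0, q; q, z] !![1, 0; -p, 1], by
    rw [SymplecticGroup.mem_iff, J, fromBlocks_transpose, fromBlocks_multiply, fromBlocks_multiply,
      fromBlocks_inj]
    refine ⟨?_, ?_, ?_, ?_⟩ <;> ext i j <;> fin_cases i <;> fin_cases j <;>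
      (simp [Matrix.vecMul, dotProduct, Fin.sum_univ_two]; try ring)⟩

/-- The negative root subgroup of the long simple root. -/
def lowSL (s : ℂ) : Sp :=
  ⟨fromBlocks 1 0 !![s, 0; 0, 0] 1, by
    rw [SymplecticGroup.mem_iff, J, fromBlocks_transpose, fromBlocks_multiply, fromBlocks_multiply,
      fromBlocks_inj]
    refine ⟨?_, ?_, ?_, ?_⟩ <;> ext i j <;> fin_cases i <;> fin_cases j <;> simp⟩

/-- The transpose of a symplectic matrix. -/
def spTranspose (g : Sp) : Sp := ⟨g.1ᵀ, SymplecticGroup.transpose_mem g.2⟩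

lemma isLower_heis (p q z : ℂ) : IsLower (heis p q z) := by
  constructor
  · rintro (i | i) <;> fin_cases i <;> simp [heis]
  · rintro (i | i) (j | j) <;> fin_cases i <;> fin_cases j <;> simp [heis, level]

lemma isLower_lowSL (s : ℂ) : IsLower (lowSL s) := by
  constructor
  · rintro (i | i) <;> fin_cases i <;> simp [lowSL]
  · rintro (i | i) (j | j) <;> fin_cases i <;> fin_cases j <;> simp [lowSL, level]

lemma IsLower.transpose {u : Sp} (h : IsLower u) : IsUpper (spTranspose u) :=
  ⟨h.1, fun i j hij hl => h.2 j i hij.symm hl⟩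

/-- A regular function which vanishes on a punctured line in `Sp₄(ℂ)` vanishes on the line. -/
lemma IsRegular.eq_zero_of_line {c : Sp → ℂ} (hc : IsRegular c) {γ : ℂ → Sp}
    {A B : Matrix (Fin 2 ⊕ Fin 2) (Fin 2 ⊕ Fin 2) ℂ} (hγ : ∀ s, (γ s).1 = A + s • B)
    (h : ∀ s, s ≠ 0 → c (γ s) = 0) (s : ℂ) : c (γ s) = 0 := by
  obtain ⟨p, hp⟩ := hc
  let P : Polynomial ℂ := MvPolynomial.aeval (fun ij : (Fin 2 ⊕ Fin 2) × (Fin 2 ⊕ Fin 2) =>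
    Polynomial.C (A ij.1 ij.2) + Polynomial.X * Polynomial.C (B ij.1 ij.2)) p
  have hP : ∀ s, P.eval s = c (γ s) := by
    intro s
    rw [hp, ← Polynomial.coe_aeval_eq_eval, MvPolynomial.comp_aeval_apply,
      MvPolynomial.aeval_eq_eval]
    congr 2
    funext ij
    simp [hγ]
    ring
  have h0 : P = 0 := by
    -- Along the line the function is a polynomial in `s` vanishing at every nonzero `s`, hence
    -- identically. This elementary argument takes the place of Zariski density.
    refine Polynomial.eq_zero_of_infinite_isRoot P (Set.Infinite.mono (s := {0}ᶜ) ?_ ?_)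
    · intro s hs
      exact (hP s).trans (h s hs)
    · exact (Set.finite_singleton 0).infinite_compl
  rw [← hP, h0, Polynomial.eval_zero]

lemma sp_left (g : Sp) (i j : Fin 2 ⊕ Fin 2) :
    g.1 (Sum.inr 0) i * g.1 (Sum.inl 0) j + g.1 (Sum.inr 1) i * g.1 (Sum.inl 1) j -
      g.1 (Sum.inl 0) i * g.1 (Sum.inr 0) j - g.1 (Sum.inl 1) i * g.1 (Sum.inr 1) j =
      J (Fin 2) ℂ i j := by
  rw [← SymplecticGroup.mem_iff'.1 g.2]
  simp [Matrix.mul_apply, Fintype.sum_sum_type, Fin.sum_univ_two, J, Matrix.one_apply]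
  ring

lemma sp_right (g : Sp) (i j : Fin 2 ⊕ Fin 2) :
    g.1 i (Sum.inr 0) * g.1 j (Sum.inl 0) + g.1 i (Sum.inr 1) * g.1 j (Sum.inl 1) -
      g.1 i (Sum.inl 0) * g.1 j (Sum.inr 0) - g.1 i (Sum.inl 1) * g.1 j (Sum.inr 1) =
      J (Fin 2) ℂ i j :=
  sp_left (spTranspose g) i j

/-- The matrices preserving the decomposition of `ℂ⁴` into the planes spanned by the basis vectors
of weights `±x₂` and by those of weights `±(1, 0)`, and diagonal on the first plane. -/
structure IsBlock (g : Sp) : Prop where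
  row : ∀ j, j ≠ Sum.inl 1 → g.1 (Sum.inl 1) j = 0
  col : ∀ i, i ≠ Sum.inl 1 → g.1 i (Sum.inl 1) = 0
  row' : ∀ j, j ≠ Sum.inr 1 → g.1 (Sum.inr 1) j = 0
  col' : ∀ i, i ≠ Sum.inr 1 → g.1 i (Sum.inr 1) = 0
  corner : g.1 (Sum.inl 1) (Sum.inl 1) * g.1 (Sum.inr 1) (Sum.inr 1) = 1
  det : g.1 (Sum.inl 0) (Sum.inl 0) * g.1 (Sum.inr 0) (Sum.inr 0) -
    g.1 (Sum.inl 0) (Sum.inr 0) * g.1 (Sum.inr 0) (Sum.inl 0) = 1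

/-- Pairing the cleared row and column with the others through the symplectic form forces the row
and column of the dual vector `inr 1` to vanish off the diagonal as well; the two normalisations
come from the same relations. -/
lemma isBlock_of_row_col {g : Sp} (h0 : g.1 (Sum.inl 1) (Sum.inl 1) ≠ 0)
    (row : ∀ j, j ≠ Sum.inl 1 → g.1 (Sum.inl 1) j = 0)
    (col : ∀ i, i ≠ Sum.inl 1 → g.1 i (Sum.inl 1) = 0) : IsBlock g := by
  have c1 := col (Sum.inl 0) (by decide)
  have c2 := col (Sum.inr 0) (by decide)
  have c3 := col (Sum.inr 1) (by decide)
  have r1 := row (Sum.inl 0) (by decide)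
  have r2 := row (Sum.inr 0) (by decide)
  have r3 := row (Sum.inr 1) (by decide)
  have col' : ∀ i, i ≠ Sum.inr 1 → g.1 i (Sum.inr 1) = 0 := by
    intro i hi
    have h := sp_right g (Sum.inl 1) i
    rw [r1, r2, r3] at h
    have hJ : J (Fin 2) ℂ (Sum.inl 1) i = 0 := by
      rcases i with i | i <;> fin_cases i <;> simp_all [J]
    rw [hJ] at h
    simpa [h0] using h
  have row' : ∀ j, j ≠ Sum.inr 1 → g.1 (Sum.inr 1) j = 0 := by
    intro j hj
    have h := sp_left g (Sum.inl 1) j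
    rw [c1, c2, c3] at h
    have hJ : J (Fin 2) ℂ (Sum.inl 1) j = 0 := by
      rcases j with j | j <;> fin_cases j <;> simp_all [J]
    rw [hJ] at h
    simpa [h0] using h
  refine ⟨row, col, row', col', ?_, ?_⟩
  · have h := sp_left g (Sum.inl 1) (Sum.inr 1)
    rw [c1, c2, c3] at h
    simp [J] at h
    exact h
  · have h := sp_left g (Sum.inl 0) (Sum.inr 0)
    rw [row' (Sum.inl 0) (by decide), r1] at h
    simp [J] at h
    linear_combination -h

/-- The factorisation of a block matrix into lower unipotent, diagonal and upper unipotent parts. -/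
lemma IsBlock.eq_mul {g : Sp} (hg : IsBlock g) (a b : ℂˣ)
    (ha : g.1 (Sum.inl 0) (Sum.inl 0) = a) (hb : g.1 (Sum.inl 1) (Sum.inl 1) = b) :
    g = lowSL (g.1 (Sum.inr 0) (Sum.inl 0) / a) * (torus a b *
      spTranspose (lowSL (g.1 (Sum.inl 0) (Sum.inr 0) / a))) := by
  have hd := hg.det
  have hc := hg.corner
  rw [ha] at hd
  rw [hb] at hc
  have ha0 : (a : ℂ) ≠ 0 := a.ne_zero
  have hb0 : (b : ℂ) ≠ 0 := b.ne_zero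
  have e1 : g.1 (Sum.inr 1) (Sum.inr 1) = (b : ℂ)⁻¹ := eq_inv_of_mul_eq_one_right hc
  have e2 : g.1 (Sum.inr 0) (Sum.inr 0) =
      (1 + g.1 (Sum.inl 0) (Sum.inr 0) * g.1 (Sum.inr 0) (Sum.inl 0)) / a := by
    field_simp
    linear_combination hd
  apply Subtype.ext
  change g.1 = (lowSL _).1 * ((torus a b).1 * (lowSL _).1ᵀ)
  ext i j
  have hr := hg.row
  have hcl := hg.col
  have hr' := hg.row'
  have hcl' := hg.col'
  rcases i with i | i <;> rcases j with j | j <;> fin_cases i <;> fin_cases j <;>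
    simp [lowSL, torus, Matrix.mul_apply, Fintype.sum_sum_type, Fin.sum_univ_two, ha, hb, hr, hcl,
      hr', hcl', e1, e2, Matrix.diagonal_apply, Matrix.one_apply] <;>
    field_simp
  ring

/-- On the big cell, lower unipotent times torus times upper unipotent, the function is a multiple
of its value at `1`. The big cell is reached by Gaussian elimination with two pivots, the entry at
`inl 1` and then the entry at `inl 0`; where a pivot vanishes, a line leaving that locus is used. -/
theorem IsHighestFunction.eq_zero {x : Weight} {c : Sp → ℂ} (hc : IsHighestFunction x c)
    (h1 : c 1 = 0) (g : Sp) : c g = 0 := by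
  have block₁ : ∀ g, IsBlock g → g.1 (Sum.inl 0) (Sum.inl 0) ≠ 0 → c g = 0 := by
    intro g hg h0
    have hb0 : g.1 (Sum.inl 1) (Sum.inl 1) ≠ 0 := left_ne_zero_of_mul_eq_one hg.corner
    rw [hg.eq_mul (Units.mk0 _ h0) (Units.mk0 _ hb0) rfl rfl, hc.lower _ _ (isLower_lowSL _),
      hc.torus, ← one_mul (spTranspose _), hc.upper _ _ (isLower_lowSL _).transpose, h1, mul_zero]
  have block₂ : ∀ g, IsBlock g → c g = 0 := by
    intro g hg
    by_cases h0 : g.1 (Sum.inl 0) (Sum.inl 0) = 0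
    -- Moving along `lowSL s` turns the vanishing pivot into `s` times its neighbour, which is
    -- nonzero because the two-by-two block has determinant `1`.
    · have hγ : ∀ s, (g * lowSL s).1 = g.1 + s • (g.1 * fromBlocks 0 0 !![1, 0; 0, 0] 0) := by
        intro s
        have e : (lowSL s).1 = 1 + s • fromBlocks 0 0 !![1, 0; 0, 0] 0 := by
          simp only [lowSL, ← fromBlocks_one, fromBlocks_smul, fromBlocks_add]
          simp
        change g.1 * (lowSL s).1 = _
        rw [e, Matrix.mul_add, Matrix.mul_one, Matrix.mul_smul]
      have h := hc.regular.eq_zero_of_line hγ (fun s hs => ?_) 0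
      · have e : lowSL 0 = 1 := by
          apply Subtype.ext
          change fromBlocks 1 0 !![(0 : ℂ), 0; 0, 0] 1 = 1
          rw [← fromBlocks_one]
          congr 1
          ext i j
          fin_cases i <;> fin_cases j <;> rfl
        rwa [e, mul_one] at h
      · have hent : ∀ i j, (g * lowSL s).1 i j = g.1 i j +
            s * (if j = Sum.inl 0 then g.1 i (Sum.inr 0) else 0) := by
          intro i j
          rw [hγ]
          rcases j with j | j <;> fin_cases j <;>
            simp [Matrix.mul_apply, Fintype.sum_sum_type, Fin.sum_univ_two]
        refine block₁ _ (isBlock_of_row_col ?_ ?_ ?_) ?_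
        · rw [hent]
          simpa using left_ne_zero_of_mul_eq_one hg.corner
        · intro j hj
          rw [hent, hg.row j hj, hg.row (Sum.inr 0) (by decide)]
          simp
        · intro i hi
          rw [hent, hg.col i hi]
          simp
        · rw [hent, h0]
          have := hg.det
          rw [h0] at this
          simp only [if_true, zero_add]
          refine mul_ne_zero hs fun h => ?_
          rw [h] at this
          simp at this
    · exact block₁ g hg h0
  have corner : ∀ g, g.1 (Sum.inl 1) (Sum.inl 1) ≠ 0 → c g = 0 := by
    have col : ∀ g : Sp, g.1 (Sum.inl 1) (Sum.inl 1) ≠ 0 →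
        (∀ i, i ≠ Sum.inl 1 → g.1 i (Sum.inl 1) = 0) → c g = 0 := by
      intro g h0 hcol
      -- The parameters are chosen so that right multiplication by the transpose clears the rest of
      -- the row `inl 1`; the column, already cleared, stays so.
      let h := heis (-(g.1 (Sum.inl 1) (Sum.inl 0) / g.1 (Sum.inl 1) (Sum.inl 1)))
        (-(g.1 (Sum.inl 1) (Sum.inr 0) / g.1 (Sum.inl 1) (Sum.inl 1)))
        (-(g.1 (Sum.inl 1) (Sum.inr 1) / g.1 (Sum.inl 1) (Sum.inl 1)))
      rw [← hc.upper (spTranspose h) g (isLower_heis _ _ _).transpose]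
      have hent : ∀ i j, (g * spTranspose h).1 i j = ∑ k, g.1 i k * h.1 j k := fun i j => rfl
      refine block₂ _ (isBlock_of_row_col ?_ ?_ ?_)
      · rw [hent]
        simpa [h, heis, Fintype.sum_sum_type, Fin.sum_univ_two] using h0
      · intro j hj
        rw [hent]
        rcases j with j | j <;> fin_cases j <;>
          simp [h, heis, Fintype.sum_sum_type, Fin.sum_univ_two] at hj ⊢ <;> field_simp <;> ring_nf
      · intro i hi
        rw [hent]
        simp [h, heis, Fintype.sum_sum_type, Fin.sum_univ_two, hcol i hi]
    intro g h0
    let h := heis (-(g.1 (Sum.inl 0) (Sum.inl 1) / g.1 (Sum.inl 1) (Sum.inl 1)))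
      (-(g.1 (Sum.inr 0) (Sum.inl 1) / g.1 (Sum.inl 1) (Sum.inl 1)))
      (-(g.1 (Sum.inr 1) (Sum.inl 1) / g.1 (Sum.inl 1) (Sum.inl 1)))
    rw [← hc.lower h g (isLower_heis _ _ _)]
    have hent : ∀ i j, (h * g).1 i j = ∑ k, h.1 i k * g.1 k j := fun i j => rfl
    refine col _ ?_ ?_
    · rw [hent]
      simpa [h, heis, Fintype.sum_sum_type, Fin.sum_univ_two] using h0
    · intro i hi
      rw [hent]
      rcases i with i | i <;> fin_cases i <;>
        simp [h, heis, Fintype.sum_sum_type, Fin.sum_univ_two] at hi ⊢ <;> field_simp <;> ring_nf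
  by_cases h0 : g.1 (Sum.inl 1) (Sum.inl 1) = 0
  -- The row `inl 1` cannot vanish, as it pairs to a nonzero value with the row `inr 1`. Since
  -- `heis` is affine in its parameters, `s ↦ g * heis (s p) (s q) (s z)` is a line, along which the
  -- pivot is `s` times the displayed nonzero sum.
  · obtain ⟨p, q, z, hpqz⟩ : ∃ p q z : ℂ, g.1 (Sum.inl 1) (Sum.inl 0) * p +
        g.1 (Sum.inl 1) (Sum.inr 0) * q + g.1 (Sum.inl 1) (Sum.inr 1) * z ≠ 0 := by
      by_contra! h
      have e1 := h 1 0 0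
      have e2 := h 0 1 0
      have e3 := h 0 0 1
      simp at e1 e2 e3
      have := sp_right g (Sum.inl 1) (Sum.inr 1)
      simp [h0, e1, e2, e3, J] at this
    have hγ : ∀ s, (g * heis (s * p) (s * q) (s * z)).1 = g.1 +
        s • (g.1 * fromBlocks !![0, p; 0, 0] 0 !![0, q; q, z] !![0, 0; -p, 0]) := by
      intro s
      have e : (heis (s * p) (s * q) (s * z)).1 =
          1 + s • fromBlocks !![0, p; 0, 0] 0 !![0, q; q, z] !![0, 0; -p, 0] := by
        simp only [heis, ← fromBlocks_one, fromBlocks_smul, fromBlocks_add]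
        congr 1 <;> ext i j <;> fin_cases i <;> fin_cases j <;> simp
      change g.1 * (heis (s * p) (s * q) (s * z)).1 = _
      rw [e, Matrix.mul_add, Matrix.mul_one, Matrix.mul_smul]
    have h := hc.regular.eq_zero_of_line hγ (fun s hs => corner _ ?_) 0
    · have e : heis (0 * p) (0 * q) (0 * z) = 1 := by
        apply Subtype.ext
        simp only [heis, zero_mul]
        change fromBlocks _ _ _ _ = (1 : Matrix (Fin 2 ⊕ Fin 2) (Fin 2 ⊕ Fin 2) ℂ)
        rw [← fromBlocks_one]
        congr 1 <;> ext i j <;> fin_cases i <;> fin_cases j <;> simp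
      rwa [e, mul_one] at h
    · rw [hγ]
      simp [Matrix.mul_apply, Fintype.sum_sum_type, Fin.sum_univ_two, h0, hs]
      intro h
      apply hpqz
      linear_combination h
  · exact corner g h0

/-! ### Weight decomposition of rational representations -/

/-- The character of the torus given by a weight. -/
def weightChar (y : Weight) : ℂˣ × ℂˣ →* ℂ where
  toFun p := ((p.1 ^ y.1 * p.2 ^ y.2 : ℂˣ) : ℂ)
  map_one' := by simp
  map_mul' p p' := by simp [mul_zpow]; ring

lemma weightChar_apply (y : Weight) (p : ℂˣ × ℂˣ) :
    weightChar y p = (p.1 : ℂ) ^ y.1 * (p.2 : ℂ) ^ y.2 := by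
  simp [weightChar]

lemma weightChar_add (y y' : Weight) (p : ℂˣ × ℂˣ) :
    weightChar (y + y') p = weightChar y p * weightChar y' p := by
  simp only [weightChar_apply, Prod.fst_add, Prod.snd_add, zpow_add₀ (Units.ne_zero _)]
  ring

lemma weightChar_injective : Function.Injective weightChar := by
  intro y y' h
  have key : ∀ m n : ℤ, (2 : ℂ) ^ m = 2 ^ n → m = n := by
    intro m n hmn
    have : (2 : ℝ) ^ m = 2 ^ n := by simpa using congrArg norm hmn
    exact zpow_right_injective₀ (by norm_num) (by norm_num) this
  -- At the points `(2, 1)` and `(1, 2)` a character takes the values `2 ^ m` and `2 ^ n`, which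
  -- determine the weight.
  have h1 := DFunLike.congr_fun h (Units.mk0 2 two_ne_zero, 1)
  have h2 := DFunLike.congr_fun h (1, Units.mk0 2 two_ne_zero)
  simp only [weightChar_apply] at h1 h2
  simp at h1 h2
  exact Prod.ext (key _ _ h1) (key _ _ h2)

lemma linearIndependent_weightChar :
    LinearIndependent ℂ fun y : Weight => (weightChar y : ℂˣ × ℂˣ → ℂ) :=
  (linearIndependent_monoidHom (ℂˣ × ℂˣ) ℂ).comp weightChar weightChar_injective

variable {V : Type*} [AddCommGroup V] [Module ℂ V]

/-- Distinct characters are linearly independent; linear functionals transfer this to vector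
coefficients. It makes weight expansions unique, hence linear and equivariant. -/
lemma eq_zero_of_sum_weightChar {w : Weight →₀ V}
    (h : ∀ p, (w.sum fun y u => weightChar y p • u) = 0) : w = 0 := by
  ext y
  rw [Finsupp.zero_apply, ← Module.forall_dual_apply_eq_zero_iff ℂ]
  intro φ
  have h0 : w.mapRange φ (map_zero φ) = 0 := by
    refine linearIndependent_iff.1 linearIndependent_weightChar _ ?_
    funext p
    rw [Finsupp.linearCombination_apply, Finsupp.sum_mapRange_index (by simp)]
    simp only [Finsupp.sum, Finset.sum_apply, Pi.smul_apply, Pi.zero_apply]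
    have := congrArg φ (h p)
    simp only [Finsupp.sum, map_sum, map_zero, map_smul] at this
    rw [← this]
    exact Finset.sum_congr rfl fun y _ => by simp [mul_comm]
  simpa using DFunLike.congr_fun h0 y

/-- The weight of a basis vector of `ℂ⁴`. -/
def stdWeight : Fin 2 ⊕ Fin 2 → Weight := Sum.elim ![(1, 0), (0, 1)] ![(-1, 0), (0, -1)]

lemma torus_apply (p : ℂˣ × ℂˣ) (i j : Fin 2 ⊕ Fin 2) :
    (torus p.1 p.2).1 i j = if i = j then weightChar (stdWeight i) p else 0 := by
  refine (Matrix.diagonal_apply _ _ _).trans ?_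
  congr 1
  rcases i with i | i <;> fin_cases i <;> simp [weightChar_apply, stdWeight]

/-- The restriction to the torus of a regular function is a combination of characters. -/
lemma exists_eval_torus (P : MvPolynomial ((Fin 2 ⊕ Fin 2) × (Fin 2 ⊕ Fin 2)) ℂ) :
    ∃ w : Weight →₀ ℂ, ∀ p : ℂˣ × ℂˣ,
      MvPolynomial.eval (fun ij => (torus p.1 p.2).1 ij.1 ij.2) P =
        w.sum fun y u => weightChar y p * u := by
  induction P using MvPolynomial.induction_on with
  | C a => exact ⟨Finsupp.single 0 a, fun p => by
      rw [Finsupp.sum_single_index (by simp)]; simp [weightChar_apply]⟩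
  | add P Q hP hQ =>
    obtain ⟨w, hw⟩ := hP
    obtain ⟨w', hw'⟩ := hQ
    refine ⟨w + w', fun p => ?_⟩
    rw [map_add, hw, hw', Finsupp.sum_add_index' (by simp) (by simp [mul_add])]
  | mul_X P ij hP =>
    obtain ⟨w, hw⟩ := hP
    by_cases hij : ij.1 = ij.2
    · refine ⟨w.mapDomain (· + stdWeight ij.1), fun p => ?_⟩
      rw [map_mul, hw, MvPolynomial.eval_X, torus_apply, if_pos hij,
        Finsupp.sum_mapDomain_index (by simp) (by simp [mul_add]), Finsupp.sum_mul]
      refine Finset.sum_congr rfl fun y _ => ?_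
      simp only [weightChar_add]
      ring
    · refine ⟨0, fun p => ?_⟩
      rw [map_mul, MvPolynomial.eval_X, torus_apply, if_neg hij]
      simp

lemma exists_weight_expansion [FiniteDimensional ℂ V] {ρ : Representation ℂ Sp V}
    (hρ : IsRational ρ) (v : V) :
    ∃ w : Weight →₀ V, ∀ p : ℂˣ × ℂˣ,
      ρ (torus p.1 p.2) v = w.sum fun y u => weightChar y p • u := by
  let b := Module.finBasis ℂ V
  have h : ∀ i, ∃ w : Weight →₀ ℂ, ∀ p : ℂˣ × ℂˣ,
      b.coord i (ρ (torus p.1 p.2) v) = w.sum fun y u => weightChar y p * u := by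
    intro i
    obtain ⟨P, hP⟩ := hρ (b.coord i) v
    obtain ⟨w, hw⟩ := exists_eval_torus P
    exact ⟨w, fun p => (hP _).trans (hw p)⟩
  choose w hw using h
  refine ⟨∑ i, (w i).mapRange (fun a => a • b i) (zero_smul _ _), fun p => ?_⟩
  rw [← Finsupp.sum_finsetSum_index (by simp) (by simp), ← b.sum_repr (ρ (torus p.1 p.2) v)]
  refine Finset.sum_congr rfl fun i _ => ?_
  rw [Finsupp.sum_mapRange_index (by simp)]
  have := hw i p
  rw [Module.Basis.coord_apply] at this
  rw [this, Finsupp.sum, Finsupp.sum, Finset.sum_smul]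
  exact Finset.sum_congr rfl fun y _ => by rw [mul_smul]

lemma torus_mul (p p' : ℂˣ × ℂˣ) :
    torus (p * p').1 (p * p').2 = torus p.1 p.2 * torus p'.1 p'.2 := by
  apply Subtype.ext
  change _ = (torus p.1 p.2).1 * (torus p'.1 p'.2).1
  simp only [torus, Matrix.diagonal_mul_diagonal]
  congr 1
  funext i
  rcases i with i | i <;> fin_cases i <;> simp [mul_comm]

lemma torus_one : torus 1 1 = 1 := by
  apply Subtype.ext
  change (torus 1 1).1 = (1 : Matrix (Fin 2 ⊕ Fin 2) (Fin 2 ⊕ Fin 2) ℂ)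
  rw [← Matrix.diagonal_one]
  simp only [torus]
  congr 1
  funext i
  rcases i with i | i <;> fin_cases i <;> simp

lemma mem_weightSpace {ρ : Representation ℂ Sp V} {y : Weight} {v : V} :
    v ∈ weightSpace ρ y ↔ ∀ p : ℂˣ × ℂˣ, ρ (torus p.1 p.2) v = weightChar y p • v := by
  simp only [weightSpace, Submodule.mem_iInf, Module.End.mem_eigenspace_iff]
  exact ⟨fun h p => h p.1 p.2, fun h a b => h (a, b)⟩

section

variable [FiniteDimensional ℂ V] {ρ : Representation ℂ Sp V} (hρ : IsRational ρ)

/-- The weight components of a vector. -/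
def weightComponents : V →ₗ[ℂ] Weight →₀ V where
  toFun v := (exists_weight_expansion hρ v).choose
  map_add' v v' := by
    rw [← sub_eq_zero]
    refine eq_zero_of_sum_weightChar fun p => ?_
    rw [Finsupp.sum_sub_index (by simp [smul_sub]), Finsupp.sum_add_index' (by simp) (by simp),
      ← (exists_weight_expansion hρ _).choose_spec, ← (exists_weight_expansion hρ _).choose_spec,
      ← (exists_weight_expansion hρ _).choose_spec, map_add, sub_self]
  map_smul' a v := by
    rw [← sub_eq_zero]
    refine eq_zero_of_sum_weightChar fun p => ?_
    rw [Finsupp.sum_sub_index (by simp [smul_sub]), RingHom.id_apply,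
      Finsupp.sum_smul_index' (by simp), ← (exists_weight_expansion hρ _).choose_spec]
    simp only [smul_comm _ a]
    rw [← Finsupp.smul_sum,
      ← (exists_weight_expansion hρ _).choose_spec, map_smul, sub_self]

lemma torus_apply_eq_sum (v : V) (p : ℂˣ × ℂˣ) :
    ρ (torus p.1 p.2) v = (weightComponents hρ v).sum fun y u => weightChar y p • u :=
  (exists_weight_expansion hρ v).choose_spec p

lemma weightComponents_eq {v : V} {w : Weight →₀ V}
    (h : ∀ p : ℂˣ × ℂˣ, ρ (torus p.1 p.2) v = w.sum fun y u => weightChar y p • u) :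
    weightComponents hρ v = w := by
  rw [← sub_eq_zero]
  refine eq_zero_of_sum_weightChar fun p => ?_
  rw [Finsupp.sum_sub_index (by simp [smul_sub]), ← torus_apply_eq_sum, h, sub_self]

lemma sum_weightComponents (v : V) : ((weightComponents hρ v).sum fun _ u => u) = v := by
  have := torus_apply_eq_sum hρ v 1
  simp only [map_one, one_smul] at this
  rw [← this]
  change ρ (torus 1 1) v = v
  rw [torus_one, map_one, Module.End.one_apply]

lemma weightComponents_torus (v : V) (p : ℂˣ × ℂˣ) (y : Weight) :
    weightComponents hρ (ρ (torus p.1 p.2) v) y = weightChar y p • weightComponents hρ v y := by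
  have : weightComponents hρ (ρ (torus p.1 p.2) v) =
      Finsupp.onFinset (weightComponents hρ v).support
        (fun y => weightChar y p • weightComponents hρ v y)
        (fun y hy => by
          rw [Finsupp.mem_support_iff]
          exact fun h => hy (by rw [h, smul_zero])) := by
    refine weightComponents_eq hρ fun p' => ?_
    rw [← Module.End.mul_apply, ← map_mul, ← torus_mul, torus_apply_eq_sum,
      Finsupp.onFinset_sum _ (by simp), Finsupp.sum]
    exact Finset.sum_congr rfl fun y _ => by rw [map_mul, mul_smul]
  rw [this, Finsupp.onFinset_apply]

lemma weightComponents_of_mem {y : Weight} {v : V} (hv : v ∈ weightSpace ρ y) :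
    weightComponents hρ v = Finsupp.single y v := by
  refine weightComponents_eq hρ fun p => ?_
  rw [mem_weightSpace.1 hv, Finsupp.sum_single_index (by simp)]

lemma weightComponents_mem_weightSpace (v : V) (y : Weight) :
    weightComponents hρ v y ∈ weightSpace ρ y := by
  rw [mem_weightSpace]
  intro p
  have key : (weightComponents hρ v).mapRange (ρ (torus p.1 p.2)) (map_zero _) =
      weightComponents hρ (ρ (torus p.1 p.2) v) := by
    symm
    refine weightComponents_eq hρ fun p' => ?_
    rw [Finsupp.sum_mapRange_index (by simp), ← Module.End.mul_apply, ← map_mul, ← torus_mul,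
      mul_comm, torus_mul, map_mul, Module.End.mul_apply, torus_apply_eq_sum hρ v p', Finsupp.sum,
      map_sum]
    exact Finset.sum_congr rfl fun y _ => map_smul _ _ _
  rw [← weightComponents_torus, ← key, Finsupp.mapRange_apply]

/-- Modulo `N` the expansion of `ρ (torus p) v` is zero for every `p`, so by independence of
characters each component is zero modulo `N`. -/
lemma weightComponents_mem {N : Submodule ℂ V} (hN : ∀ g, ∀ v ∈ N, ρ g v ∈ N) {v : V}
    (hv : v ∈ N) (y : Weight) : weightComponents hρ v y ∈ N := by
  have : (weightComponents hρ v).mapRange N.mkQ (map_zero _) = 0 := by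
    refine eq_zero_of_sum_weightChar fun p => ?_
    rw [Finsupp.sum_mapRange_index (by simp)]
    have h : N.mkQ (ρ (torus p.1 p.2) v) = 0 := by simpa using hN _ v hv
    rw [torus_apply_eq_sum hρ, Finsupp.sum, map_sum] at h
    rw [← h]
    exact Finset.sum_congr rfl fun y _ => (map_smul _ _ _).symm
  simpa using DFunLike.congr_fun this y

end

/-! ### Uniqueness of the irreducible representation of a given highest weight -/

/-- The pairing of a weight with the cocharacter `c ↦ torus c (c ^ 2)`. -/
def height (y : Weight) : ℤ := y.1 + 2 * y.2

lemma DominanceLE.height_le {y x : Weight} (h : DominanceLE y x) : height y ≤ height x := by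
  obtain ⟨k, l, h1, h2⟩ := dominanceLE_iff.1 h
  simp only [height]
  omega

lemma height_stdWeight (i : Fin 2 ⊕ Fin 2) : height (stdWeight i) = level i := by
  rcases i with i | i <;> fin_cases i <;> rfl

/-- The point of the torus with coordinates `(c ^ m, c ^ (2 * m))`. -/
def cocharacter (m : ℤ) (c : ℂˣ) : ℂˣ × ℂˣ := (c ^ m, c ^ (2 * m))

lemma weightChar_cocharacter (y : Weight) (m : ℤ) (c : ℂˣ) :
    weightChar y (cocharacter m c) = (c : ℂ) ^ (m * height y) := by
  rw [weightChar_apply, cocharacter, height, Units.val_zpow_eq_zpow_val,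
    Units.val_zpow_eq_zpow_val, ← _root_.zpow_mul, ← _root_.zpow_mul, ← zpow_add₀ c.ne_zero]
  congr 1
  ring

lemma torus_mul_mul_torus_apply (p p' : ℂˣ × ℂˣ) (u : Sp) (i j : Fin 2 ⊕ Fin 2) :
    (torus p.1 p.2 * u * torus p'.1 p'.2).1 i j =
      weightChar (stdWeight i) p * u.1 i j * weightChar (stdWeight j) p' := by
  change ((torus p.1 p.2).1 * u.1 * (torus p'.1 p'.2).1) i j = _
  simp only [Matrix.mul_apply, torus_apply]
  simp

section

variable {V : Type*} [AddCommGroup V] [Module ℂ V] {ρ : Representation ℂ Sp V}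

/-- Conjugation by the cocharacter multiplies the entry `(i, j)` by `c ^ (m (level j - level i))`.
Under the hypothesis on `u`, the conjugate is polynomial in `c` and tends to the identity as `c`
tends to `0`. -/
lemma exists_polynomial_conj (hρ : IsRational ρ) {m : ℤ} {u : Sp} (hd : ∀ i, u.1 i i = 1)
    (hu : ∀ i j, i ≠ j → u.1 i j ≠ 0 → 0 < m * (level j - level i)) (φ : Module.Dual ℂ V) (w : V) :
    ∃ P : Polynomial ℂ, P.eval 0 = φ w ∧ ∀ c : ℂˣ, P.eval (c : ℂ) =
      φ (ρ (torus (cocharacter (-m) c).1 (cocharacter (-m) c).2 * u *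
        torus (cocharacter m c).1 (cocharacter m c).2) w) := by
  obtain ⟨p, hp⟩ := hρ φ w
  -- The truncation `toNat` is harmless: the exponent is `0` on the diagonal, positive at the
  -- nonzero entries off it, and irrelevant where the entry of `u` vanishes.
  refine ⟨MvPolynomial.aeval (fun ij : (Fin 2 ⊕ Fin 2) × (Fin 2 ⊕ Fin 2) =>
    Polynomial.X ^ (m * (level ij.2 - level ij.1)).toNat * Polynomial.C (u.1 ij.1 ij.2)) p,
    ?_, fun c => ?_⟩
  · have h := hp 1
    rw [map_one, Module.End.one_apply] at h
    rw [h, ← Polynomial.coe_aeval_eq_eval, MvPolynomial.comp_aeval_apply,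
      MvPolynomial.aeval_eq_eval]
    congr 2
    funext ij
    rcases eq_or_ne ij.1 ij.2 with hij | hij
    · simp [hij, hd]
    · rw [show (1 : Sp).1 = 1 from rfl, Matrix.one_apply_ne hij]
      by_cases h0 : u.1 ij.1 ij.2 = 0
      · simp [h0]
      · have := hu _ _ hij h0
        simp [Int.toNat_eq_zero, this]
  · rw [hp, ← Polynomial.coe_aeval_eq_eval, MvPolynomial.comp_aeval_apply,
      MvPolynomial.aeval_eq_eval]
    congr 2
    funext ij
    rw [torus_mul_mul_torus_apply, weightChar_cocharacter, weightChar_cocharacter,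
      height_stdWeight, height_stdWeight]
    have key : u.1 ij.1 ij.2 ≠ 0 → ((m * (level ij.2 - level ij.1)).toNat : ℤ) =
        m * (level ij.2 - level ij.1) := by
      intro h0
      refine Int.toNat_of_nonneg ?_
      rcases eq_or_ne ij.1 ij.2 with hij | hij
      · simp [hij]
      · exact (hu _ _ hij h0).le
    by_cases h0 : u.1 ij.1 ij.2 = 0
    · simp [h0]
    · rw [mul_right_comm, ← zpow_add₀ c.ne_zero]
      simp only [map_mul, map_pow, Polynomial.coe_aeval_eq_eval, Polynomial.eval_X,
        Polynomial.eval_C]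
      rw [← zpow_natCast, key h0]
      congr 2
      ring

/-- If `n = 0`, then `P` is the constant `K`; if `n > 0`, evaluating `X ^ n P = K` at `0` gives `K =
0`, and so `P = 0`. -/
lemma eval_zero_of_pow_mul_eval {P : Polynomial ℂ} {n : ℕ} {K : ℂ}
    (h : ∀ c : ℂˣ, (c : ℂ) ^ n * P.eval (c : ℂ) = K) : P.eval 0 = K := by
  have hP : Polynomial.X ^ n * P - Polynomial.C K = 0 := by
    refine Polynomial.eq_zero_of_infinite_isRoot _
      (Set.Infinite.mono (s := {0}ᶜ) ?_ (Set.finite_singleton 0).infinite_compl)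
    intro c hc
    have h' : c ^ n * P.eval c = K := h (Units.mk0 c hc)
    simp [Polynomial.IsRoot, h']
  rw [sub_eq_zero] at hP
  rcases n with _ | n
  · rw [pow_zero, one_mul] at hP
    rw [hP, Polynomial.eval_C]
  · have hK : K = 0 := by
      have := congrArg (Polynomial.eval 0) hP
      simpa using this.symm
    rw [hK, Polynomial.C_0, mul_eq_zero] at hP
    rw [hP.resolve_left (pow_ne_zero _ Polynomial.X_ne_zero), Polynomial.eval_zero, hK]

/-- The conjugated coefficient is a polynomial `P` with `P(0) = φ w`. By the weights of `φ` and `w`,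
it is also `φ (ρ u w)` times a power of `c` whose exponent is at most `0`. The two descriptions
agree only if the values coincide. -/
lemma apply_unipotent_eq (hρ : IsRational ρ) {m : ℤ} {u : Sp} (hd : ∀ i, u.1 i i = 1)
    (hu : ∀ i j, i ≠ j → u.1 i j ≠ 0 → 0 < m * (level j - level i)) {φ : Module.Dual ℂ V}
    {y z : Weight} (hφ : ∀ (p : ℂˣ × ℂˣ) w, φ (ρ (torus p.1 p.2) w) = weightChar y p * φ w)
    {w : V} (hw : w ∈ weightSpace ρ z) (hyz : m * height z ≤ m * height y) :
    φ (ρ u w) = φ w := by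
  obtain ⟨P, hP0, hP⟩ := exists_polynomial_conj hρ hd hu φ w
  rw [← hP0]
  refine (eval_zero_of_pow_mul_eval (n := (m * height y - m * height z).toNat) fun c => ?_).symm
  rw [hP, map_mul, map_mul, Module.End.mul_apply, Module.End.mul_apply, hφ,
    mem_weightSpace.1 hw, map_smul, map_smul, smul_eq_mul, weightChar_cocharacter,
    weightChar_cocharacter, ← zpow_natCast, Int.toNat_of_nonneg (by omega), ← mul_assoc,
    ← mul_assoc, ← zpow_add₀ c.ne_zero, ← zpow_add₀ c.ne_zero]
  convert one_mul _
  convert zpow_zero _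
  ring

lemma eq_top_of_invariant (h : ρ.IsIrreducible) {N : Submodule ℂ V}
    (hN : ∀ g, ∀ v ∈ N, ρ g v ∈ N) (h0 : N ≠ ⊥) : N = ⊤ := by
  let N' : Subrepresentation ρ := ⟨N, hN⟩
  rcases eq_bot_or_eq_top N' with h | h
  · exact (h0 (congrArg Subrepresentation.toSubmodule h)).elim
  · exact congrArg Subrepresentation.toSubmodule h

/-- The realisation of a representation in the functions on the group. -/
def matrixCoefficient (ρ : Representation ℂ Sp V) (f : Module.Dual ℂ V) : V →ₗ[ℂ] Sp → ℂ :=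
  LinearMap.pi fun g => f ∘ₗ ρ g

/-- The kernel is an invariant subspace, and it is not everything because evaluation at `1` recovers
`f`. -/
lemma matrixCoefficient_injective (h : ρ.IsIrreducible) {f : Module.Dual ℂ V} (hf : f ≠ 0) :
    Function.Injective (matrixCoefficient ρ f) := by
  rw [← LinearMap.ker_eq_bot]
  by_contra h0
  have := eq_top_of_invariant h (N := LinearMap.ker (matrixCoefficient ρ f)) ?_ h0
  · refine hf (LinearMap.ext fun v => ?_)
    have hv : v ∈ LinearMap.ker (matrixCoefficient ρ f) := this ▸ Submodule.mem_top
    have := congrFun hv 1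
    simpa [matrixCoefficient] using this
  · intro g v hv
    funext g'
    have := congrFun hv (g' * g)
    simpa [matrixCoefficient] using this

/-- By irreducibility the translates of `v` span the module. The image is therefore spanned by the
right translates of the single function `g ↦ f (ρ g v)`. -/
lemma range_matrixCoefficient (h : ρ.IsIrreducible) (f : Module.Dual ℂ V) {v : V} (hv : v ≠ 0) :
    LinearMap.range (matrixCoefficient ρ f) =
      Submodule.span ℂ (Set.range fun k g => f (ρ (g * k) v)) := by
  have htop : Submodule.span ℂ (Set.range fun k => ρ k v) = ⊤ := by
    refine eq_top_of_invariant h ?_ ?_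
    · intro g w hw
      have := Submodule.mem_map_of_mem (f := ρ g) hw
      rw [Submodule.map_span] at this
      refine Submodule.span_mono ?_ this
      rintro _ ⟨_, ⟨k, rfl⟩, rfl⟩
      exact ⟨g * k, by simp⟩
    · refine (Submodule.ne_bot_iff _).2 ⟨v, Submodule.subset_span ⟨1, by simp⟩, hv⟩
  rw [LinearMap.range_eq_map, ← htop, Submodule.map_span, ← Set.range_comp]
  congr 2
  funext k g
  simp [matrixCoefficient]

/-- The embedding turns `ρ` into right translation. The dimension of a weight space is thus
expressed by the image alone, without reference to the representation. -/
lemma finrank_weightSpace_eq {f : Module.Dual ℂ V}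
    (hf : Function.Injective (matrixCoefficient ρ f)) (y : Weight) :
    Module.finrank ℂ (weightSpace ρ y) = Module.finrank ℂ
      (LinearMap.range (matrixCoefficient ρ f) ⊓ ⨅ p : ℂˣ × ℂˣ, ⨅ g : Sp, LinearMap.ker
        (LinearMap.proj (R := ℂ) (φ := fun _ : Sp => ℂ) (g * torus p.1 p.2) -
          weightChar y p • LinearMap.proj g) : Submodule ℂ (Sp → ℂ)) := by
  refine (Submodule.equivMapOfInjective _ hf (weightSpace ρ y)).finrank_eq.trans ?_
  suffices h : (weightSpace ρ y).map (matrixCoefficient ρ f) = LinearMap.range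
      (matrixCoefficient ρ f) ⊓ ⨅ p : ℂˣ × ℂˣ, ⨅ g : Sp, LinearMap.ker
        (LinearMap.proj (R := ℂ) (φ := fun _ : Sp => ℂ) (g * torus p.1 p.2) -
          weightChar y p • LinearMap.proj g) by rw [h]
  ext F
  simp only [Submodule.mem_map, Submodule.mem_inf, LinearMap.mem_range, Submodule.mem_iInf,
    LinearMap.mem_ker, LinearMap.sub_apply, LinearMap.smul_apply, LinearMap.proj_apply, smul_eq_mul,
    sub_eq_zero]
  constructor
  · rintro ⟨v, hv, rfl⟩
    refine ⟨⟨v, rfl⟩, fun p g => ?_⟩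
    simp [matrixCoefficient, mem_weightSpace.1 hv]
  · rintro ⟨⟨v, rfl⟩, hF⟩
    refine ⟨v, mem_weightSpace.2 fun p => hf ?_, rfl⟩
    funext g
    have := hF p g
    simpa [matrixCoefficient] using this

variable [FiniteDimensional ℂ V]

/-- The functional `φ` composed with the projection to a weight space. -/
def weightFunctional (hρ : IsRational ρ) (y : Weight) (φ : Module.Dual ℂ V) : Module.Dual ℂ V :=
  φ ∘ₗ Finsupp.lapply y ∘ₗ weightComponents hρ

lemma weightFunctional_apply (hρ : IsRational ρ) (y : Weight) (φ : Module.Dual ℂ V) (v : V) :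
    weightFunctional hρ y φ v = φ (weightComponents hρ v y) := rfl

lemma weightFunctional_torus (hρ : IsRational ρ) (y : Weight) (φ : Module.Dual ℂ V)
    (p : ℂˣ × ℂˣ) (w : V) : weightFunctional hρ y φ (ρ (torus p.1 p.2) w) =
      weightChar y p * weightFunctional hρ y φ w := by
  simp only [weightFunctional_apply, weightComponents_torus, map_smul, smul_eq_mul]

end

/-- The functional projects to the weight `x` before applying `φ`. Lower unipotents do not affect it
and upper ones fix `v`, both because no weight has height exceeding that of `x`. -/
lemma IsIrrepOfHighestWeight.exists_isHighestFunction {V : Type*} [AddCommGroup V]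
    [Module ℂ V] {ρ : Representation ℂ Sp V} {x : Weight}
    (h : IsIrrepOfHighestWeight ρ x) :
    ∃ (v : V) (f : Module.Dual ℂ V), f v = 1 ∧
      IsHighestFunction x fun g => f (ρ g v) := by
  have := h.finite
  obtain ⟨v, hv, hv0⟩ := (Submodule.ne_bot_iff _).1 h.weight
  obtain ⟨φ, hφ⟩ := Module.Projective.exists_dual_eq_one ℂ hv0
  have hle : ∀ (w : V) y, weightComponents h.rational w y ≠ 0 → height y ≤ height x := by
    intro w y hy
    exact (h.highest y ((Submodule.ne_bot_iff _).2
      ⟨_, weightComponents_mem_weightSpace h.rational w y, hy⟩)).height_le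
  refine ⟨v, weightFunctional h.rational x φ, ?_, ?_, ?_, ?_, ?_⟩
  · rw [weightFunctional_apply, weightComponents_of_mem _ hv, Finsupp.single_eq_same, hφ]
  · exact h.rational _ _
  · intro u g hu
    rw [map_mul, Module.End.mul_apply]
    generalize ρ g v = w
    rw [← sum_weightComponents h.rational w]
    simp only [Finsupp.sum, map_sum]
    refine Finset.sum_congr rfl fun y hy => ?_
    refine apply_unipotent_eq h.rational (m := 1) hu.1 (fun i j hij h0 => ?_)
      (weightFunctional_torus _ _ _) (weightComponents_mem_weightSpace h.rational w y) ?_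
    · by_contra hl
      exact h0 (hu.2 i j hij (by omega))
    · simpa using hle w y (Finsupp.mem_support_iff.1 hy)
  · intro u g hu
    rw [map_mul, Module.End.mul_apply]
    congr 2
    have : weightComponents h.rational (ρ u v) = weightComponents h.rational v := by
      ext y
      by_cases hy : height y ≤ height x
      · rw [← sub_eq_zero, ← Module.forall_dual_apply_eq_zero_iff ℂ]
        intro ψ
        rw [map_sub, sub_eq_zero]
        refine apply_unipotent_eq h.rational (φ := weightFunctional h.rational y ψ) (m := -1) hu.1
          (fun i j hij h0 => ?_) (weightFunctional_torus _ _ _) hv (by omega)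
        by_contra hl
        exact h0 (hu.2 i j hij (by omega))
      · rw [not_ne_iff.1 fun h0 => hy (hle (ρ u v) y h0), not_ne_iff.1 fun h0 => hy (hle v y h0)]
    rw [← sum_weightComponents h.rational (ρ u v), this, sum_weightComponents]
  · intro a b g
    rw [map_mul, Module.End.mul_apply]
    exact weightFunctional_torus _ _ _ (a, b) _

/-- The normalised highest functions of the two modules agree at `1`, hence everywhere. Both modules
then have the same image in the functions on the group. One-dimensionality of the highest weight
space is not needed. -/
theorem IsIrrepOfHighestWeight.finrank_weightSpace_eq {V₁ V₂ : Type*} [AddCommGroup V₁]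
    [Module ℂ V₁] [AddCommGroup V₂] [Module ℂ V₂] {ρ₁ : Representation ℂ Sp V₁}
    {ρ₂ : Representation ℂ Sp V₂} {x : Weight} (h₁ : IsIrrepOfHighestWeight ρ₁ x)
    (h₂ : IsIrrepOfHighestWeight ρ₂ x) (y : Weight) :
    Module.finrank ℂ (weightSpace ρ₁ y) = Module.finrank ℂ (weightSpace ρ₂ y) := by
  have := h₁.finite
  have := h₂.finite
  obtain ⟨v₁, f₁, hv₁, hc₁⟩ := h₁.exists_isHighestFunction
  obtain ⟨v₂, f₂, hv₂, hc₂⟩ := h₂.exists_isHighestFunction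
  have hc : ∀ g, f₁ (ρ₁ g v₁) = f₂ (ρ₂ g v₂) := by
    intro g
    rw [← sub_eq_zero]
    refine IsHighestFunction.eq_zero (c := fun g => f₁ (ρ₁ g v₁) - f₂ (ρ₂ g v₂)) (x := x)
      ⟨?_, fun u g hu => ?_, fun u g hu => ?_, fun a b g => ?_⟩ ?_ g
    · obtain ⟨p₁, hp₁⟩ := hc₁.regular
      obtain ⟨p₂, hp₂⟩ := hc₂.regular
      exact ⟨p₁ - p₂, fun g => by rw [map_sub, ← hp₁, ← hp₂]⟩
    · exact congrArg₂ _ (hc₁.lower u g hu) (hc₂.lower u g hu)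
    · exact congrArg₂ _ (hc₁.upper u g hu) (hc₂.upper u g hu)
    · exact (congrArg₂ _ (hc₁.torus a b g) (hc₂.torus a b g)).trans (mul_sub _ _ _).symm
    · simp [hv₁, hv₂]
  have ne₁ : f₁ ≠ 0 ∧ v₁ ≠ 0 := by constructor <;> rintro rfl <;> simp at hv₁
  have ne₂ : f₂ ≠ 0 ∧ v₂ ≠ 0 := by constructor <;> rintro rfl <;> simp at hv₂
  rw [SpFour.finrank_weightSpace_eq (matrixCoefficient_injective h₁.irreducible ne₁.1),
    SpFour.finrank_weightSpace_eq (matrixCoefficient_injective h₂.irreducible ne₂.1),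
    range_matrixCoefficient h₁.irreducible f₁ ne₁.2,
    range_matrixCoefficient h₂.irreducible f₂ ne₂.2]
  rw [show (fun k g => f₁ (ρ₁ (g * k) v₁)) = fun k g => f₂ (ρ₂ (g * k) v₂) from
    funext fun k => funext fun g => hc _]

lemma weightMult_eq {n : ℕ} {ρ : Representation ℂ Sp (Fin n → ℂ)} {x : Weight}
    (h : IsIrrepOfHighestWeight ρ x) (y : Weight) :
    weightMult x y = Module.finrank ℂ (weightSpace ρ y) := by
  have h' : ∃ V : Σ n : ℕ, Representation ℂ Sp (Fin n → ℂ), IsIrrepOfHighestWeight V.2 x :=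
    ⟨⟨n, ρ⟩, h⟩
  rw [weightMult, dif_pos h']
  exact h'.choose_spec.finrank_weightSpace_eq h y

/-! ### The fundamental representations -/

open Matrix

section

variable {n : ℕ} {ρ : Representation ℂ Sp (Fin n → ℂ)} {wt : Fin n → Weight}

lemma mem_weightSpace_of_diagonal
    (hdiag : ∀ p v i, ρ (torus p.1 p.2) v i = weightChar (wt i) p * v i) {y : Weight}
    {v : Fin n → ℂ} : v ∈ weightSpace ρ y ↔ ∀ i, wt i ≠ y → v i = 0 := by
  rw [mem_weightSpace]
  constructor
  · intro h i hi
    by_contra h0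
    refine hi (weightChar_injective (MonoidHom.ext fun p => ?_))
    have := congrFun (h p) i
    rw [hdiag, Pi.smul_apply, smul_eq_mul] at this
    exact mul_right_cancel₀ h0 this
  · intro h p
    funext i
    rw [hdiag, Pi.smul_apply, smul_eq_mul]
    by_cases hi : wt i = y
    · rw [hi]
    · rw [h i hi, mul_zero, mul_zero]

lemma weightSpace_eq_span
    (hdiag : ∀ p v i, ρ (torus p.1 p.2) v i = weightChar (wt i) p * v i)
    (hinj : Function.Injective wt) (i : Fin n) :
    weightSpace ρ (wt i) = Submodule.span ℂ {Pi.single i 1} := by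
  ext v
  rw [mem_weightSpace_of_diagonal hdiag, Submodule.mem_span_singleton]
  constructor
  · intro h
    refine ⟨v i, ?_⟩
    funext j
    rcases eq_or_ne j i with rfl | hj
    · simp
    · simp [hj, h j (hinj.ne hj)]
  · rintro ⟨a, rfl⟩ j hj
    have : j ≠ i := fun h => hj (h ▸ rfl)
    simp [this]

lemma finrank_weightSpace_of_diagonal
    (hdiag : ∀ p v i, ρ (torus p.1 p.2) v i = weightChar (wt i) p * v i)
    (hinj : Function.Injective wt) (i : Fin n) :
    Module.finrank ℂ (weightSpace ρ (wt i)) = 1 := by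
  rw [weightSpace_eq_span hdiag hinj, finrank_span_singleton]
  simp

/-- A rational representation with pairwise distinct weights, such that some group element has
no vanishing matrix coefficients in a basis of weight vectors, is irreducible. -/
lemma isIrrepOfHighestWeight_of_diagonal [NeZero n] (hρ : IsRational ρ)
    (hdiag : ∀ p v i, ρ (torus p.1 p.2) v i = weightChar (wt i) p * v i)
    (hinj : Function.Injective wt) {g : Sp} (hg : ∀ i j, ρ g (Pi.single j 1) i ≠ 0) (k : Fin n)
    (hk : ∀ i, DominanceLE (wt i) (wt k)) : IsIrrepOfHighestWeight ρ (wt k) := by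
  have hsingle : ∀ i, (Pi.single i 1 : Fin n → ℂ) ≠ 0 := fun i => by simp
  have hne : ∀ y, weightSpace ρ y ≠ ⊥ → ∃ i, wt i = y := by
    intro y hy
    obtain ⟨v, hv, hv0⟩ := (Submodule.ne_bot_iff _).1 hy
    by_contra! h
    exact hv0 (funext fun i => (mem_weightSpace_of_diagonal hdiag).1 hv i (h i))
  have hcomp : ∀ (v : Fin n → ℂ) i, weightComponents hρ v (wt i) = Pi.single i (v i) := by
    intro v i
    have key : weightComponents hρ v = ∑ j, Finsupp.single (wt j) (Pi.single j (v j)) := by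
      conv_lhs => rw [← Finset.univ_sum_single v]
      rw [map_sum]
      refine Finset.sum_congr rfl fun j _ => weightComponents_of_mem hρ ?_
      rw [mem_weightSpace_of_diagonal hdiag]
      intro i hi
      have : i ≠ j := fun h => hi (h ▸ rfl)
      simp [this]
    rw [key, Finsupp.finsetSum_apply, Finset.sum_eq_single i]
    · simp
    · intro j _ hj
      exact Finsupp.single_eq_of_ne' (hinj.ne hj)
    · simp
  have hirr : ∀ N : Submodule ℂ (Fin n → ℂ), (∀ g, ∀ v ∈ N, ρ g v ∈ N) → N = ⊥ ∨ N = ⊤ := by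
    intro N hN
    refine or_iff_not_imp_left.2 fun h0 => ?_
    -- An invariant subspace contains the weight components of its vectors. The weights being
    -- distinct, these are multiples of basis vectors; applying `g` to one basis vector then yields
    -- all of them.
    have hmem : ∀ v ∈ N, ∀ i, v i ≠ 0 → (Pi.single i 1 : Fin n → ℂ) ∈ N := by
      intro v hv i hi
      have := N.smul_mem (v i)⁻¹ (weightComponents_mem hρ hN hv (wt i))
      rwa [hcomp, ← Pi.single_smul', smul_eq_mul, inv_mul_cancel₀ hi] at this
    obtain ⟨v, hv, hv0⟩ := (Submodule.ne_bot_iff _).1 h0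
    obtain ⟨j, hj⟩ := Function.ne_iff.1 hv0
    refine eq_top_iff.2 fun w _ => ?_
    rw [pi_eq_sum_univ' w]
    refine N.sum_mem fun i _ => N.smul_mem _ ?_
    have := hmem _ (hN g _ (hmem v hv j hj)) i (hg i j)
    convert this using 1
  refine ⟨inferInstance, hρ, ?_, ?_, ?_⟩
  · have : Nontrivial (Subrepresentation ρ) := by
      refine ⟨⟨⊥, ⊤, fun h => ?_⟩⟩
      exact bot_ne_top (congrArg Subrepresentation.toSubmodule h)
    refine ⟨fun N => ?_⟩
    rcases hirr N.toSubmodule fun g v hv => N.apply_mem_toSubmodule g hv with h | h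
    · exact Or.inl (Subrepresentation.toSubmodule_injective h)
    · exact Or.inr (Subrepresentation.toSubmodule_injective h)
  · rw [weightSpace_eq_span hdiag hinj]
    simp
  · intro y hy
    obtain ⟨i, rfl⟩ := hne y hy
    exact hk i

end

lemma isRegular_entry (i j : Fin 2 ⊕ Fin 2) : IsRegular fun g => g.1 i j :=
  ⟨MvPolynomial.X (i, j), fun g => by simp only [MvPolynomial.eval_X]⟩

lemma isRational_of_apply {n : ℕ} {ρ : Representation ℂ Sp (Fin n → ℂ)}
    (h : ∀ i j, IsRegular fun g => ρ g (Pi.single j 1) i) : IsRational ρ := by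
  choose P hP using h
  intro f v
  refine ⟨∑ i, ∑ j, MvPolynomial.C (f (Pi.single i 1) * v j) * P i j, fun g => ?_⟩
  have hv : ρ g v = ∑ j, v j • ρ g (Pi.single j 1) := by
    conv_lhs => rw [← Finset.univ_sum_single v]
    rw [map_sum]
    refine Finset.sum_congr rfl fun j _ => ?_
    rw [← map_smul, ← Pi.single_smul', smul_eq_mul, mul_one]
  have hf : ∀ w : Fin n → ℂ, f w = ∑ i, w i * f (Pi.single i 1) := by
    intro w
    conv_lhs => rw [← Finset.univ_sum_single w]
    rw [map_sum]
    refine Finset.sum_congr rfl fun j _ => ?_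
    rw [← smul_eq_mul, ← map_smul, ← Pi.single_smul', smul_eq_mul, mul_one]
  rw [hf, hv, map_sum]
  refine Finset.sum_congr rfl fun i _ => ?_
  rw [map_sum, Finset.sum_apply, Finset.sum_mul]
  refine Finset.sum_congr rfl fun j _ => ?_
  rw [map_mul, MvPolynomial.eval_C, ← hP, Pi.smul_apply, smul_eq_mul]
  ring

/-- A symplectic matrix with no vanishing matrix coefficients in the fundamental
representations. -/
def genericElement : Sp :=
  ⟨fromBlocks !![-2, -4; 1, -5] !![1, -5; -3, -5] !![-3, 2; 3, 1] !![4, 1; -3, 2], by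
    rw [SymplecticGroup.mem_iff, J, fromBlocks_transpose, fromBlocks_multiply, fromBlocks_multiply,
      fromBlocks_inj]
    refine ⟨?_, ?_, ?_, ?_⟩ <;> ext i j <;> fin_cases i <;> fin_cases j <;>
      simp [Matrix.vecMul, dotProduct, Fin.sum_univ_two] <;> norm_num⟩

/-! #### The standard representation -/

/-- The enumeration of the basis vectors of `ℂ⁴`. -/
def stdIndex : Fin 4 ≃ Fin 2 ⊕ Fin 2 := (finSumFinEquiv (m := 2) (n := 2)).symm

/-- The standard representation of `Sp₄(ℂ)` on `ℂ⁴`. -/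
def stdRep : Representation ℂ Sp (Fin 4 → ℂ) :=
  (MonoidHomClass.toMonoidHom (Matrix.toLinAlgEquiv' (R := ℂ) (n := Fin 4))).comp
    ((MonoidHomClass.toMonoidHom (Matrix.reindexAlgEquiv ℂ ℂ stdIndex.symm)).comp
      (Matrix.symplecticGroup (Fin 2) ℂ).subtype)

lemma stdRep_apply (g : Sp) (v : Fin 4 → ℂ) (i : Fin 4) : stdRep g v i =
    ∑ j, g.1 (stdIndex i) (stdIndex j) * v j := rfl

lemma stdRep_single (g : Sp) (i j : Fin 4) : stdRep g (Pi.single j 1) i =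
    g.1 (stdIndex i) (stdIndex j) := by
  rw [stdRep_apply]
  simp [Pi.single_apply]

lemma stdRep_torus (p : ℂˣ × ℂˣ) (v : Fin 4 → ℂ) (i : Fin 4) : stdRep (torus p.1 p.2) v i =
    weightChar (stdWeight (stdIndex i)) p * v i := by
  rw [stdRep_apply]
  simp [torus_apply]

lemma stdWeight_injective : Function.Injective stdWeight := by
  rintro (i | i) (j | j) <;> fin_cases i <;> fin_cases j <;> simp [stdWeight]

lemma weightMult_x₂ : weightMult x₂ x₂ = 1 := by
  have hinj : Function.Injective fun i : Fin 4 => stdWeight (stdIndex i) :=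
    stdWeight_injective.comp (Equiv.injective _)
  have h : IsIrrepOfHighestWeight stdRep x₂ := by
    refine isIrrepOfHighestWeight_of_diagonal
      (wt := fun i : Fin 4 => stdWeight (stdIndex i)) (g := genericElement)
      (isRational_of_apply fun i j => ?_) stdRep_torus hinj (fun i j => ?_)
      (stdIndex.symm (Sum.inl 1)) (fun i => ?_)
    · simp only [stdRep_single]
      exact isRegular_entry _ _
    · rw [stdRep_single]
      generalize stdIndex i = i
      generalize stdIndex j = j
      rcases i with i | i <;> rcases j with j | j <;> fin_cases i <;> fin_cases j <;>
        simp [genericElement]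
    · rw [Equiv.apply_symm_apply, dominanceLE_iff]
      generalize stdIndex i = i
      rcases i with i | i <;> fin_cases i
      · exact ⟨0, 1, by decide, by decide⟩
      · exact ⟨0, 0, by decide, by decide⟩
      · exact ⟨1, 1, by decide, by decide⟩
      · exact ⟨1, 2, by decide, by decide⟩
  rw [weightMult_eq h]
  exact finrank_weightSpace_of_diagonal stdRep_torus hinj (stdIndex.symm (Sum.inl 1))

/-! #### The primitive part of the exterior square -/

/-- The skew-symmetric matrix `X` with `trace (J * X) = 0` and the given coordinates. -/
def primitiveMatrix : (Fin 5 → ℂ) →ₗ[ℂ] Matrix (Fin 2 ⊕ Fin 2) (Fin 2 ⊕ Fin 2) ℂ where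
  toFun v := fromBlocks !![0, v 0; -v 0, 0] !![v 4, v 1; v 2, -v 4]
    !![-v 4, -v 2; -v 1, v 4] !![0, v 3; -v 3, 0]
  map_add' v w := by
    rw [fromBlocks_add]
    congr 1 <;> ext i j <;> fin_cases i <;> fin_cases j <;> simp <;> ring
  map_smul' a v := by
    rw [fromBlocks_smul]
    congr 1 <;> ext i j <;> fin_cases i <;> fin_cases j <;> simp

/-- The coordinates of a skew-symmetric matrix `X` with `trace (J * X) = 0`. -/
def primitiveCoord : Matrix (Fin 2 ⊕ Fin 2) (Fin 2 ⊕ Fin 2) ℂ →ₗ[ℂ] Fin 5 → ℂ where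
  toFun X := ![X (Sum.inl 0) (Sum.inl 1), X (Sum.inl 0) (Sum.inr 1), X (Sum.inl 1) (Sum.inr 0),
    X (Sum.inr 0) (Sum.inr 1), X (Sum.inl 0) (Sum.inr 0)]
  map_add' X Y := by ext i; fin_cases i <;> rfl
  map_smul' a X := by ext i; fin_cases i <;> rfl

lemma primitiveCoord_primitiveMatrix (v : Fin 5 → ℂ) : primitiveCoord (primitiveMatrix v) = v := by
  funext i
  fin_cases i <;> rfl

lemma primitiveMatrix_transpose (v : Fin 5 → ℂ) : (primitiveMatrix v)ᵀ = -primitiveMatrix v := by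
  ext i j
  rcases i with i | i <;> rcases j with j | j <;> fin_cases i <;> fin_cases j <;>
    simp [primitiveMatrix]

lemma trace_J_mul (X : Matrix (Fin 2 ⊕ Fin 2) (Fin 2 ⊕ Fin 2) ℂ) :
    (J (Fin 2) ℂ * X).trace = X (Sum.inl 0) (Sum.inr 0) + X (Sum.inl 1) (Sum.inr 1) -
      X (Sum.inr 0) (Sum.inl 0) - X (Sum.inr 1) (Sum.inl 1) := by
  simp [Matrix.trace, Matrix.mul_apply, Fintype.sum_sum_type, Fin.sum_univ_two, J,
    Matrix.one_apply]
  ring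

lemma trace_J_mul_primitiveMatrix (v : Fin 5 → ℂ) :
    (J (Fin 2) ℂ * primitiveMatrix v).trace = 0 := by
  rw [trace_J_mul]
  simp [primitiveMatrix]

/-- Skew-symmetry leaves six free entries and the trace condition relates two of them, so the five
coordinates determine the matrix. -/
lemma primitiveMatrix_primitiveCoord {X : Matrix (Fin 2 ⊕ Fin 2) (Fin 2 ⊕ Fin 2) ℂ} (hX : Xᵀ = -X)
    (htr : (J (Fin 2) ℂ * X).trace = 0) : primitiveMatrix (primitiveCoord X) = X := by
  have hs : ∀ i j, X j i = -X i j := fun i j => congrFun (congrFun hX i) j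
  have h0 : ∀ i, X i i = 0 := fun i => by
    have := hs i i
    linear_combination this / 2
  have h1 : X (Sum.inl 1) (Sum.inr 1) = -X (Sum.inl 0) (Sum.inr 0) := by
    rw [trace_J_mul, hs (Sum.inl 0) (Sum.inr 0), hs (Sum.inl 1) (Sum.inr 1)] at htr
    linear_combination htr / 2
  ext i j
  rcases i with i | i <;> rcases j with j | j <;> fin_cases i <;> fin_cases j <;>
    simp [primitiveMatrix, primitiveCoord, h0, h1, hs (Sum.inl 0), hs (Sum.inl 1) (Sum.inr 0),
      hs (Sum.inl 1) (Sum.inr 1), hs (Sum.inr 0) (Sum.inr 1)]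

lemma primitiveMatrix_conj (g : Sp) (v : Fin 5 → ℂ) :
    primitiveMatrix (primitiveCoord (g.1 * primitiveMatrix v * g.1ᵀ)) =
      g.1 * primitiveMatrix v * g.1ᵀ := by
  refine primitiveMatrix_primitiveCoord ?_ ?_
  · rw [Matrix.transpose_mul, Matrix.transpose_mul, Matrix.transpose_transpose,
      primitiveMatrix_transpose, Matrix.neg_mul, Matrix.mul_neg, Matrix.mul_assoc]
  · rw [← Matrix.mul_assoc, Matrix.trace_mul_comm, ← Matrix.mul_assoc, ← Matrix.mul_assoc,
      SymplecticGroup.mem_iff'.1 g.2, trace_J_mul_primitiveMatrix]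

lemma conj_primitiveMatrix_apply (A : Matrix (Fin 2 ⊕ Fin 2) (Fin 2 ⊕ Fin 2) ℂ) (v : Fin 5 → ℂ)
    (i j : Fin 2 ⊕ Fin 2) : (A * primitiveMatrix v * Aᵀ) i j =
      v 0 * (A i (Sum.inl 0) * A j (Sum.inl 1) - A i (Sum.inl 1) * A j (Sum.inl 0)) +
      v 1 * (A i (Sum.inl 0) * A j (Sum.inr 1) - A i (Sum.inr 1) * A j (Sum.inl 0)) +
      v 2 * (A i (Sum.inl 1) * A j (Sum.inr 0) - A i (Sum.inr 0) * A j (Sum.inl 1)) +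
      v 3 * (A i (Sum.inr 0) * A j (Sum.inr 1) - A i (Sum.inr 1) * A j (Sum.inr 0)) +
      v 4 * (A i (Sum.inl 0) * A j (Sum.inr 0) - A i (Sum.inr 0) * A j (Sum.inl 0) -
        (A i (Sum.inl 1) * A j (Sum.inr 1) - A i (Sum.inr 1) * A j (Sum.inl 1))) := by
  simp [Matrix.mul_apply, Fintype.sum_sum_type, Fin.sum_univ_two, primitiveMatrix]
  ring

/-- The map `X ↦ A * X * Aᵀ` in coordinates. -/
def primitiveEnd (A : Matrix (Fin 2 ⊕ Fin 2) (Fin 2 ⊕ Fin 2) ℂ) : Module.End ℂ (Fin 5 → ℂ) :=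
  primitiveCoord ∘ₗ LinearMap.mulRight ℂ Aᵀ ∘ₗ LinearMap.mulLeft ℂ A ∘ₗ primitiveMatrix

lemma primitiveEnd_apply (A : Matrix (Fin 2 ⊕ Fin 2) (Fin 2 ⊕ Fin 2) ℂ) (v : Fin 5 → ℂ) :
    primitiveEnd A v = primitiveCoord (A * primitiveMatrix v * Aᵀ) := rfl

lemma primitiveEnd_one : primitiveEnd 1 = 1 := by
  refine LinearMap.ext fun v => ?_
  rw [primitiveEnd_apply, Matrix.one_mul, Matrix.transpose_one, Matrix.mul_one,
    primitiveCoord_primitiveMatrix, Module.End.one_apply]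

/-- Only the right factor has to be symplectic: conjugation by it must preserve the trace condition
for the coordinates to lose no information. -/
lemma primitiveEnd_mul (A : Matrix (Fin 2 ⊕ Fin 2) (Fin 2 ⊕ Fin 2) ℂ) (h : Sp) :
    primitiveEnd (A * h.1) = primitiveEnd A * primitiveEnd h.1 := by
  refine LinearMap.ext fun v => ?_
  rw [Module.End.mul_apply, primitiveEnd_apply, primitiveEnd_apply, primitiveEnd_apply,
    primitiveMatrix_conj, Matrix.transpose_mul]
  simp only [Matrix.mul_assoc]

/-- The representation of `Sp₄(ℂ)` on the skew-symmetric matrices `X` with `trace (J * X) = 0`. -/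
def primitiveRep : Representation ℂ Sp (Fin 5 → ℂ) where
  toFun g := primitiveEnd g.1
  map_one' := primitiveEnd_one
  map_mul' g h := primitiveEnd_mul g.1 h

lemma primitiveRep_apply (g : Sp) (v : Fin 5 → ℂ) :
    primitiveRep g v = primitiveCoord (g.1 * primitiveMatrix v * g.1ᵀ) := rfl

/-- The weights of `primitiveRep`. -/
def primitiveWeight : Fin 5 → Weight := ![(1, 1), (1, -1), (-1, 1), (-1, -1), (0, 0)]

lemma primitiveWeight_injective : Function.Injective primitiveWeight := by
  intro i j
  fin_cases i <;> fin_cases j <;> simp [primitiveWeight]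

lemma primitiveRep_torus (p : ℂˣ × ℂˣ) (v : Fin 5 → ℂ) (i : Fin 5) :
    primitiveRep (torus p.1 p.2) v i = weightChar (primitiveWeight i) p * v i := by
  have h : ∀ X : Matrix (Fin 2 ⊕ Fin 2) (Fin 2 ⊕ Fin 2) ℂ, ∀ i j,
      ((torus p.1 p.2).1 * X * (torus p.1 p.2).1ᵀ) i j =
        weightChar (stdWeight i + stdWeight j) p * X i j := by
    intro X i j
    simp only [Matrix.mul_apply, torus_apply, Matrix.transpose_apply, weightChar_add]
    simp
    ring
  rw [primitiveRep_apply]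
  fin_cases i <;> exact h _ _ _

lemma isRegular_primitiveRep (i j : Fin 5) :
    IsRegular fun g => primitiveRep g (Pi.single j 1) i := by
  have h : ∀ (X : Matrix (Fin 2 ⊕ Fin 2) (Fin 2 ⊕ Fin 2) ℂ) i j,
      IsRegular fun g => (g.1 * X * g.1ᵀ) i j := by
    intro X i j
    refine ⟨∑ k, (∑ l, MvPolynomial.X (i, l) * MvPolynomial.C (X l k)) * MvPolynomial.X (j, k),
      fun g => ?_⟩
    simp only [Matrix.mul_apply, Matrix.transpose_apply, map_sum, map_mul, MvPolynomial.eval_X,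
      MvPolynomial.eval_C]
  simp only [primitiveRep_apply]
  fin_cases i <;> exact h _ _ _

lemma isIrrepOfHighestWeight_primitiveRep : IsIrrepOfHighestWeight primitiveRep x₁ := by
  refine isIrrepOfHighestWeight_of_diagonal (g := genericElement)
    (isRational_of_apply isRegular_primitiveRep) primitiveRep_torus primitiveWeight_injective
    (fun i j => ?_) 0 (fun i => ?_)
  · rw [primitiveRep_apply]
    fin_cases i <;>
    · refine (conj_primitiveMatrix_apply _ _ _ _).trans_ne ?_
      fin_cases j <;> simp [genericElement] <;> norm_num
  · rw [dominanceLE_iff]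
    fin_cases i
    · exact ⟨0, 0, by decide, by decide⟩
    · exact ⟨1, 2, by decide, by decide⟩
    · exact ⟨1, 0, by decide, by decide⟩
    · exact ⟨2, 2, by decide, by decide⟩
    · exact ⟨1, 1, by decide, by decide⟩

/-- The weight `0` is the one at index `4`: the trace condition cuts the two-dimensional zero weight
space of the exterior square down to a line. -/
lemma weightMult_x₁ (i : Fin 5) : weightMult x₁ (primitiveWeight i) = 1 := by
  rw [weightMult_eq isIrrepOfHighestWeight_primitiveRep]
  exact finrank_weightSpace_of_diagonal primitiveRep_torus primitiveWeight_injective i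

end SpFour

end

open SpFour in
theorem lemma3p2 :
    C (r * t) * S x₁ =
        C (r * s * t * s * t * r) + C (t * s * r * s * r * t) - two • C (r * t * s * r * t)
          + C (r * t) ∧
      C (r * t) * S x₂ = (C (r * t * s * r * t) - two • C (r * t)) * C ω := by
  exact ⟨C_rt_mul_S_x₁ (weightMult_x₁ 0) (weightMult_x₁ 4), C_rt_mul_S_x₂ weightMult_x₂⟩
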